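/- Let $g\ge 2$, let $\Sigma$ be a closed oriented surface of genus $g$, i.e. a smooth surface presented as the connected sum of a chain of $g$ tori $\mathbb T_i=\mathbb R^2/\mathbb Z^2$ ($i=1,\dots,g$), and let $\omega$ be any symplectic form on $\Sigma$. Let $a_i$ and $b_i$ be the loops in $\Sigma$ given by a vertical and a horizontal circle of $\mathbb T_i$ that avoid the regions where the tori are glued, and identify $H^1(\Sigma;\mathbb R)$ with $\mathbb R^{2g}$ by $[\theta]\mapsto\left(\int_{a_1}\theta,\int_{b_1}\theta,\dots,\int_{a_g}\theta,\int_{b_g}\theta\right)$. The flux of a symplectic isotopy $\phi_t$, $t\in[0,1]$, of $(\Sigma,\omega)$ with $\phi_0=\mathrm{id}$ and $\frac{d}{dt}\phi_t=X_t\circ\phi_t$ is $\left[\int_0^1\omega(X_t,\cdot)\,dt\right]\in H^1(\Sigma;\mathbb R)\cong\mathbb R^{2g}$. Then for every $(u_1,v_1,\dots,u_g,v_g)\in\mathbb R^{2g}$ such that $u_i\ne 0$ and $v_i/u_i\in\mathbb R\setminus\mathbb Q$ for $i=1,\dots,g$, there is a smooth flow $\psi^t\colon\Sigma\to\Sigma$,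 $t\in\mathbb R$, that preserves $\omega$, such that 1. every periodic orbit of $\psi^t$ is a fixed point, i.e. if $\psi^T(p)=p$ for some $T>0$, then $\psi^t(p)=p$ for all $t$; 2. $\psi^t$ has exactly $2g-2$ fixed points, and each fixed point $p$ is hyperbolic, i.e. the eigenvalues of $d\psi^1_p\colon T_p\Sigma\to T_p\Sigma$ are real and different from $\pm1$; 3. the flux of $\psi^t|_{t\in[0,1]}$ is $(u_1,v_1,\dots,u_g,v_g)$. -/

import Mathlib

open scoped Manifold ContDiff

noncomputable section

namespace SurfaceFlow

/-! ### Closed surfaces of genus `g` as connected sums of `g` tori -/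

/-- The lattice `ℤ + ℤ i` in `ℂ`. -/
def IsLattice (c : ℂ) : Prop := ∃ m n : ℤ, c = m + n * Complex.I

/-- Centre of the disc removed from a torus `ℂ / (ℤ + ℤ i)` to attach the previous torus. -/
def leftCentre : ℂ := 0

/-- Centre of the disc removed from a torus `ℂ / (ℤ + ℤ i)` to attach the next torus. -/
def rightCentre : ℂ := 1 / 2 + 1 / 2 * Complex.I

/-- `c` is a lift to `ℂ` of the centre of a removed disc of the `i`-th torus. The first torus has
no left disc and the last one has no right disc. -/
def IsHoleCentre (g : ℕ) (i : Fin g) (c : ℂ) : Prop :=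
  (0 < (i : ℕ) ∧ IsLattice (c - leftCentre)) ∨ ((i : ℕ) + 1 < g ∧ IsLattice (c - rightCentre))

/-- The lift to `ℂ` of the `i`-th torus minus its closed discs, which have radius `1/16`. -/
def holedPlane (g : ℕ) (i : Fin g) : Set ℂ :=
  {z | ∀ c, IsHoleCentre g i c → 1 / 16 < ‖z - c‖}

/-- The gluing of the annulus `1/16 < |z - rightCentre| < 1/4` of a torus with the annulus
`1/16 < |w - leftCentre| < 1/4` of the next one: `z` and `w` are identified if, for suitable lifts,
`(z - rightCentre) (w - leftCentre) = 1/64`. For points of holed planes both factors have modulus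
larger than `1/16`, hence also smaller than `1/4`. -/
def Glued (z w : ℂ) : Prop :=
  ∃ l m : ℂ, IsLattice l ∧ IsLattice m ∧
    (z - rightCentre - l) * (w - leftCentre - m) = 1 / 64

/-- A presentation of the smooth surface `S` as the connected sum of a chain of `g` tori
`ℂ / (ℤ + ℤ i)`: the `i`-th holed torus is embedded in `S` as an open set by `param i`, these open
sets cover `S`, consecutive ones overlap exactly in the gluing annulus and other ones are disjoint.
For `g ≥ 1`, a compact Hausdorff smooth surface is a closed (connected, orientable) surface of genus
`g` if and only if it has such a presentation. -/
structure TorusSum (g : ℕ) (S : Type*) [TopologicalSpace S]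
    [ChartedSpace (EuclideanSpace ℝ (Fin 2)) S] where
  param : Fin g → ℂ → S
  localDiffeo : ∀ i, ∀ z ∈ holedPlane g i, IsLocalDiffeomorphAt 𝓘(ℝ, ℂ) (𝓡 2) ∞ (param i) z
  cover : ∀ x : S, ∃ i, ∃ z ∈ holedPlane g i, param i z = x
  eq_same : ∀ i, ∀ z ∈ holedPlane g i, ∀ w ∈ holedPlane g i,
    (param i z = param i w ↔ IsLattice (z - w))
  eq_lt : ∀ i j, i < j → ∀ z ∈ holedPlane g i, ∀ w ∈ holedPlane g j,
    (param i z = param j w ↔ (j : ℕ) = i + 1 ∧ Glued z w)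

variable {S : Type*} [TopologicalSpace S] [ChartedSpace (EuclideanSpace ℝ (Fin 2)) S]

/-- The loop `a_i`: the vertical circle `Re z = 1/4` of the `i`-th torus, `s ∈ [0, 1]`. -/
def TorusSum.loopA {g : ℕ} (d : TorusSum g S) (i : Fin g) (s : ℝ) : S :=
  d.param i (1 / 4 + s * Complex.I)

/-- The loop `b_i`: the horizontal circle `Im z = 1/4` of the `i`-th torus, `s ∈ [0, 1]`. -/
def TorusSum.loopB {g : ℕ} (d : TorusSum g S) (i : Fin g) (s : ℝ) : S :=
  d.param i (s + 1 / 4 * Complex.I)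

/-! ### Vector fields, differential forms, periods -/

variable (S) in
/-- Vector fields on `S` (no regularity required). -/
abbrev VField := (p : S) → TangentSpace (𝓡 2) p

variable (S) in
/-- Differential 1-forms on `S` (no regularity required). -/
abbrev OneForm := (p : S) → TangentSpace (𝓡 2) p →L[ℝ] ℝ

variable (S) in
/-- Bilinear forms on the tangent spaces of `S`. -/
abbrev BilinForm := (p : S) → TangentSpace (𝓡 2) p →L[ℝ] TangentSpace (𝓡 2) p →L[ℝ] ℝ

/-- Symplectic forms on a surface: smooth, alternating and non-degenerate (closedness is automatic,
as there are no non-zero 3-forms in dimension two). -/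
structure IsSymplecticForm [IsManifold (𝓡 2) ∞ S] (Ω : BilinForm S) : Prop where
  smooth : ContMDiff (𝓡 2) ((𝓡 2).prod
      𝓘(ℝ, EuclideanSpace ℝ (Fin 2) →L[ℝ] EuclideanSpace ℝ (Fin 2) →L[ℝ] ℝ)) ∞
    (fun p => Bundle.TotalSpace.mk'
      (EuclideanSpace ℝ (Fin 2) →L[ℝ] EuclideanSpace ℝ (Fin 2) →L[ℝ] ℝ)
      (E := fun p : S => TangentSpace (𝓡 2) p →L[ℝ] TangentSpace (𝓡 2) p →L[ℝ] ℝ) p (Ω p))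
  alternating : ∀ p v, Ω p v v = 0
  nondegenerate : ∀ p v, (∀ w, Ω p v w = 0) → v = 0

/-- The contraction `Ω(X, ·)`. -/
def contraction (Ω : BilinForm S) (X : VField S) : OneForm S := fun p => Ω p (X p)

/-- The coordinate expression of a 1-form in the preferred chart at `p`. -/
def OneForm.inChart (α : OneForm S) (p : S) (y : EuclideanSpace ℝ (Fin 2)) :
    EuclideanSpace ℝ (Fin 2) →L[ℝ] ℝ :=
  (α ((extChartAt (𝓡 2) p).symm y)).comp
    (mfderiv 𝓘(ℝ, EuclideanSpace ℝ (Fin 2)) (𝓡 2) (extChartAt (𝓡 2) p).symm y)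

/-- A closed 1-form: smooth in the charts, and with `dα = 0` there. -/
def OneForm.IsClosed (α : OneForm S) : Prop :=
  ∀ p : S, ContDiffOn ℝ ∞ (α.inChart p) (extChartAt (𝓡 2) p).target ∧
    ∀ y ∈ (extChartAt (𝓡 2) p).target, ∀ v w,
      fderiv ℝ (α.inChart p) y v w = fderiv ℝ (α.inChart p) y w v

/-- The integral of a 1-form along a curve parametrized by `[0, 1]`. -/
def OneForm.period (α : OneForm S) (γ : ℝ → S) : ℝ :=
  ∫ s in (0 : ℝ)..1, α (γ s) (mfderiv 𝓘(ℝ, ℝ) (𝓡 2) γ s (1 : ℝ))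

/-! ### Symplectic flows, flux, hyperbolic fixed points -/

/-- A symplectic flow on `(S, Ω)`: a smooth action of `ℝ` on `S` by maps that preserve `Ω`,
together with the vector field `field` that generates it (which it determines). -/
structure SymplecticFlow (Ω : BilinForm S) where
  toFun : ℝ → S → S
  field : VField S
  smooth : ContMDiff (𝓘(ℝ, ℝ).prod (𝓡 2)) (𝓡 2) ∞ (fun x : ℝ × S => toFun x.1 x.2)
  map_zero : ∀ p, toFun 0 p = p
  map_add : ∀ s t p, toFun (s + t) p = toFun s (toFun t p)
  generates : ∀ p, IsMIntegralCurve (I := 𝓡 2) (fun t => toFun t p) field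
  preserves : ∀ t p v w, Ω (toFun t p) (mfderiv (𝓡 2) (𝓡 2) (toFun t) p v)
    (mfderiv (𝓡 2) (𝓡 2) (toFun t) p w) = Ω p v w

/-- The value on a loop `γ` of the flux `[∫₀¹ Ω(X_t, ·) dt]` of an isotopy `φ_t`, `t ∈ [0, 1]`,
with `dφ_t/dt = X_t ∘ φ_t`. -/
def fluxOn (Ω : BilinForm S) (X : ℝ → VField S) (γ : ℝ → S) : ℝ :=
  ∫ t in (0 : ℝ)..1, (contraction Ω (X t)).period γ

/-- The flux of the path `ψ^t`, `t ∈ [0, 1]`, of a symplectic flow is the class with coordinates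
`(u_1, v_1, …, u_g, v_g)`, where the first cohomology is identified with `ℝ^{2g}` by evaluation on
`a_1, b_1, …, a_g, b_g`. The vector field of the path is `X_t = ψ.field` for all `t`. -/
def HasFlux {g : ℕ} (d : TorusSum g S) {Ω : BilinForm S} (ψ : SymplecticFlow Ω)
    (u v : Fin g → ℝ) : Prop :=
  (contraction Ω ψ.field).IsClosed ∧
    ∀ i, fluxOn Ω (fun _ => ψ.field) (d.loopA i) = u i ∧
      fluxOn Ω (fun _ => ψ.field) (d.loopB i) = v i

/-- The derivative of `φ` at a fixed point `p`, as an endomorphism of the tangent space. -/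
def derivAtFixed (φ : S → S) (p : S) (hp : φ p = p) :
    TangentSpace (𝓡 2) p →L[ℝ] TangentSpace (𝓡 2) p :=
  Eq.rec (motive := fun q _ => TangentSpace (𝓡 2) p →L[ℝ] TangentSpace (𝓡 2) q)
    (mfderiv (𝓡 2) (𝓡 2) φ p) hp

/-- A hyperbolic endomorphism of the plane, area-preserving in the applications: all complex
eigenvalues are real and different from `1` and `-1`. -/
def IsHyperbolicMap (A : EuclideanSpace ℝ (Fin 2) →L[ℝ] EuclideanSpace ℝ (Fin 2)) : Prop :=
  ∀ z : ℂ, (A.toLinearMap.charpoly.map (algebraMap ℝ ℂ)).IsRoot z →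
    z.im = 0 ∧ z ≠ 1 ∧ z ≠ -1

/-- A hyperbolic fixed point of a symplectomorphism of a surface. (The tangent space of `S` at `p`
is by definition a copy of `EuclideanSpace ℝ (Fin 2)`.) -/
def IsHyperbolicFixedPoint (φ : S → S) (p : S) : Prop :=
  ∃ hp : φ p = p, IsHyperbolicMap (derivAtFixed φ p hp)

/-- The fixed points of a flow. -/
def SymplecticFlow.fixedPoints {Ω : BilinForm S} (ψ : SymplecticFlow Ω) : Set S :=
  {p | ∀ t, ψ.toFun t p = p}

/-- `p` lies on a periodic orbit (possibly constant) of the flow. -/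
def SymplecticFlow.IsPeriodicPoint {Ω : BilinForm S} (ψ : SymplecticFlow Ω) (p : S) : Prop :=
  ∃ T : ℝ, 0 < T ∧ ψ.toFun T p = p

/-! ### Existence of closed surfaces of genus `g`

The compact Hausdorff smooth surface `Model g`, glued from `g` holed tori, has a presentation
`Model.torusSum g` as a connected sum, so closed surfaces of genus `g` in the above sense exist. -/

theorem IsLattice.neg {c : ℂ} (h : IsLattice c) : IsLattice (-c) := by
  obtain ⟨m, n, rfl⟩ := h
  exact ⟨-m, -n, by push_cast; ring⟩

theorem IsLattice.add {c d : ℂ} (h : IsLattice c) (h' : IsLattice d) : IsLattice (c + d) := by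
  obtain ⟨m, n, rfl⟩ := h
  obtain ⟨m', n', rfl⟩ := h'
  exact ⟨m + m', n + n', by push_cast; ring⟩

theorem IsLattice.sub {c d : ℂ} (h : IsLattice c) (h' : IsLattice d) : IsLattice (c - d) := by
  rw [sub_eq_add_neg]; exact h.add h'.neg

theorem isLattice_zero : IsLattice 0 := ⟨0, 0, by simp⟩

theorem IsLattice.eq_zero {c : ℂ} (h : IsLattice c) (hc : ‖c‖ < 1) : c = 0 := by
  obtain ⟨m, n, rfl⟩ := h
  have h1 := (Complex.abs_re_le_norm _).trans_lt hc
  have h2 := (Complex.abs_im_le_norm _).trans_lt hc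
  simp only [Complex.add_re, Complex.intCast_re, Complex.mul_re, Complex.intCast_im, Complex.I_re,
    Complex.I_im, mul_zero, sub_zero, add_zero, Complex.add_im, Complex.mul_im, mul_one,
    zero_add] at h1 h2
  have h3 : |m| < 1 := by exact_mod_cast h1
  have h4 : |n| < 1 := by exact_mod_cast h2
  rw [Int.abs_lt_one_iff] at h3 h4
  simp [h3, h4]

theorem IsLattice.eq_of_near {l m a : ℂ} (hl : IsLattice l) (hm : IsLattice m)
    (h : ‖a - l‖ + ‖a - m‖ < 1) : l = m := by
  have : l - m = 0 := (hl.sub hm).eq_zero <| by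
    have : l - m = (a - m) - (a - l) := by ring
    rw [this]
    linarith [norm_sub_le (a - m) (a - l)]
  exact sub_eq_zero.1 this

theorem half_le_norm {c d : ℂ} (hc : IsLattice (c - leftCentre))
    (hd : IsLattice (d - rightCentre)) : 1 / 2 ≤ ‖c - d‖ := by
  obtain ⟨m, n, h⟩ := hc.sub hd
  have h' : c - d = m + n * Complex.I - rightCentre := by
    rw [← h]; simp only [leftCentre]; ring
  have hre : (c - d).re = m - 1 / 2 := by
    rw [h']; simp [rightCentre]
  refine le_trans ?_ (Complex.abs_re_le_norm _)
  rw [hre]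
  rcases le_or_gt m 0 with hm | hm
  · have : (m : ℝ) ≤ 0 := by exact_mod_cast hm
    rw [abs_of_nonpos] <;> linarith
  · have : (1 : ℝ) ≤ m := by exact_mod_cast hm
    rw [abs_of_nonneg] <;> linarith

theorem holes_apart {g : ℕ} {i : Fin g} {c d : ℂ} (hc : IsHoleCentre g i c)
    (hd : IsHoleCentre g i d) (h : ‖c - d‖ < 1 / 2) : c = d := by
  rcases hc with ⟨_, hc⟩ | ⟨_, hc⟩ <;> rcases hd with ⟨_, hd⟩ | ⟨_, hd⟩
  · have := (hc.sub hd).eq_zero (by simpa using by linarith)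
    simpa [sub_eq_zero] using this
  · linarith [half_le_norm hc hd]
  · rw [norm_sub_rev] at h; linarith [half_le_norm hd hc]
  · have := (hc.sub hd).eq_zero (by simpa using by linarith)
    simpa [sub_eq_zero] using this

theorem IsHoleCentre.add {g : ℕ} {i : Fin g} {c l : ℂ} (hc : IsHoleCentre g i c)
    (hl : IsLattice l) : IsHoleCentre g i (c + l) := by
  rcases hc with ⟨h, hc⟩ | ⟨h, hc⟩
  · exact Or.inl ⟨h, by have := hc.add hl; rwa [add_sub_right_comm]⟩
  · exact Or.inr ⟨h, by have := hc.add hl; rwa [add_sub_right_comm]⟩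

theorem add_mem_holedPlane {g : ℕ} {i : Fin g} {z l : ℂ} (hz : z ∈ holedPlane g i)
    (hl : IsLattice l) : z + l ∈ holedPlane g i := by
  intro c hc
  have := hz _ (hc.add hl.neg)
  rwa [show z - (c + -l) = z + l - c by ring] at this

theorem isOpen_holedPlane (g : ℕ) (i : Fin g) : IsOpen (holedPlane g i) := by
  rw [Metric.isOpen_iff]
  intro z hz
  by_cases h : ∃ c, IsHoleCentre g i c ∧ ‖z - c‖ < 1 / 4
  · obtain ⟨c, hc, hzc⟩ := h
    have h1 := hz c hc
    refine ⟨min (‖z - c‖ - 1 / 16) (1 / 16), lt_min (by linarith) (by norm_num), ?_⟩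
    intro w hw d hd
    rw [Metric.mem_ball, dist_eq_norm, lt_min_iff] at hw
    have hzw : ‖z - c‖ ≤ ‖w - c‖ + ‖w - z‖ := by
      have : z - c = (w - c) - (w - z) := by ring
      rw [this]; exact norm_sub_le _ _
    by_cases hdc : c = d
    · subst hdc; linarith
    · have h2 : 1 / 2 ≤ ‖c - d‖ := by
        by_contra! h3; exact hdc (holes_apart hc hd h3)
      have h3 : ‖c - d‖ ≤ ‖w - d‖ + (‖w - z‖ + ‖z - c‖) := by
        have : c - d = (w - d) - ((w - z) + (z - c)) := by ring
        rw [this]; exact (norm_sub_le _ _).trans (by gcongr; exact norm_add_le _ _)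
      linarith
  · push Not at h
    refine ⟨1 / 8, by norm_num, fun w hw d hd => ?_⟩
    rw [Metric.mem_ball, dist_eq_norm] at hw
    have h3 : ‖z - d‖ ≤ ‖w - d‖ + ‖w - z‖ := by
      have : z - d = (w - d) - (w - z) := by ring
      rw [this]; exact norm_sub_le _ _
    linarith [h d hd]

/-- The gluing relation on points of holed planes. -/
def Rel (g : ℕ) (i : Fin g) (z : ℂ) (j : Fin g) (w : ℂ) : Prop :=
  (i = j ∧ IsLattice (z - w)) ∨ ((j : ℕ) = i + 1 ∧ Glued z w) ∨ ((i : ℕ) = j + 1 ∧ Glued w z)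

theorem Rel.symm {g : ℕ} {i j : Fin g} {z w : ℂ} (h : Rel g i z j w) : Rel g j w i z := by
  rcases h with ⟨h, h'⟩ | h | h
  · exact Or.inl ⟨h.symm, by simpa using h'.neg⟩
  · exact Or.inr (Or.inr h)
  · exact Or.inr (Or.inl h)

theorem glued_bounds {g : ℕ} {i j : Fin g} {z w l m : ℂ} (hij : (j : ℕ) = i + 1)
    (hz : z ∈ holedPlane g i) (hw : w ∈ holedPlane g j) (hl : IsLattice l) (hm : IsLattice m)
    (h : (z - rightCentre - l) * (w - leftCentre - m) = 1 / 64) :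
    1 / 16 < ‖z - rightCentre - l‖ ∧ ‖z - rightCentre - l‖ < 1 / 4 ∧
    1 / 16 < ‖w - leftCentre - m‖ ∧ ‖w - leftCentre - m‖ < 1 / 4 := by
  have h1 : 1 / 16 < ‖z - rightCentre - l‖ := by
    rw [sub_sub]
    exact hz _ (Or.inr ⟨by have := j.2; omega, by simpa using hl⟩)
  have h2 : 1 / 16 < ‖w - leftCentre - m‖ := by
    rw [sub_sub]
    exact hw _ (Or.inl ⟨by omega, by simpa using hm⟩)
  have h3 : ‖z - rightCentre - l‖ * ‖w - leftCentre - m‖ = 1 / 64 := by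
    rw [← norm_mul, h]; norm_num
  refine ⟨h1, ?_, h2, ?_⟩ <;> nlinarith

theorem Rel.trans {g : ℕ} {i j k : Fin g} {z w x : ℂ} (hz : z ∈ holedPlane g i)
    (hw : w ∈ holedPlane g j) (hx : x ∈ holedPlane g k)
    (h : Rel g i z j w) (h' : Rel g j w k x) : Rel g i z k x := by
  rcases h with ⟨rfl, h⟩ | ⟨e, l, m, hl, hm, h⟩ | ⟨e, l, m, hl, hm, h⟩
  · rcases h' with ⟨rfl, h'⟩ | ⟨e', l', m', hl', hm', h'⟩ | ⟨e', l', m', hl', hm', h'⟩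
    · exact Or.inl ⟨rfl, by simpa using h.add h'⟩
    · exact Or.inr (Or.inl ⟨e', l' + (z - w), m', hl'.add h, hm', by rw [← h']; ring⟩)
    · exact Or.inr (Or.inr ⟨e', l', m' + (z - w), hl', hm'.add h, by rw [← h']; ring⟩)
  · have b := glued_bounds e hz hw hl hm h
    rcases h' with ⟨rfl, h'⟩ | ⟨e', l', m', hl', hm', h'⟩ | ⟨e', l', m', hl', hm', h'⟩
    · exact Or.inr (Or.inl ⟨e, l, m - (w - x), hl, hm.sub h', by rw [← h]; ring⟩)
    · exfalso
      have b' := glued_bounds e' hw hx hl' hm' h'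
      have := half_le_norm (c := leftCentre + m) (d := rightCentre + l') (by simpa using hm)
        (by simpa using hl')
      rw [show leftCentre + m - (rightCentre + l')
        = (w - rightCentre - l') - (w - leftCentre - m) by ring] at this
      linarith [norm_sub_le (w - rightCentre - l') (w - leftCentre - m)]
    · have b' := glued_bounds e' hx hw hl' hm' h'
      have hmm : m = m' := hm.eq_of_near hm' (a := w - leftCentre) (by linarith)
      subst hmm
      have hik : i = k := Fin.ext (by omega)
      refine Or.inl ⟨hik, ?_⟩
      have h0 : w - leftCentre - m ≠ 0 := by
        intro h0; rw [h0] at h; norm_num at h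
      have := mul_right_cancel₀ h0 (h.trans h'.symm)
      have h3 : z - x = l - l' := by linear_combination this
      rw [h3]; exact hl.sub hl'
  · have b := glued_bounds e hw hz hl hm h
    rcases h' with ⟨rfl, h'⟩ | ⟨e', l', m', hl', hm', h'⟩ | ⟨e', l', m', hl', hm', h'⟩
    · exact Or.inr (Or.inr ⟨e, l - (w - x), m, hl.sub h', hm, by rw [← h]; ring⟩)
    · have b' := glued_bounds e' hw hx hl' hm' h'
      have hmm : l = l' := hl.eq_of_near hl' (a := w - rightCentre) (by linarith)
      subst hmm
      have hik : i = k := Fin.ext (by omega)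
      refine Or.inl ⟨hik, ?_⟩
      have h0 : w - rightCentre - l ≠ 0 := by
        intro h0; rw [h0] at h; norm_num at h
      have := mul_left_cancel₀ h0 (h.trans h'.symm)
      have h3 : z - x = m - m' := by linear_combination this
      rw [h3]; exact hm.sub hm'
    · exfalso
      have b' := glued_bounds e' hx hw hl' hm' h'
      have := half_le_norm (c := leftCentre + m') (d := rightCentre + l) (by simpa using hm')
        (by simpa using hl)
      rw [show leftCentre + m' - (rightCentre + l)
        = (w - rightCentre - l) - (w - leftCentre - m') by ring] at this
      linarith [norm_sub_le (w - rightCentre - l) (w - leftCentre - m')]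

/-- Identified points are identified through a local smooth map. -/
theorem Rel.local_map {g : ℕ} {i j : Fin g} {z w : ℂ} (h : Rel g i z j w) :
    ∃ f : ℂ → ℂ, ContDiffAt ℝ ∞ f z ∧ f z = w ∧
      ∀ᶠ z' in nhds z, Rel g i z' j (f z') := by
  rcases h with ⟨rfl, h⟩ | ⟨e, l, m, hl, hm, h⟩ | ⟨e, l, m, hl, hm, h⟩
  · refine ⟨fun z' => z' - (z - w), by fun_prop, by ring, Filter.Eventually.of_forall fun z' => ?_⟩
    exact Or.inl ⟨rfl, by simpa using h⟩
  · have h0 : z - rightCentre - l ≠ 0 := by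
      intro h0; rw [h0] at h; norm_num at h
    refine ⟨fun z' => 1 / 64 * (z' - rightCentre - l)⁻¹ + leftCentre + m, ?_, ?_, ?_⟩
    · have : ContDiffAt ℝ ∞ (fun z' : ℂ => (z' - rightCentre - l)⁻¹) z :=
        ContDiffAt.inv (by fun_prop) h0
      fun_prop
    · rw [← h]; field_simp; ring
    · have : ∀ᶠ z' in nhds z, z' - rightCentre - l ≠ 0 :=
        ContinuousAt.eventually_ne (by fun_prop) h0
      filter_upwards [this] with z' hz'
      exact Or.inr (Or.inl ⟨e, l, m, hl, hm, by field_simp; ring⟩)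
  · have h0 : z - leftCentre - m ≠ 0 := by
      intro h0; rw [h0] at h; norm_num at h
    refine ⟨fun z' => 1 / 64 * (z' - leftCentre - m)⁻¹ + rightCentre + l, ?_, ?_, ?_⟩
    · have : ContDiffAt ℝ ∞ (fun z' : ℂ => (z' - leftCentre - m)⁻¹) z :=
        ContDiffAt.inv (by fun_prop) h0
      fun_prop
    · rw [← h]; field_simp; ring
    · have : ∀ᶠ z' in nhds z, z' - leftCentre - m ≠ 0 :=
        ContinuousAt.eventually_ne (by fun_prop) h0
      filter_upwards [this] with z' hz'
      exact Or.inr (Or.inr ⟨e, l, m, hl, hm, by field_simp; ring⟩)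

theorem eventually_not_isLattice {z : ℂ} (h : ¬ IsLattice z) :
    ∀ᶠ z' in nhds z, ¬ IsLattice z' := by
  have hb : ∀ᶠ z' in nhds z, ‖z - z'‖ < 1 / 4 := by
    filter_upwards [Metric.ball_mem_nhds z (show (0 : ℝ) < 1 / 4 by norm_num)] with z' hz'
    rwa [Metric.mem_ball, dist_comm, dist_eq_norm] at hz'
  by_cases hl : ∃ l, IsLattice l ∧ ‖z - l‖ < 1 / 4
  · obtain ⟨l, hl, hzl⟩ := hl
    have hne : z ≠ l := fun e => h (e ▸ hl)
    filter_upwards [hb, (continuousAt_id (x := z)).eventually_ne hne] with z' h1 h2 h3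
    have h4 : z' = l := h3.eq_of_near hl (a := z) (by linarith)
    exact h2 h4
  · push Not at hl
    filter_upwards [hb] with z' h1 h3
    linarith [hl z' h3]

theorem eventually_not_glued {g : ℕ} {i j : Fin g} {z w : ℂ} (hij : (j : ℕ) = i + 1)
    (h : ¬ Glued z w) :
    ∀ᶠ p in nhds (z, w), p.1 ∈ holedPlane g i → p.2 ∈ holedPlane g j → ¬ Glued p.1 p.2 := by
  have hb : ∀ᶠ p : ℂ × ℂ in nhds (z, w), ‖z - p.1‖ < 1 / 16 ∧ ‖w - p.2‖ < 1 / 16 := by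
    have hc : ContinuousAt (fun p : ℂ × ℂ => max ‖z - p.1‖ ‖w - p.2‖) (z, w) := by fun_prop
    filter_upwards [hc.eventually_lt (continuousAt_const (y := (1 / 16 : ℝ))) (by simp)] with p hp
    exact max_lt_iff.1 hp
  have key : ∀ p : ℂ × ℂ, ‖z - p.1‖ < 1 / 16 ∧ ‖w - p.2‖ < 1 / 16 → p.1 ∈ holedPlane g i →
      p.2 ∈ holedPlane g j → ∀ l m, IsLattice l → IsLattice m →
      (p.1 - rightCentre - l) * (p.2 - leftCentre - m) = 1 / 64 →
      ‖z - rightCentre - l‖ < 5 / 16 ∧ ‖w - leftCentre - m‖ < 5 / 16 := by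
    intro p hp h1 h2 l m hl hm e
    have b := glued_bounds hij h1 h2 hl hm e
    constructor
    · rw [show z - rightCentre - l = (z - p.1) + (p.1 - rightCentre - l) by ring]
      linarith [norm_add_le (z - p.1) (p.1 - rightCentre - l), hp.1]
    · rw [show w - leftCentre - m = (w - p.2) + (p.2 - leftCentre - m) by ring]
      linarith [norm_add_le (w - p.2) (p.2 - leftCentre - m), hp.2]
  by_cases hl : ∃ l m, IsLattice l ∧ IsLattice m ∧ ‖z - rightCentre - l‖ < 5 / 16 ∧
      ‖w - leftCentre - m‖ < 5 / 16
  · obtain ⟨l, m, hl, hm, b1, b2⟩ := hl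
    have hne : (z - rightCentre - l) * (w - leftCentre - m) ≠ 1 / 64 :=
      fun e => h ⟨l, m, hl, hm, e⟩
    have hc : ContinuousAt (fun p : ℂ × ℂ => (p.1 - rightCentre - l) * (p.2 - leftCentre - m))
        (z, w) := by fun_prop
    filter_upwards [hb, hc.eventually_ne hne] with p hp hpne h1 h2 ⟨l', m', hl', hm', e⟩
    have b := key p hp h1 h2 l' m' hl' hm' e
    have e1 : l' = l := hl'.eq_of_near hl (a := z - rightCentre) (by linarith)
    have e2 : m' = m := hm'.eq_of_near hm (a := w - leftCentre) (by linarith)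
    subst e1 e2
    exact hpne e
  · filter_upwards [hb] with p hp h1 h2 ⟨l', m', hl', hm', e⟩
    exact hl ⟨l', m', hl', hm', key p hp h1 h2 l' m' hl' hm' e⟩

theorem eventually_not_rel {g : ℕ} {i j : Fin g} {z w : ℂ} (h : ¬ Rel g i z j w) :
    ∀ᶠ p in nhds (z, w), p.1 ∈ holedPlane g i → p.2 ∈ holedPlane g j →
      ¬ Rel g i p.1 j p.2 := by
  simp only [Rel, not_or, not_and] at h ⊢
  obtain ⟨h1, h2, h3⟩ := h
  have e1 : ∀ᶠ p in nhds (z, w), i = j → ¬ IsLattice (p.1 - p.2) := by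
    by_cases hij : i = j
    · have hc : ContinuousAt (fun p : ℂ × ℂ => p.1 - p.2) (z, w) := by fun_prop
      filter_upwards [hc.eventually (eventually_not_isLattice (h1 hij))] with p hp _ using hp
    · exact Filter.Eventually.of_forall fun _ h => absurd h hij
  have e2 : ∀ᶠ p in nhds (z, w), (j : ℕ) = i + 1 → p.1 ∈ holedPlane g i →
      p.2 ∈ holedPlane g j → ¬ Glued p.1 p.2 := by
    by_cases hij : (j : ℕ) = i + 1
    · filter_upwards [eventually_not_glued hij (h2 hij)] with p hp _ using hp
    · exact Filter.Eventually.of_forall fun _ h => absurd h hij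
  have e3 : ∀ᶠ p in nhds (z, w), (i : ℕ) = j + 1 → p.2 ∈ holedPlane g j →
      p.1 ∈ holedPlane g i → ¬ Glued p.2 p.1 := by
    by_cases hij : (i : ℕ) = j + 1
    · have hc : Filter.Tendsto (Prod.swap : ℂ × ℂ → ℂ × ℂ) (nhds (z, w)) (nhds (w, z)) :=
        continuous_swap.tendsto (z, w)
      filter_upwards [hc.eventually (eventually_not_glued hij (h3 hij))] with p hp _ using hp
    · exact Filter.Eventually.of_forall fun _ h => absurd h hij
  filter_upwards [e1, e2, e3] with p h1 h2 h3 h4 h5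
  exact ⟨h1, fun e => h2 e h4 h5, fun e => h3 e h5 h4⟩

/-- The relation that glues the holed tori. -/
def glueSetoid (g : ℕ) : Setoid (Σ i : Fin g, holedPlane g i) where
  r x y := Rel g x.1 x.2 y.1 y.2
  iseqv :=
    { refl := fun _ => Or.inl ⟨rfl, by simpa using isLattice_zero⟩
      symm := fun h => h.symm
      trans := fun {x y z} h h' => Rel.trans x.2.2 y.2.2 z.2.2 h h' }

/-- The connected sum of a chain of `g` tori. -/
def Model (g : ℕ) : Type := Quotient (glueSetoid g)

instance (g : ℕ) : TopologicalSpace (Model g) :=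
  inferInstanceAs (TopologicalSpace (Quotient (glueSetoid g)))

/-- The projection of the `i`-th holed plane to the connected sum. -/
def proj {g : ℕ} (i : Fin g) (z : holedPlane g i) : Model g := Quotient.mk (glueSetoid g) ⟨i, z⟩

theorem proj_eq {g : ℕ} {i j : Fin g} {z : holedPlane g i} {w : holedPlane g j} :
    proj i z = proj j w ↔ Rel g i z j w := Quotient.eq (r := glueSetoid g)

theorem exists_proj {g : ℕ} (q : Model g) : ∃ (i : Fin g) (z : holedPlane g i), proj i z = q := by
  obtain ⟨⟨i, z⟩, h⟩ := Quotient.exists_rep q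
  exact ⟨i, z, h⟩

theorem isOpen_model {g : ℕ} {V : Set (Model g)} :
    IsOpen V ↔ ∀ i, IsOpen ((proj i : holedPlane g i → Model g) ⁻¹' V) := by
  have h : Topology.IsQuotientMap (Quotient.mk (glueSetoid g)) := isQuotientMap_quotient_mk'
  exact h.isOpen_preimage.symm.trans isOpen_sigma_iff

theorem continuous_proj {g : ℕ} (i : Fin g) : Continuous (proj i : holedPlane g i → Model g) :=
  continuous_def.2 fun _ hV => isOpen_model.1 hV i

theorem local_lift {g : ℕ} {i j : Fin g} {z : holedPlane g i} {w : holedPlane g j}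
    (h : proj i z = proj j w) :
    ∃ f : ℂ → ℂ, ContDiffAt ℝ ∞ f z ∧ f z = w ∧
      ∀ᶠ z' in nhds (z : ℂ), ∀ hz' : z' ∈ holedPlane g i, ∃ hf : f z' ∈ holedPlane g j,
        proj i ⟨z', hz'⟩ = proj j ⟨f z', hf⟩ := by
  obtain ⟨f, hf, hfz, hr⟩ := (proj_eq.1 h).local_map
  refine ⟨f, hf, hfz, ?_⟩
  have : ∀ᶠ z' in nhds (z : ℂ), f z' ∈ holedPlane g j :=
    hf.continuousAt.eventually (by rw [hfz]; exact (isOpen_holedPlane g j).mem_nhds w.2)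
  filter_upwards [hr, this] with z' h1 h2 h3
  exact ⟨h2, proj_eq.2 h1⟩

theorem isOpenMap_proj {g : ℕ} (j : Fin g) : IsOpenMap (proj j : holedPlane g j → Model g) := by
  intro V hV
  rw [isOpen_model]
  intro i
  rw [isOpen_iff_mem_nhds]
  rintro z ⟨w, hw, hwz⟩
  obtain ⟨f, hf, hfz, hr⟩ := local_lift hwz.symm
  obtain ⟨V', hV', rfl⟩ := isOpen_induced_iff.1 hV
  have h1 : ∀ᶠ z' in nhds (z : ℂ), f z' ∈ V' :=
    hf.continuousAt.eventually (by rw [hfz]; exact hV'.mem_nhds hw)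
  have h2 := (continuous_subtype_val.tendsto z).eventually (h1.and hr)
  filter_upwards [h2] with z' hz'
  obtain ⟨hm, he⟩ := hz'.2 z'.2
  exact ⟨⟨f z', hm⟩, hz'.1, he.symm⟩

theorem proj_injOn {g : ℕ} {i : Fin g} {z w : holedPlane g i} {a : ℂ}
    (hz : ‖(z : ℂ) - a‖ < 1 / 4) (hw : ‖(w : ℂ) - a‖ < 1 / 4) (h : proj i z = proj i w) :
    z = w := by
  rcases proj_eq.1 h with ⟨_, h⟩ | ⟨h, _⟩ | ⟨h, _⟩
  · have : (z : ℂ) - w = 0 := h.eq_zero <| by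
      rw [show (z : ℂ) - w = (z - a) - (w - a) by ring]
      linarith [norm_sub_le ((z : ℂ) - a) (w - a)]
    exact Subtype.ext (sub_eq_zero.1 this)
  · omega
  · omega

instance (g : ℕ) : T2Space (Model g) := by
  refine ⟨fun p q hpq => ?_⟩
  obtain ⟨i, z, rfl⟩ := exists_proj p
  obtain ⟨j, w, rfl⟩ := exists_proj q
  have h := eventually_not_rel (fun h => hpq (proj_eq.2 h))
  rw [nhds_prod_eq, Filter.eventually_prod_iff] at h
  obtain ⟨P, hP, Q, hQ, h⟩ := h
  obtain ⟨A, hA, hAo, hzA⟩ := eventually_nhds_iff.1 hP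
  obtain ⟨B, hB, hBo, hwB⟩ := eventually_nhds_iff.1 hQ
  refine ⟨proj i '' (Subtype.val ⁻¹' A), proj j '' (Subtype.val ⁻¹' B),
    isOpenMap_proj i _ (hAo.preimage continuous_subtype_val),
    isOpenMap_proj j _ (hBo.preimage continuous_subtype_val), ⟨z, hzA, rfl⟩, ⟨w, hwB, rfl⟩, ?_⟩
  rw [Set.disjoint_left]
  rintro _ ⟨z', hz', rfl⟩ ⟨w', hw', e⟩
  exact h (hA _ hz') (hB _ hw') z'.2 w'.2 (proj_eq.1 e.symm)

/-- Representatives at distance at least `1/8` from the centres of the holes. -/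
theorem exists_far {g : ℕ} (q : Model g) : ∃ (i : Fin g) (z : holedPlane g i),
    proj i z = q ∧ ∀ c, IsHoleCentre g i c → 1 / 8 ≤ ‖(z : ℂ) - c‖ := by
  obtain ⟨i, z, rfl⟩ := exists_proj q
  by_cases h : ∀ c, IsHoleCentre g i c → 1 / 8 ≤ ‖(z : ℂ) - c‖
  · exact ⟨i, z, rfl, h⟩
  push Not at h
  obtain ⟨c, hc, hzc⟩ := h
  have hpos := z.2 c hc
  have h0 : (z : ℂ) - c ≠ 0 := by
    intro h; rw [h, norm_zero] at hpos; linarith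
  have hn : ‖(1 / 64 : ℂ) / (z - c)‖ = 1 / 64 / ‖(z : ℂ) - c‖ := by
    rw [norm_div]; norm_num
  have hlo : 1 / 8 < ‖(1 / 64 : ℂ) / (z - c)‖ := by
    rw [hn, lt_div_iff₀ (by linarith)]; linarith
  have hhi : ‖(1 / 64 : ℂ) / (z - c)‖ < 1 / 4 := by
    rw [hn, div_lt_iff₀ (by linarith)]; linarith
  have far : ∀ (j : Fin g) (d : ℂ), IsHoleCentre g j d →
      ∀ e, IsHoleCentre g j e → 1 / 8 < ‖d + (1 / 64 : ℂ) / (z - c) - e‖ := by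
    intro j d hd e he
    by_cases hde : d = e
    · subst hde; simpa using hlo
    · have h2 : 1 / 2 ≤ ‖d - e‖ := by
        by_contra! h3; exact hde (holes_apart hd he h3)
      have h3 : ‖d - e‖ ≤ ‖d + (1 / 64 : ℂ) / (z - c) - e‖ + ‖(1 / 64 : ℂ) / (z - c)‖ := by
        have : d - e = (d + (1 / 64 : ℂ) / (z - c) - e) - (1 / 64 : ℂ) / (z - c) := by ring
        conv_lhs => rw [this]
        exact norm_sub_le _ _
      linarith
  rcases hc with ⟨hi, hc⟩ | ⟨hi, hc⟩
  · let j : Fin g := ⟨i - 1, by omega⟩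
    have hd : IsHoleCentre g j rightCentre :=
      Or.inr ⟨by have := i.2; simp only [j]; omega, by simpa using isLattice_zero⟩
    refine ⟨j, ⟨rightCentre + (1 / 64 : ℂ) / (z - c),
      fun e he => by linarith [far j _ hd e he]⟩, ?_, fun e he => (far j _ hd e he).le⟩
    refine proj_eq.2 (Or.inr (Or.inl ⟨by simp only [j]; omega, 0, c - leftCentre,
      isLattice_zero, hc, ?_⟩))
    field_simp
    ring
  · let j : Fin g := ⟨i + 1, hi⟩
    have hd : IsHoleCentre g j leftCentre :=
      Or.inl ⟨by simp [j], by simpa using isLattice_zero⟩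
    refine ⟨j, ⟨leftCentre + (1 / 64 : ℂ) / (z - c),
      fun e he => by linarith [far j _ hd e he]⟩, ?_, fun e he => (far j _ hd e he).le⟩
    refine proj_eq.2 (Or.inr (Or.inr ⟨by simp [j], c - rightCentre, 0, hc,
      isLattice_zero, ?_⟩))
    field_simp
    ring

instance (g : ℕ) : CompactSpace (Model g) := by
  let K : Fin g → Set ℂ := fun i => {z | ∀ c, IsHoleCentre g i c → 1 / 8 ≤ ‖z - c‖} ∩
    Metric.closedBall 0 2
  have hKU : ∀ i, K i ⊆ holedPlane g i := fun i z hz c hc => by linarith [hz.1 c hc]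
  have hK : ∀ i, IsCompact (K i) := fun i => by
    refine (isCompact_closedBall 0 2).inter_left ?_
    simp only [Set.ofPred_forall]
    exact isClosed_iInter fun c => isClosed_iInter fun _ =>
      isClosed_le continuous_const (by fun_prop)
  have hc : ∀ i, IsCompact (proj i '' (Subtype.val ⁻¹' K i)) := fun i => by
    refine IsCompact.image ?_ (continuous_proj i)
    rw [Subtype.isCompact_iff, Subtype.image_preimage_coe,
      Set.inter_eq_right.2 (hKU i)]
    exact hK i
  refine ⟨?_⟩
  convert isCompact_iUnion hc
  symm
  rw [Set.eq_univ_iff_forall]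
  intro q
  obtain ⟨i, z, rfl, hz⟩ := exists_far q
  rw [Set.mem_iUnion]
  let l : ℂ := ⌊(z : ℂ).re⌋ + ⌊(z : ℂ).im⌋ * Complex.I
  have hl : IsLattice l := ⟨_, _, rfl⟩
  have hm : (z : ℂ) - l ∈ holedPlane g i := by
    rw [sub_eq_add_neg]; exact add_mem_holedPlane z.2 hl.neg
  refine ⟨i, ⟨(z : ℂ) - l, hm⟩, ⟨?_, ?_⟩, proj_eq.2 (Or.inl ⟨rfl, by simpa using hl.neg⟩)⟩
  · intro c hc
    have := hz _ (hc.add hl)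
    rwa [show (z : ℂ) - (c + l) = z - l - c by ring] at this
  · rw [mem_closedBall_zero_iff]
    refine (Complex.norm_le_abs_re_add_abs_im _).trans ?_
    have h1 : ((z : ℂ) - l).re = Int.fract (z : ℂ).re := by simp [l]
    have h2 : ((z : ℂ) - l).im = Int.fract (z : ℂ).im := by simp [l]
    rw [h1, h2, Int.abs_fract, Int.abs_fract]
    linarith [Int.fract_lt_one (z : ℂ).re, Int.fract_lt_one (z : ℂ).im]

/-- A linear identification of `ℂ` with the Euclidean plane. -/
def toPlane : ℂ ≃L[ℝ] EuclideanSpace ℝ (Fin 2) :=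
  Complex.orthonormalBasisOneI.repr.toContinuousLinearEquiv

/-- A small disc in a holed plane, on which the projection is injective. -/
def smallDisc (g : ℕ) (i : Fin g) (a : ℂ) : Set ℂ := holedPlane g i ∩ Metric.ball a (1 / 4)

theorem isOpen_smallDisc (g : ℕ) (i : Fin g) (a : ℂ) : IsOpen (smallDisc g i a) :=
  (isOpen_holedPlane g i).inter Metric.isOpen_ball

/-- The projection, extended arbitrarily to the plane. -/
def Model.param {g : ℕ} (i : Fin g) (a : holedPlane g i) (z : ℂ) : Model g :=
  open Classical in if hz : z ∈ holedPlane g i then proj i ⟨z, hz⟩ else proj i a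

theorem Model.param_of_mem {g : ℕ} {i : Fin g} {a : holedPlane g i} {z : ℂ}
    (hz : z ∈ holedPlane g i) : Model.param i a z = proj i ⟨z, hz⟩ := dif_pos hz

theorem Model.param_injOn {g : ℕ} (i : Fin g) (a : holedPlane g i) :
    Set.InjOn (Model.param i a) (smallDisc g i a) := by
  intro z hz w hw h
  rw [param_of_mem hz.1, param_of_mem hw.1] at h
  have h1 := hz.2
  have h2 := hw.2
  rw [Metric.mem_ball, dist_eq_norm] at h1 h2
  exact congrArg Subtype.val (proj_injOn (z := ⟨z, hz.1⟩) (w := ⟨w, hw.1⟩) h1 h2 h)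

theorem Model.continuousOn_param {g : ℕ} (i : Fin g) (a : holedPlane g i) :
    ContinuousOn (Model.param i a) (smallDisc g i a) := by
  refine ContinuousOn.mono ?_ Set.inter_subset_left
  rw [continuousOn_iff_continuous_domRestrict]
  convert continuous_proj i using 1
  ext z
  exact param_of_mem z.2

theorem Model.isOpenMap_param {g : ℕ} (i : Fin g) (a : holedPlane g i) :
    IsOpenMap ((smallDisc g i a).domRestrict (Model.param i a)) := by
  intro V hV
  have h2 : (smallDisc g i a).domRestrict (Model.param i a) '' V =
      proj i '' (Subtype.val ⁻¹' (Subtype.val '' V)) := by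
    ext q
    constructor
    · rintro ⟨z, hz, rfl⟩
      exact ⟨⟨z, z.2.1⟩, ⟨z, hz, rfl⟩, (param_of_mem z.2.1).symm⟩
    · rintro ⟨z, ⟨w, hw, e⟩, rfl⟩
      refine ⟨w, hw, ?_⟩
      rw [Set.domRestrict_apply, param_of_mem w.2.1]
      congr 1
      exact Subtype.ext e
  rw [h2]
  exact isOpenMap_proj i _ (((isOpen_smallDisc g i a).isOpenMap_subtype_val V hV).preimage
    continuous_subtype_val)

/-- The inverse chart at the image of a point. -/
def Model.invChart {g : ℕ} (i : Fin g) (a : holedPlane g i) : OpenPartialHomeomorph ℂ (Model g) :=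
  haveI : Nonempty ℂ := ⟨0⟩
  OpenPartialHomeomorph.ofContinuousOpenRestrict
    ((Model.param_injOn i a).toPartialEquiv (Model.param i a) (smallDisc g i a))
    (Model.continuousOn_param i a) (Model.isOpenMap_param i a) (isOpen_smallDisc g i a)

theorem Model.invChart_source {g : ℕ} (i : Fin g) (a : holedPlane g i) :
    (Model.invChart i a).source = smallDisc g i a := rfl

theorem Model.invChart_apply {g : ℕ} (i : Fin g) (a : holedPlane g i) (z : ℂ) :
    Model.invChart i a z = Model.param i a z := rfl

/-- The chart at the image of a point. -/
def Model.chart {g : ℕ} (x : Σ i : Fin g, holedPlane g i) :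
    OpenPartialHomeomorph (Model g) (EuclideanSpace ℝ (Fin 2)) :=
  (Model.invChart x.1 x.2).symm.trans toPlane.toHomeomorph.toOpenPartialHomeomorph

theorem mem_smallDisc {g : ℕ} (i : Fin g) (a : holedPlane g i) : (a : ℂ) ∈ smallDisc g i a :=
  ⟨a.2, Metric.mem_ball_self (by norm_num)⟩

theorem Model.mem_chart_source {g : ℕ} (x : Σ i : Fin g, holedPlane g i) :
    proj x.1 x.2 ∈ (Model.chart x).source := by
  have h := (Model.invChart x.1 x.2).map_source (mem_smallDisc x.1 x.2)
  rw [Model.invChart_apply, Model.param_of_mem x.2.2] at h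
  simpa [Model.chart] using h

instance (g : ℕ) : ChartedSpace (EuclideanSpace ℝ (Fin 2)) (Model g) where
  atlas := Set.range Model.chart
  chartAt q := Model.chart (Quotient.out q)
  mem_chart_source q := by
    have h := Model.mem_chart_source (Quotient.out q)
    have e : proj (Quotient.out q).1 (Quotient.out q).2 = q := Quotient.out_eq q
    rwa [e] at h
  chart_mem_atlas q := ⟨_, rfl⟩

theorem Model.transition {g : ℕ} {i j : Fin g} (a : holedPlane g i) (b : holedPlane g j) {z : ℂ}
    (hz : z ∈ smallDisc g i a) (hb : Model.param i a z ∈ (Model.invChart j b).target) :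
    ContDiffAt ℝ ∞ (fun z => (Model.invChart j b).symm (Model.param i a z)) z := by
  set w := (Model.invChart j b).symm (Model.param i a z) with hw
  have hwm : w ∈ smallDisc g j b := (Model.invChart j b).map_target hb
  have hwe : Model.param j b w = Model.param i a z := (Model.invChart j b).right_inv hb
  rw [param_of_mem hz.1, param_of_mem hwm.1] at hwe
  obtain ⟨f, hf, hfz, hr⟩ := local_lift hwe.symm
  refine hf.congr_of_eventuallyEq ?_
  have h1 : ∀ᶠ z' in nhds z, f z' ∈ smallDisc g j b :=
    hf.continuousAt.eventually (by
      simp only at hfz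
      rw [hfz]; exact (isOpen_smallDisc g j b).mem_nhds hwm)
  filter_upwards [hr, h1, (isOpen_smallDisc g i a).mem_nhds hz] with z' h2 h3 h4
  obtain ⟨hm, he⟩ := h2 h4.1
  rw [param_of_mem h4.1, he, ← param_of_mem (a := b) hm]
  exact (Model.invChart j b).left_inv h3

instance (g : ℕ) : IsManifold (𝓡 2) ∞ (Model g) := by
  refine isManifold_of_contDiffOn _ _ _ ?_
  rintro _ _ ⟨⟨i, a⟩, rfl⟩ ⟨⟨j, b⟩, rfl⟩ y hy
  refine ContDiffAt.contDiffWithinAt ?_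
  have hy1 : toPlane.symm y ∈ smallDisc g i a ∧
      Model.param i a (toPlane.symm y) ∈ (Model.invChart j b).target := by
    simpa [Model.chart, Model.invChart_source, Model.invChart_apply] using hy
  exact toPlane.contDiff.contDiffAt.comp y
    ((Model.transition a b hy1.1 hy1.2).comp y toPlane.symm.contDiff.contDiffAt)

theorem quarter_mem_holedPlane (g : ℕ) (i : Fin g) : (1 / 4 : ℂ) ∈ holedPlane g i := by
  intro c hc
  rcases hc with ⟨_, m, n, h⟩ | ⟨_, m, n, h⟩
  · have hre : (1 / 4 - c : ℂ).re = 1 / 4 - m := by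
      rw [sub_eq_iff_eq_add.1 h]; simp [leftCentre]
    refine lt_of_lt_of_le ?_ (Complex.abs_re_le_norm _)
    rw [hre]
    rcases le_or_gt m 0 with hm | hm
    · have : (m : ℝ) ≤ 0 := by exact_mod_cast hm
      rw [abs_of_nonneg] <;> linarith
    · have : (1 : ℝ) ≤ m := by exact_mod_cast hm
      rw [abs_of_nonpos] <;> linarith
  · have hre : (1 / 4 - c : ℂ).re = -1 / 4 - m := by
      rw [sub_eq_iff_eq_add.1 h]; simp [rightCentre]; ring
    refine lt_of_lt_of_le ?_ (Complex.abs_re_le_norm _)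
    rw [hre]
    rcases le_or_gt m (-1) with hm | hm
    · have : (m : ℝ) ≤ -1 := by exact_mod_cast hm
      rw [abs_of_nonneg] <;> linarith
    · have : (0 : ℝ) ≤ m := by exact_mod_cast (show (0 : ℤ) ≤ m by omega)
      rw [abs_of_nonpos] <;> linarith

/-- The standard closed surface of genus `g`. -/
def Model.torusSum (g : ℕ) : TorusSum g (Model g) where
  param i := Model.param i ⟨1 / 4, quarter_mem_holedPlane g i⟩
  localDiffeo i z hz := by
    have hmem : Model.chart ⟨i, ⟨z, hz⟩⟩ ∈ IsManifold.maximalAtlas (𝓡 2) ∞ (Model g) :=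
      IsManifold.subset_maximalAtlas ⟨_, rfl⟩
    refine ⟨⟨(Model.invChart i ⟨z, hz⟩).toPartialEquiv, (Model.invChart i ⟨z, hz⟩).open_source,
      (Model.invChart i ⟨z, hz⟩).open_target, ?_, ?_⟩, mem_smallDisc i ⟨z, hz⟩, ?_⟩
    · have h1 := contMDiffOn_symm_of_mem_maximalAtlas hmem
      have h2 : ContMDiffOn 𝓘(ℝ, ℂ) (𝓡 2) ∞ toPlane (smallDisc g i z) :=
        toPlane.contDiff.contMDiff.contMDiffOn
      refine (h1.comp h2 ?_).congr ?_
      · intro w hw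
        simpa [Model.chart, Model.invChart_source] using hw
      · intro w _
        simp [Model.chart]
    · have h1 := contMDiffOn_of_mem_maximalAtlas hmem
      have h2 : ContMDiff (𝓡 2) 𝓘(ℝ, ℂ) ∞ toPlane.symm := toPlane.symm.contDiff.contMDiff
      refine (h2.comp_contMDiffOn (h1.mono ?_)).congr ?_
      · intro w hw
        simpa [Model.chart] using hw
      · intro w _
        simp [Model.chart]
    · intro w hw
      exact (Model.param_of_mem hw.1).trans (Model.param_of_mem hw.1).symm
  cover q := by
    obtain ⟨i, z, rfl⟩ := exists_proj q
    exact ⟨i, z, z.2, Model.param_of_mem z.2⟩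
  eq_same i z hz w hw := by
    rw [Model.param_of_mem hz, Model.param_of_mem hw, proj_eq]
    simp [Rel]
  eq_lt i j hij z hz w hw := by
    rw [Model.param_of_mem hz, Model.param_of_mem hw, proj_eq]
    have h1 : i ≠ j := hij.ne
    have h2 : (i : ℕ) ≠ j + 1 := by have : (i : ℕ) < j := hij; omega
    simp [Rel, h1, h2]

end SurfaceFlow

end

open scoped Manifold ContDiff

noncomputable section

namespace SurfaceFlow

open Set Filter Topology

/-! ### Smooth dependence of local flows on the initial value -/

/-! ### Smoothness of post-composition on spaces of continuous maps -/

section Composition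

universe w
variable {K : Type} [TopologicalSpace K] [CompactSpace K]

/-! Put `μ i = u i + I v i`. On the `i`-th torus the multivalued potential `z ↦ μ i z` has an
imaginary part whose differential is single-valued, has integrals `u i` and `v i` over the vertical
and the horizontal circle, and has level lines of irrational slope. These potentials have to be
joined across the necks. The gluing is the inversion `ζ ↦ 1 / (64 ζ)`, and the Joukowski map `ε (ζ +
1 / (64 ζ))` is invariant under it; so this map, with the same `ε` for all tori, fits on both sides
of a neck up to an additive constant (`potential_glued`). Further out, `model` interpolates between
the Joukowski map and `μ i ζ`. If `ε` is small, the interpolation has an injective differential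
(`fderiv_model_injective`), so it creates no new critical points.

Let `Φ` be the resulting multivalued potential and `H = Im Φ`. The closed form `dH` lives on the
surface, and the vector field `X` with `Ω(X, ·) = dH` (`surfaceField`) generates the flow. The form
`Ω` enters only through its density `ρ` in the parametrizations, which rescales the planar field;
this is why any symplectic form is allowed. The zeros of `X` are the critical points `ζ = ±1/8` of
the Joukowski map, two on each of the `g - 1` necks. Near them `X` is `conj (Φ') / ρ` and `Φ'` has a
simple zero with real derivative, so the linearization is `v ↦ κ conj v` with eigenvalues `±κ`
(`fderiv_liftedField_saddle`).

The Joukowski map sends the circle `|ζ| = 1/8` into the real line, so these circles are invariant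
(`norm_ge_of_flow`) and every orbit stays in the core of a single torus. Lifted to the plane, an
orbit other than a zero has constant `Im Φ`, whereas `Re Φ` is strictly monotone, because the
differential of `Φ` maps `X` to a non-zero real number (`potential_along_flow`). A periodic orbit
closes up to a lattice vector `l`, and `Φ (z + l) = Φ z + μ i l` gives `Im (μ i l) = 0`.
Irrationality forces `l = 0`, against the monotonicity of `Re Φ`.

The rest is analysis. The flow is smooth by the implicit function theorem in a space of curves
(`exists_local_flow_of_contDiff`, `IsLocalPushforward.exists_flow`), and it preserves `Ω` because
`ddH = 0` (`IsHamiltonianOn.divergence_eq`, `flow_preserves`). -/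

/-- A bilinear map, applied pointwise to continuous functions. -/
def pointwiseApply (K : Type) [TopologicalSpace K] [CompactSpace K]
    {G E F : Type w} [NormedAddCommGroup G] [NormedSpace ℝ G] [NormedAddCommGroup E]
    [NormedSpace ℝ E] [NormedAddCommGroup F] [NormedSpace ℝ F] (B : G →L[ℝ] E →L[ℝ] F) :
    C(K, G) →L[ℝ] C(K, E) →L[ℝ] C(K, F) :=
  LinearMap.mkContinuous₂
    (LinearMap.mk₂ ℝ (fun (A : C(K, G)) (δ : C(K, E)) =>
        (⟨fun k => B (A k) (δ k), by fun_prop⟩ : C(K, F)))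
      (fun _ _ _ => by ext; simp) (fun _ _ _ => by ext; simp) (fun _ _ _ => by ext; simp)
      (fun _ _ _ => by ext; simp)) ‖B‖
    (fun A δ => by
      rw [ContinuousMap.norm_le _ (by positivity)]
      intro k
      refine (B.le_opNorm₂ (A k) (δ k)).trans ?_
      gcongr
      · exact A.norm_coe_le_norm k
      · exact δ.norm_coe_le_norm k)

/-- Pointwise this is the mean value inequality. Compactness of `K` makes the continuity of the
derivative along `γ` uniform, which turns the pointwise estimates into one in the sup norm. -/
theorem hasFDerivAt_postcomp {G E F : Type w} [NormedAddCommGroup G] [NormedSpace ℝ G]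
    [NormedAddCommGroup E] [NormedSpace ℝ E] [NormedAddCommGroup F] [NormedSpace ℝ F]
    (B : G →L[ℝ] E →L[ℝ] F) (f : C(E, F)) (f' : C(E, G))
    (hf : ∀ x, HasFDerivAt f (B (f' x)) x) (γ : C(K, E)) :
    HasFDerivAt (fun γ : C(K, E) => f.comp γ) (pointwiseApply K B (f'.comp γ)) γ := by
  rw [hasFDerivAt_iff_isLittleO_nhds_zero, Asymptotics.isLittleO_iff]
  intro c hcpos
  have key : ∀ᶠ h in 𝓝 (0 : E), ∀ k : K, ‖B (f' (γ k + h)) - B (f' (γ k))‖ < c := by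
    have : ∀ k ∈ (univ : Set K), ∀ᶠ p : K × E in 𝓝 (k, (0 : E)),
        ‖B (f' (γ p.1 + p.2)) - B (f' (γ p.1))‖ < c := by
      intro k _
      have h1 : Continuous fun p : K × E => ‖B (f' (γ p.1 + p.2)) - B (f' (γ p.1))‖ := by
        fun_prop
      exact h1.continuousAt.eventually_lt continuousAt_const (by simpa using hcpos)
    have h2 := isCompact_univ.eventually_forall_of_forall_eventually (x₀ := (0 : E))
      (P := fun h k => ‖B (f' (γ k + h)) - B (f' (γ k))‖ < c)
      (fun k hk => (continuous_swap.tendsto ((0 : E), k)).eventually (this k hk))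
    filter_upwards [h2] with h hh k using hh k (mem_univ k)
  obtain ⟨δ, hδ, hball⟩ := Metric.eventually_nhds_iff_ball.1 key
  filter_upwards [Metric.ball_mem_nhds (0 : C(K, E)) hδ] with h hh
  rw [ContinuousMap.norm_le _ (by positivity)]
  intro k
  have hk : ‖h k‖ < δ := (h.norm_coe_le_norm k).trans_lt (by simpa using hh)
  have hmv := (convex_ball (0 : E) δ).norm_image_sub_le_of_norm_hasFDerivWithin_le
    (f := fun y => f (γ k + y) - B (f' (γ k)) y)
    (f' := fun y => B (f' (γ k + y)) - B (f' (γ k))) (C := c) (x := 0) (y := h k)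
    (fun y _ => by
      have h2 : HasFDerivAt (fun y => f (γ k + y)) (B (f' (γ k + y))) y := by
        have h3 := (hf (γ k + y)).comp y ((hasFDerivAt_id y).const_add (γ k))
        rwa [ContinuousLinearMap.comp_id] at h3
      exact (h2.sub (B (f' (γ k))).hasFDerivAt).hasFDerivWithinAt)
    (fun y hy => (hball y hy k).le) (by simpa using hδ) (by simpa using hk)
  have h3 : ‖h k‖ ≤ ‖h‖ := h.norm_coe_le_norm k
  calc _ = ‖f (γ k + h k) - B (f' (γ k)) (h k) - (f (γ k + 0) - B (f' (γ k)) 0)‖ := by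
        rw [add_zero, map_zero, sub_zero, sub_right_comm]
        rfl
    _ ≤ c * ‖h k - 0‖ := hmv
    _ ≤ c * ‖h‖ := by rw [sub_zero]; gcongr

/-- The derivative is again a post-composition, with `f'`, followed by a continuous linear map;
hence the induction. All spaces share one universe, so that the induction hypothesis applies to `E
→L[ℝ] F`. -/
theorem contDiff_postcomp (n : ℕ) : ∀ {E F : Type w} [NormedAddCommGroup E] [NormedSpace ℝ E]
    [NormedAddCommGroup F] [NormedSpace ℝ F] (f : C(E, F)), ContDiff ℝ n f →
    ContDiff ℝ n (fun γ : C(K, E) => f.comp γ) := by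
  induction n with
  | zero =>
    intro E F _ _ _ _ f hf
    rw [Nat.cast_zero, contDiff_zero]
    exact f.continuous_postcomp
  | succ n ih =>
    intro E F _ _ _ _ f hf
    obtain ⟨f', hf', hd⟩ := contDiff_succ_iff_hasFDerivAt.1 hf
    have h1 := hasFDerivAt_postcomp (K := K) (ContinuousLinearMap.id ℝ (E →L[ℝ] F)) f
      ⟨f', hf'.continuous⟩ hd
    exact contDiff_succ_iff_hasFDerivAt.2 ⟨_, ContDiff.comp
      (pointwiseApply K (ContinuousLinearMap.id ℝ (E →L[ℝ] F))).contDiff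
      (ih ⟨f', hf'.continuous⟩ hf'), h1⟩

theorem contDiff_infty_postcomp {E F : Type w} [NormedAddCommGroup E] [NormedSpace ℝ E]
    [NormedAddCommGroup F] [NormedSpace ℝ F] (f : C(E, F)) (hf : ContDiff ℝ ∞ f) :
    ContDiff ℝ ∞ (fun γ : C(K, E) => f.comp γ) :=
  contDiff_infty.2 fun n => contDiff_postcomp n f (contDiff_infty.1 hf n)

end Composition

/-! ### Local flows from the implicit function theorem -/

section LocalFlow

universe w
variable {E : Type w} [NormedAddCommGroup E]

/-- The extension of a curve on `[-1, 1]` to the line by constants. -/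
def extendCurve (γ : C(Icc (-1 : ℝ) 1, E)) (s : ℝ) : E :=
  γ (projIcc (-1) 1 (by norm_num) s)

theorem continuous_extendCurve (γ : C(Icc (-1 : ℝ) 1, E)) : Continuous (extendCurve γ) :=
  γ.continuous.comp continuous_projIcc

/-- Multiplication by a number of modulus at most one on `[-1, 1]`. -/
def scaleIcc (ρ : Icc (-1 : ℝ) 1) : C(Icc (-1 : ℝ) 1, Icc (-1 : ℝ) 1) :=
  ⟨fun t => ⟨ρ * t, by
    have h1 := abs_le.2 ρ.2
    have h2 := abs_le.2 t.2
    refine abs_le.1 ?_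
    rw [abs_mul]
    nlinarith [abs_nonneg (ρ : ℝ), abs_nonneg (t : ℝ)]⟩, by fun_prop⟩

theorem extendCurve_scaleIcc (γ : C(Icc (-1 : ℝ) 1, E)) (ρ : Icc (-1 : ℝ) 1) {s : ℝ}
    (hs : s ∈ Icc (-1 : ℝ) 1) :
    extendCurve (γ.comp (scaleIcc ρ)) s = extendCurve γ (ρ * s) := by
  have h := (scaleIcc ρ ⟨s, hs⟩).2
  simp only [scaleIcc, ContinuousMap.coe_mk] at h
  rw [extendCurve, extendCurve, projIcc_of_mem _ hs, projIcc_of_mem _ h]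
  rfl

variable [NormedSpace ℝ E]

/-- The integration operator `γ ↦ ∫₀ᵗ γ` on curves. -/
def curveIntegral (E : Type w) [NormedAddCommGroup E] [NormedSpace ℝ E] :
    C(Icc (-1 : ℝ) 1, E) →L[ℝ] C(Icc (-1 : ℝ) 1, E) :=
  LinearMap.mkContinuous
    { toFun := fun γ => ⟨fun t => ∫ s in (0 : ℝ)..t, extendCurve γ s,
        (intervalIntegral.continuous_primitive
          (fun a b => (continuous_extendCurve γ).intervalIntegrable a b) 0).comp
          continuous_subtype_val⟩
      map_add' := fun γ γ' => by
        ext t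
        exact intervalIntegral.integral_add ((continuous_extendCurve γ).intervalIntegrable _ _)
          ((continuous_extendCurve γ').intervalIntegrable _ _)
      map_smul' := fun c γ => by
        ext t
        exact intervalIntegral.integral_smul c _ } 1
    (fun γ => by
      rw [one_mul, ContinuousMap.norm_le _ (by positivity)]
      intro t
      refine (intervalIntegral.norm_integral_le_of_norm_le_const
        (C := ‖γ‖) fun s _ => γ.norm_coe_le_norm _).trans ?_
      have : |(t : ℝ) - 0| ≤ 1 := by rw [sub_zero, abs_le]; exact t.2
      nlinarith [norm_nonneg γ])

theorem curveIntegral_apply (γ : C(Icc (-1 : ℝ) 1, E)) (t : Icc (-1 : ℝ) 1) :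
    curveIntegral E γ t = ∫ s in (0 : ℝ)..t, extendCurve γ s := rfl

theorem curveIntegral_comp_scaleIcc (γ : C(Icc (-1 : ℝ) 1, E)) (ρ : Icc (-1 : ℝ) 1) :
    (ρ : ℝ) • curveIntegral E (γ.comp (scaleIcc ρ)) = (curveIntegral E γ).comp (scaleIcc ρ) := by
  ext t
  rw [ContinuousMap.smul_apply, curveIntegral_apply, ContinuousMap.comp_apply,
    curveIntegral_apply]
  have h : ∫ s in (0 : ℝ)..t, extendCurve (γ.comp (scaleIcc ρ)) s =
      ∫ s in (0 : ℝ)..t, extendCurve γ (ρ * s) := by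
    refine intervalIntegral.integral_congr fun s hs => extendCurve_scaleIcc γ ρ ?_
    have h2 : uIcc (0 : ℝ) t ⊆ Icc (-1) 1 :=
      uIcc_subset_Icc ⟨by norm_num, by norm_num⟩ t.2
    exact h2 hs
  rw [h, intervalIntegral.smul_integral_comp_mul_left, mul_zero]
  rfl

/-- The defect of `γ` as a solution of `γ' = s f(γ)`, `γ(0) = x`. -/
def flowDefect (f : C(E, E)) (p : (ℝ × E) × C(Icc (-1 : ℝ) 1, E)) : C(Icc (-1 : ℝ) 1, E) :=
  p.2 - ContinuousMap.const _ p.1.2 - p.1.1 • curveIntegral E (f.comp p.2)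

theorem contDiff_flowDefect {f : C(E, E)} (hf : ContDiff ℝ ∞ f) :
    ContDiff ℝ ∞ (flowDefect f) := by
  have h1 : ContDiff ℝ ∞ fun p : (ℝ × E) × C(Icc (-1 : ℝ) 1, E) =>
      (ContinuousMap.const (Icc (-1 : ℝ) 1) p.1.2 : C(Icc (-1 : ℝ) 1, E)) :=
    (ContinuousLinearMap.const ℝ (Icc (-1 : ℝ) 1) : E →L[ℝ] _).contDiff.comp contDiff_fst.snd
  have h2 : ContDiff ℝ ∞ fun p : (ℝ × E) × C(Icc (-1 : ℝ) 1, E) =>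
      curveIntegral E (f.comp p.2) :=
    (curveIntegral E).contDiff.comp ((contDiff_infty_postcomp f hf).comp contDiff_snd)
  exact (contDiff_snd.sub h1).sub (contDiff_fst.fst.smul h2)

/-- Slowing a solution of speed `s` down by the factor `ρ` gives a solution of speed `s * ρ`. This
is what ties the solutions for different speeds together. -/
theorem flowDefect_scale {f : C(E, E)} {s : ℝ} {x : E} {γ : C(Icc (-1 : ℝ) 1, E)}
    (h : flowDefect f ((s, x), γ) = 0) (ρ : Icc (-1 : ℝ) 1) :
    flowDefect f ((s * ρ, x), γ.comp (scaleIcc ρ)) = 0 := by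
  have h1 : (flowDefect f ((s, x), γ)).comp (scaleIcc ρ) = 0 := by rw [h]; rfl
  rw [← h1, flowDefect, mul_smul, ← ContinuousMap.comp_assoc, curveIntegral_comp_scaleIcc]
  rfl

/-- At `s = 0` the equation `γ = x + s ∫ f ∘ γ` reads `γ = x`, and its derivative in `γ` is the
identity. The implicit function theorem thus gives solutions `Γ (s, x)` near the constant curve,
smooth in `(s, x)`. The flow is the end-point of `Γ (t, x)`: time has become a parameter, whence
joint smoothness. -/
theorem exists_local_flow_of_contDiff [CompleteSpace E] (f : C(E, E)) (hf : ContDiff ℝ ∞ f)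
    (x₀ : E) {V : Set E} (hV : V ∈ 𝓝 x₀) :
    ∃ ε > 0, ∃ φ : ℝ × E → E, ContDiffAt ℝ ∞ φ (0, x₀) ∧ ∀ᶠ x in 𝓝 x₀, φ (0, x) = x ∧
      ∀ t ∈ Ioo (-ε) ε, φ (t, x) ∈ V ∧ HasDerivAt (fun s => φ (s, x)) (f (φ (t, x))) t := by
  set C := C(Icc (-1 : ℝ) 1, E)
  set γ₀ : C := ContinuousMap.const _ x₀ with hγ₀
  set u : (ℝ × E) × C := ((0, x₀), γ₀) with hu
  have hF : ContDiffAt ℝ ∞ (flowDefect f) u := (contDiff_flowDefect hf).contDiffAt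
  have hFu : flowDefect f u = 0 := by simp [flowDefect, hu, hγ₀]
  have hinv : fderiv ℝ (flowDefect f) u ∘L .inr ℝ (ℝ × E) C = .id ℝ C := by
    have h1 : HasFDerivAt (flowDefect f) (fderiv ℝ (flowDefect f) u) ((0, x₀), γ₀) :=
      (hF.differentiableAt (by simp)).hasFDerivAt
    have h2 := h1.comp γ₀ (hasFDerivAt_prodMk_right (𝕜 := ℝ) (0, x₀) γ₀)
    have h3 : HasFDerivAt (flowDefect f ∘ fun γ : C => ((0, x₀), γ)) (.id ℝ C) γ₀ := by
      have : (flowDefect f ∘ fun γ : C => (((0 : ℝ), x₀), γ)) = fun γ => γ - γ₀ := by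
        funext γ; simp [flowDefect, hγ₀]
      rw [this]
      exact (hasFDerivAt_id γ₀).sub_const γ₀
    exact h2.unique h3
  have if₂ : (fderiv ℝ (flowDefect f) u ∘L .inr ℝ (ℝ × E) C).IsInvertible := by
    rw [hinv]; exact ⟨.refl ℝ C, rfl⟩
  set Γ := hF.implicitFunction (by simp) if₂ with hΓ
  have hΓs : ContDiffAt ℝ ∞ Γ (0, x₀) := hF.contDiffAt_implicitFunction (by simp) if₂
  have hΓ0 : Γ (0, x₀) = γ₀ := hF.implicitFunction_apply_self (by simp) if₂
  have e1 := hF.eventually_apply_implicitFunction (by simp) if₂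
  have e2 := hF.eventually_apply_eq_iff_implicitFunction (by simp) if₂
  rw [hFu] at e1 e2
  rw [← hΓ] at e1 e2
  have e3 : ∀ᶠ v in 𝓝 u, ∀ t, v.2 t ∈ V := by
    obtain ⟨δ, hδ, hb⟩ := Metric.mem_nhds_iff.1 hV
    have : ∀ᶠ v in 𝓝 u, dist v.2 γ₀ < δ :=
      (continuous_snd.tendsto u).eventually (Metric.ball_mem_nhds γ₀ hδ)
    filter_upwards [this] with v hv t
    exact hb ((ContinuousMap.dist_apply_le_dist (f := v.2) (g := γ₀) t).trans_lt hv)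
  obtain ⟨δ, hδ, hδb⟩ := Metric.eventually_nhds_iff_ball.1 (e2.and e3)
  have e4 : ∀ᶠ p in 𝓝 ((0 : ℝ), x₀), dist (Γ p) γ₀ < δ := by
    have h := hΓs.continuousAt.eventually (Metric.ball_mem_nhds (Γ (0, x₀)) hδ)
    rw [hΓ0] at h
    exact h
  obtain ⟨δ', hδ', hδb'⟩ := Metric.eventually_nhds_iff_ball.1 (e4.and e1)
  set ε := min δ δ' / 2 with hε
  have hm : 0 < min δ δ' := lt_min hδ hδ'
  have hεpos : 0 < ε := by positivity
  have hε1 : ε < δ := by have := min_le_left δ δ'; linarith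
  have hε2 : ε < δ' := by have := min_le_right δ δ'; linarith
  set o : Icc (-1 : ℝ) 1 := ⟨1, by norm_num⟩ with ho
  refine ⟨ε, hεpos, fun p => Γ p o, ?_, ?_⟩
  · exact (ContinuousMap.evalCLM ℝ o).contDiff.contDiffAt.comp _ hΓs
  filter_upwards [Metric.ball_mem_nhds x₀ hm] with x hx
  rw [Metric.mem_ball, lt_min_iff] at hx
  have hmem : ∀ t : ℝ, |t| ≤ ε → (t, x) ∈ Metric.ball ((0 : ℝ), x₀) δ' := by
    intro t ht
    rw [Metric.mem_ball, Prod.dist_eq, max_lt_iff]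
    exact ⟨by simpa using ht.trans_lt hε2, hx.2⟩
  set γ := Γ (ε, x) with hγ
  obtain ⟨hγd, hγF⟩ := hδb' (ε, x) (hmem ε (abs_of_pos hεpos).le)
  -- By the uniqueness part of the implicit function theorem, `Γ (t, x)` is the curve `γ = Γ (ε, x)`
  -- slowed down by `t / ε`, so the end-points trace out the single curve `γ`.
  have key : ∀ t : ℝ, ∀ ht : |t| ≤ ε, Γ (t, x) o = extendCurve γ (t / ε) ∧ Γ (t, x) o ∈ V := by
    intro t ht
    have hρ : t / ε ∈ Icc (-1 : ℝ) 1 := by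
      refine abs_le.1 ?_
      rw [abs_div, abs_of_pos hεpos, div_le_one hεpos]; exact ht
    set ρ : Icc (-1 : ℝ) 1 := ⟨t / ε, hρ⟩ with hρd
    have h1 := flowDefect_scale hγF ρ
    have h2 : ε * (ρ : ℝ) = t := by simp only [hρd]; field_simp
    rw [h2] at h1
    have h3 : (((t, x), γ.comp (scaleIcc ρ)) : (ℝ × E) × C) ∈ Metric.ball u δ := by
      rw [Metric.mem_ball, Prod.dist_eq, max_lt_iff, Prod.dist_eq, max_lt_iff]
      refine ⟨⟨by simpa [hu] using ht.trans_lt hε1, hx.1⟩, ?_⟩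
      refine lt_of_le_of_lt ?_ hγd
      rw [ContinuousMap.dist_le dist_nonneg]
      intro s
      exact ContinuousMap.dist_apply_le_dist (f := γ) (g := γ₀) (scaleIcc ρ s)
    have h4 : Γ (t, x) = γ.comp (scaleIcc ρ) := (hδb _ h3).1.1 h1
    constructor
    · rw [h4, ContinuousMap.comp_apply, extendCurve, projIcc_of_mem _ hρ]
      congr 1
      exact Subtype.ext (mul_one _)
    · rw [h4]; exact (hδb _ h3).2 o
  have hcurve : ∀ t : ℝ, |t| ≤ ε → Γ (t, x) o =
      x + ε • ∫ s in (0 : ℝ)..(t / ε), extendCurve (f.comp γ) s := by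
    intro t ht
    have hρ : t / ε ∈ Icc (-1 : ℝ) 1 := by
      refine abs_le.1 ?_
      rw [abs_div, abs_of_pos hεpos, div_le_one hεpos]; exact ht
    rw [(key t ht).1]
    have h1 : γ ⟨t / ε, hρ⟩ - x - ε • ∫ s in (0 : ℝ)..(t / ε), extendCurve (f.comp γ) s = 0 :=
      congrArg (fun c : C(Icc (-1 : ℝ) 1, E) => c ⟨t / ε, hρ⟩) hγF
    rw [extendCurve, projIcc_of_mem _ hρ, ← sub_eq_zero, ← sub_sub]
    exact h1
  refine ⟨?_, fun t ht => ⟨(key t (abs_le.2 ⟨ht.1.le, ht.2.le⟩)).2, ?_⟩⟩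
  · rw [hcurve 0 (by simpa using hεpos.le)]; simp
  · have h1 : HasDerivAt (fun s : ℝ => x + ε • ∫ s in (0 : ℝ)..(s / ε), extendCurve (f.comp γ) s)
        (ε • ((1 / ε : ℝ) • extendCurve (f.comp γ) (t / ε))) t := by
      have h2 : HasDerivAt (fun s : ℝ => ∫ s in (0 : ℝ)..s, extendCurve (f.comp γ) s)
          (extendCurve (f.comp γ) (t / ε)) (t / ε) :=
        ((continuous_extendCurve (f.comp γ)).integral_hasStrictDerivAt 0 (t / ε)).hasDerivAt
      have h3 : HasDerivAt (fun s : ℝ => s / ε) (1 / ε) t := (hasDerivAt_id t).div_const ε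
      exact ((h2.scomp t h3).const_smul ε).const_add x
    have h4 : ε • ((1 / ε : ℝ) • extendCurve (f.comp γ) (t / ε)) = f (Γ (t, x) o) := by
      rw [(key t (abs_le.2 ⟨ht.1.le, ht.2.le⟩)).1, smul_smul, mul_one_div_cancel hεpos.ne',
        one_smul]
      rfl
    rw [← h4]
    refine h1.congr_of_eventuallyEq ?_
    filter_upwards [Ioo_mem_nhds ht.1 ht.2] with s hs
    exact hcurve s (abs_le.2 ⟨hs.1.le, hs.2.le⟩)

/-- Local flows of a smooth vector field on an open set depend smoothly on the initial value. -/
theorem exists_local_flow [FiniteDimensional ℝ E] {U : Set E} (hU : IsOpen U) {f : E → E}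
    (hf : ContDiffOn ℝ ∞ f U) {x₀ : E} (hx₀ : x₀ ∈ U) :
    ∃ ε > 0, ∃ φ : ℝ × E → E, ContDiffAt ℝ ∞ φ (0, x₀) ∧ ∀ᶠ x in 𝓝 x₀, φ (0, x) = x ∧
      ∀ t ∈ Ioo (-ε) ε, φ (t, x) ∈ U ∧ HasDerivAt (fun s => φ (s, x)) (f (φ (t, x))) t := by
  have : CompleteSpace E := FiniteDimensional.complete ℝ E
  obtain ⟨d, hd, hdU⟩ := Metric.isOpen_iff.1 hU x₀ hx₀
  let χ : ContDiffBump x₀ := ⟨d / 4, d / 2, by positivity, by linarith⟩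
  have hsub : tsupport χ ⊆ U := by
    rw [χ.tsupport_eq]
    exact (Metric.closedBall_subset_ball (by simp only [χ]; linarith)).trans hdU
  have hg : ContDiff ℝ ∞ fun x => χ x • f x := by
    rw [contDiff_iff_contDiffAt]
    intro x
    by_cases hx : x ∈ tsupport χ
    · exact χ.contDiff.contDiffAt.smul (hf.contDiffAt (hU.mem_nhds (hsub hx)))
    · have h0 : (fun x => χ x • f x) =ᶠ[𝓝 x] fun _ => 0 := by
        filter_upwards [notMem_tsupport_iff_eventuallyEq.1 hx] with y hy
        rw [hy]; simp
      exact contDiffAt_const.congr_of_eventuallyEq h0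
  -- On the ball of radius `d / 4` the bump function is `1`, so flow lines that stay there are flow
  -- lines of `f` itself.
  obtain ⟨ε, hε, φ, hφ, h⟩ := exists_local_flow_of_contDiff ⟨_, hg.continuous⟩ hg x₀
    (V := U ∩ Metric.closedBall x₀ (d / 4))
    (inter_mem (hU.mem_nhds hx₀) (Metric.closedBall_mem_nhds x₀ (by positivity)))
  refine ⟨ε, hε, φ, hφ, ?_⟩
  filter_upwards [h] with x hx
  refine ⟨hx.1, fun t ht => ⟨(hx.2 t ht).1.1, ?_⟩⟩
  have h1 := (hx.2 t ht).2
  rw [ContinuousMap.coe_mk, χ.one_of_mem_closedBall (hx.2 t ht).1.2, one_smul] at h1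
  exact h1

end LocalFlow

/-! ### Flows of vector fields on compact surfaces -/

section Flow

variable {S : Type*} [TopologicalSpace S] [ChartedSpace (EuclideanSpace ℝ (Fin 2)) S]

/-- The vector field `X` is, on the image of `U`, the push-forward under the local diffeomorphism
`e` of the smooth planar vector field `f` on `U`. -/
structure IsPushforwardOn (e : ℂ → S) (U : Set ℂ) (f : ℂ → ℂ) (X : VField S) : Prop where
  isOpen : IsOpen U
  smooth : ContDiffOn ℝ ∞ f U
  localDiffeo : ∀ z ∈ U, IsLocalDiffeomorphAt 𝓘(ℝ, ℂ) (𝓡 2) ∞ e z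
  map_eq : ∀ z ∈ U, X (e z) = mfderiv 𝓘(ℝ, ℂ) (𝓡 2) e z (f z)

/-- Every point has a neighbourhood on which `X` is a push-forward of a smooth planar field. -/
def IsLocalPushforward (X : VField S) : Prop :=
  ∀ p : S, ∃ (e : ℂ → S) (U : Set ℂ) (f : ℂ → ℂ), IsPushforwardOn e U f X ∧ ∃ z ∈ U, e z = p

/-- Gives uniform times of existence, of smoothness and of lifting from local ones. -/
theorem exists_uniform_of_isCompact {Y : Type*} [TopologicalSpace Y] {K : Set Y}
    (hK : IsCompact K) {P : ℝ → Y → Prop} (hP : ∀ {ε ε' y}, ε' ≤ ε → P ε y → P ε' y)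
    (h : ∀ x ∈ K, ∃ ε > 0, ∀ᶠ y in 𝓝 x, P ε y) : ∃ ε > 0, ∀ y ∈ K, P ε y := by
  refine hK.induction_on (p := fun s => ∃ ε > 0, ∀ y ∈ s, P ε y) ⟨1, one_pos, by simp⟩ ?_ ?_ ?_
  · rintro s t hst ⟨ε, hε, h⟩
    exact ⟨ε, hε, fun y hy => h y (hst hy)⟩
  · rintro s t ⟨ε, hε, h⟩ ⟨ε', hε', h'⟩
    refine ⟨min ε ε', lt_min hε hε', ?_⟩
    rintro y (hy | hy)
    · exact hP (min_le_left _ _) (h y hy)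
    · exact hP (min_le_right _ _) (h' y hy)
  · intro x hx
    obtain ⟨ε, hε, h⟩ := h x hx
    exact ⟨_, mem_nhdsWithin_of_mem_nhds h, ε, hε, fun y hy => hy⟩

variable {X : VField S} {e : ℂ → S} {U : Set ℂ} {f : ℂ → ℂ}

theorem IsPushforwardOn.hasMFDerivAt (h : IsPushforwardOn e U f X) {γ : ℝ → ℂ} {t : ℝ}
    (hU : γ t ∈ U) (hγ : HasDerivAt γ (f (γ t)) t) :
    HasMFDerivAt 𝓘(ℝ, ℝ) (𝓡 2) (fun s => e (γ s)) t
      ((1 : ℝ →L[ℝ] ℝ).smulRight (X (e (γ t)))) := by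
  have h1 := ((h.localDiffeo _ hU).mdifferentiableAt (by simp)).hasMFDerivAt
  have h2 : HasMFDerivAt 𝓘(ℝ, ℝ) 𝓘(ℝ, ℂ) γ t ((1 : ℝ →L[ℝ] ℝ).smulRight (f (γ t))) :=
    hγ.hasFDerivAt.hasMFDerivAt
  have h3 := h1.comp t h2
  have h4 : (mfderiv 𝓘(ℝ, ℂ) (𝓡 2) e (γ t)).comp ((1 : ℝ →L[ℝ] ℝ).smulRight (f (γ t))) =
      (1 : ℝ →L[ℝ] ℝ).smulRight (X (e (γ t))) := by
    rw [h.map_eq _ hU]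
    refine ContinuousLinearMap.ext fun s => ?_
    exact map_smul (mfderiv 𝓘(ℝ, ℂ) (𝓡 2) e (γ t)) s (f (γ t))
  rw [← h4]
  exact h3

variable [IsManifold (𝓡 2) ∞ S]

/-- Locally `X` is the planar section `(z, f z)`, pushed forward by the tangent map of `e` and
composed with a local inverse of `e`. This regularity is what uniqueness of integral curves needs.
-/
theorem IsLocalPushforward.contMDiff (h : IsLocalPushforward X) :
    ContMDiff (𝓡 2) (𝓡 2).tangent ∞ (fun p => (⟨p, X p⟩ : TangentBundle (𝓡 2) S)) := by
  intro p
  obtain ⟨e, U, f, h, z, hz, rfl⟩ := h p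
  have he := h.localDiffeo z hz
  have h1 : ContMDiffOn 𝓘(ℝ, ℂ) (𝓡 2) ∞ e U := fun w hw =>
    (h.localDiffeo w hw).contMDiffAt.contMDiffWithinAt
  have h2 := h1.contMDiffOn_tangentMapWithin (m := ∞) (by simp) h.isOpen.uniqueMDiffOn
  have h3 : ContMDiffAt 𝓘(ℝ, ℂ) 𝓘(ℝ, ℂ).tangent ∞
      (fun w => (⟨w, f w⟩ : TangentBundle 𝓘(ℝ, ℂ) ℂ)) z :=
    contMDiffAt_vectorSpace_iff_contDiffAt.2 (h.smooth.contDiffAt (h.isOpen.mem_nhds hz))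
  have hσz : he.localInverse (e z) = z := he.localInverse_left_inv he.localInverse_mem_target
  have h4 : ContMDiffAt (𝓡 2) 𝓘(ℝ, ℂ).tangent ∞ (fun q : S =>
      (⟨he.localInverse q, f (he.localInverse q)⟩ : TangentBundle 𝓘(ℝ, ℂ) ℂ)) (e z) := by
    rw [← hσz] at h3
    exact h3.comp (e z) he.localInverse_contMDiffAt
  have hopen : (Bundle.TotalSpace.proj ⁻¹' U : Set (TangentBundle 𝓘(ℝ, ℂ) ℂ)) ∈
      𝓝 (⟨he.localInverse (e z), f (he.localInverse (e z))⟩ : TangentBundle 𝓘(ℝ, ℂ) ℂ) := by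
    refine (h.isOpen.preimage (FiberBundle.continuous_proj ℂ _)).mem_nhds ?_
    simp only [mem_preimage]
    rw [hσz]; exact hz
  have h5 := (h2.contMDiffAt hopen).comp (e z) h4
  refine h5.congr_of_eventuallyEq ?_
  have hU : ∀ᶠ q in 𝓝 (e z), he.localInverse q ∈ U := by
    refine he.localInverse_contMDiffAt.continuousAt.eventually ?_
    rw [hσz]; exact h.isOpen.mem_nhds hz
  filter_upwards [he.localInverse_eventuallyEq_right, hU] with q hq hqU
  simp only [Function.comp_apply, id_eq] at hq
  simp only [Function.comp_apply, tangentMapWithin]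
  rw [mfderivWithin_of_isOpen h.isOpen hqU, ← h.map_eq _ hqU, hq]

variable [T2Space S]

/-- In a local parametrization, the flow lines are those of the planar vector field. -/
theorem IsPushforwardOn.exists_local_flow (h : IsPushforwardOn e U f X)
    (hX : IsLocalPushforward X) {ψ : ℝ → S → S} (h0 : ∀ p, ψ 0 p = p)
    (hψ : ∀ p, IsMIntegralCurve (I := 𝓡 2) (fun t => ψ t p) X) {z₀ : ℂ} (hz₀ : z₀ ∈ U) :
    ∃ ε > 0, ∃ φ : ℝ × ℂ → ℂ, ContDiffAt ℝ ∞ φ (0, z₀) ∧ ∀ᶠ z in 𝓝 z₀, φ (0, z) = z ∧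
      ∀ t ∈ Ioo (-ε) ε, φ (t, z) ∈ U ∧ HasDerivAt (fun s => φ (s, z)) (f (φ (t, z))) t ∧
        ψ t (e z) = e (φ (t, z)) := by
  obtain ⟨ε, hε, φ, hφ, hz⟩ := SurfaceFlow.exists_local_flow h.isOpen h.smooth hz₀
  refine ⟨ε, hε, φ, hφ, ?_⟩
  filter_upwards [hz] with z hz
  refine ⟨hz.1, fun t ht => ⟨(hz.2 t ht).1, (hz.2 t ht).2, ?_⟩⟩
  refine isMIntegralCurveOn_Ioo_eqOn_of_contMDiff_boundaryless (t₀ := 0) (a := -ε) (b := ε)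
    (γ := fun t => ψ t (e z)) (γ' := fun t => e (φ (t, z))) ⟨by linarith, hε⟩
    (hX.contMDiff.of_le (by simp)) ((hψ (e z)).isMIntegralCurveOn _) ?_ ?_ ht
  · intro s hs
    exact (h.hasMFDerivAt (γ := fun t => φ (t, z)) (hz.2 s hs).1
      (hz.2 s hs).2).hasMFDerivWithinAt
  · simp only [h0, hz.1]

/-- Planar flow lines are pushed forward. On a compact surface their time of existence is uniform,
so they extend to the whole line. -/
theorem IsLocalPushforward.exists_integralCurve [CompactSpace S] (hX : IsLocalPushforward X)
    (p : S) : ∃ γ : ℝ → S, γ 0 = p ∧ IsMIntegralCurve (I := 𝓡 2) γ X := by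
  obtain ⟨ε, hε, h⟩ := exists_uniform_of_isCompact (isCompact_univ (X := S))
    (P := fun ε q => ∃ γ : ℝ → S, γ 0 = q ∧ IsMIntegralCurveOn (I := 𝓡 2) γ X (Ioo (-ε) ε))
    (fun {ε ε' y} hle ⟨γ, h1, h2⟩ =>
      ⟨γ, h1, h2.mono (Ioo_subset_Ioo (neg_le_neg hle) hle)⟩) (by
    intro p _
    obtain ⟨e, U, f, h, z, hz, rfl⟩ := hX p
    obtain ⟨ε, hε, φ, hφ, hev⟩ := SurfaceFlow.exists_local_flow h.isOpen h.smooth hz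
    refine ⟨ε, hε, ?_⟩
    have he := h.localDiffeo z hz
    have hσz : he.localInverse (e z) = z := he.localInverse_left_inv he.localInverse_mem_target
    have hc := he.localInverse_contMDiffAt.continuousAt
    rw [ContinuousAt, hσz] at hc
    filter_upwards [he.localInverse_eventuallyEq_right, hc.eventually hev] with q hq hq2
    refine ⟨fun t => e (φ (t, he.localInverse q)), ?_, fun s hs => ?_⟩
    · simp only [hq2.1]; exact hq
    · exact (h.hasMFDerivAt (γ := fun t => φ (t, he.localInverse q)) (hq2.2 s hs).1
        (hq2.2 s hs).2).hasMFDerivWithinAt)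
  exact exists_isMIntegralCurve_of_isMIntegralCurveOn (hX.contMDiff.of_le (by simp)) hε
    (fun q => h q (mem_univ q)) p

/-- By uniqueness of integral curves the flow is, in a parametrization, the planar local flow, which
is smooth. -/
theorem IsLocalPushforward.contMDiffAt_zero (hX : IsLocalPushforward X) {ψ : ℝ → S → S}
    (h0 : ∀ p, ψ 0 p = p) (hψ : ∀ p, IsMIntegralCurve (I := 𝓡 2) (fun t => ψ t p) X) (p : S) :
    ContMDiffAt (𝓘(ℝ, ℝ).prod (𝓡 2)) (𝓡 2) ∞ (fun x : ℝ × S => ψ x.1 x.2) (0, p) := by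
  obtain ⟨e, U, f, h, z, hz, rfl⟩ := hX p
  obtain ⟨ε, hε, φ, hφ, hev⟩ := h.exists_local_flow hX h0 hψ hz
  have he := h.localDiffeo z hz
  have hσz : he.localInverse (e z) = z := he.localInverse_left_inv he.localInverse_mem_target
  have hφ0 : φ (0, z) = z := hev.self_of_nhds.1
  have h1 : ContMDiffAt (𝓘(ℝ, ℝ).prod (𝓡 2)) 𝓘(ℝ, ℝ × ℂ) ∞
      (fun x : ℝ × S => (x.1, he.localInverse x.2)) (0, e z) := by
    rw [← modelWithCornersSelf_prod, ← chartedSpaceSelf_prod]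
    have hs : ContMDiffAt (𝓘(ℝ, ℝ).prod (𝓡 2)) (𝓡 2) ∞ (Prod.snd : ℝ × S → S) (0, e z) :=
      contMDiffAt_snd
    exact contMDiffAt_fst.prodMk (he.localInverse_contMDiffAt.comp (0, e z) hs)
  have h2 : ContMDiffAt 𝓘(ℝ, ℝ × ℂ) 𝓘(ℝ, ℂ) ∞ φ (0, he.localInverse (e z)) := by
    rw [hσz]; exact hφ.contMDiffAt
  have h3 : ContMDiffAt 𝓘(ℝ, ℂ) (𝓡 2) ∞ e (φ (0, he.localInverse (e z))) := by
    rw [hσz, hφ0]; exact he.contMDiffAt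
  have h4 := ContMDiffAt.comp (0, e z) h3 (ContMDiffAt.comp (0, e z) h2 h1)
  refine h4.congr_of_eventuallyEq ?_
  have hc := he.localInverse_contMDiffAt.continuousAt
  rw [ContinuousAt, hσz] at hc
  have h5 := he.localInverse_eventuallyEq_right.and (hc.eventually hev)
  have h6 : ∀ᶠ x : ℝ × S in 𝓝 (0, e z), x.1 ∈ Ioo (-ε) ε :=
    (continuous_fst.tendsto ((0 : ℝ), e z)).eventually (Ioo_mem_nhds (by simpa using hε) hε)
  filter_upwards [h6, (continuous_snd.tendsto ((0 : ℝ), e z)).eventually h5] with x hx1 hx2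
  have h7 := (hx2.2.2 x.1 hx1).2.2
  have h8 : e (he.localInverse x.2) = x.2 := hx2.1
  rw [h8] at h7
  exact h7

/-- The vector field generates a smooth flow. -/
theorem IsLocalPushforward.exists_flow [CompactSpace S] (hX : IsLocalPushforward X) :
    ∃ ψ : ℝ → S → S, (∀ p, ψ 0 p = p) ∧ (∀ s t p, ψ (s + t) p = ψ s (ψ t p)) ∧
      (∀ p, IsMIntegralCurve (I := 𝓡 2) (fun t => ψ t p) X) ∧
      ContMDiff (𝓘(ℝ, ℝ).prod (𝓡 2)) (𝓡 2) ∞ (fun x : ℝ × S => ψ x.1 x.2) := by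
  choose γ hγ0 hγ using hX.exists_integralCurve
  let ψ : ℝ → S → S := fun t p => γ p t
  have h0 : ∀ p, ψ 0 p = p := hγ0
  have hadd : ∀ s t p, ψ (s + t) p = ψ s (ψ t p) := by
    intro s t p
    have := isMIntegralCurve_Ioo_eq_of_contMDiff_boundaryless (t₀ := 0)
      (hX.contMDiff.of_le (by simp)) ((hγ p).comp_add t) (hγ (γ p t))
      (by simp only [Function.comp_apply, zero_add, hγ0])
    exact congrFun this s
  refine ⟨ψ, h0, hadd, hγ, ?_⟩
  -- A finite order `n` is fixed first: regularity of order `n` at a point spreads to a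
  -- neighbourhood, but that neighbourhood may shrink as `n` grows.
  rw [contMDiff_infty]
  intro n
  obtain ⟨ε, hε, hsm⟩ := exists_uniform_of_isCompact (isCompact_univ (X := S))
    (P := fun ε q => ∀ t, |t| < ε → ContMDiffAt (𝓘(ℝ, ℝ).prod (𝓡 2)) (𝓡 2) n
      (fun x : ℝ × S => ψ x.1 x.2) (t, q)) (fun hle h t ht => h t (ht.trans_le hle)) (by
    intro p _
    have h1 : ContMDiffAt (𝓘(ℝ, ℝ).prod (𝓡 2)) (𝓡 2) n (fun x : ℝ × S => ψ x.1 x.2) (0, p) :=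
      contMDiffAt_infty.1 (hX.contMDiffAt_zero h0 hγ p) n
    have h2 := (contMDiffAt_iff_contMDiffAt_nhds (by simp)).1 h1
    rw [nhds_prod_eq, eventually_prod_iff] at h2
    obtain ⟨P, hP, Q, hQ, h2⟩ := h2
    obtain ⟨ε, hε, hb⟩ := Metric.eventually_nhds_iff.1 hP
    refine ⟨ε, hε, ?_⟩
    filter_upwards [hQ] with q hq t ht
    exact h2 (hb (by simpa using ht)) hq)
  -- Near time `s + t` the flow is `ψ (· - t)` after `ψ t`. Regularity thus propagates by steps
  -- shorter than `ε`, and below any time `t` is reached in `k` equal steps.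
  have step : ∀ s t, |s| < ε → (∀ q, ContMDiffAt (𝓘(ℝ, ℝ).prod (𝓡 2)) (𝓡 2) n
      (fun x : ℝ × S => ψ x.1 x.2) (t, q)) → ∀ q, ContMDiffAt (𝓘(ℝ, ℝ).prod (𝓡 2)) (𝓡 2) n
      (fun x : ℝ × S => ψ x.1 x.2) (s + t, q) := by
    intro s t hs ht q
    have h1 : ContMDiffAt (𝓡 2) (𝓡 2) n (fun q => ψ t q) q :=
      (ht q).comp q (contMDiffAt_const.prodMk contMDiffAt_id)
    have h2 : ContMDiffAt (𝓘(ℝ, ℝ).prod (𝓡 2)) 𝓘(ℝ, ℝ) n (fun x : ℝ × S => x.1 - t) (s + t, q) :=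
      contMDiffAt_fst.sub contMDiffAt_const
    have h3 : ContMDiffAt (𝓘(ℝ, ℝ).prod (𝓡 2)) (𝓘(ℝ, ℝ).prod (𝓡 2)) n
        (fun x : ℝ × S => (x.1 - t, ψ t x.2)) (s + t, q) :=
      h2.prodMk (ContMDiffAt.comp (s + t, q) h1 contMDiffAt_snd)
    have h4 := ContMDiffAt.comp (s + t, q) (g := fun x : ℝ × S => ψ x.1 x.2)
      (by simpa using hsm (ψ t q) (mem_univ _) s hs) h3
    refine h4.congr_of_eventuallyEq (Eventually.of_forall fun x => ?_)
    simp only [Function.comp_apply, ← hadd, sub_add_cancel]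
  rintro ⟨t, q⟩
  obtain ⟨k, hk⟩ := exists_nat_gt (|t| / ε)
  have hk0 : (0 : ℝ) < k := lt_of_le_of_lt (by positivity) hk
  have hs : |t / k| < ε := by
    rw [abs_div, abs_of_pos hk0, div_lt_iff₀ hk0]
    rwa [div_lt_iff₀ hε, mul_comm] at hk
  have hall : ∀ j : ℕ, ∀ q, ContMDiffAt (𝓘(ℝ, ℝ).prod (𝓡 2)) (𝓡 2) n
      (fun x : ℝ × S => ψ x.1 x.2) (j * (t / k), q) := by
    intro j
    induction j with
    | zero => intro q; simpa using hsm q (mem_univ _) 0 (by simpa using hε)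
    | succ j ih =>
      have := step (t / k) (j * (t / k)) hs ih
      intro q
      convert this q using 2
      push_cast; ring
  have := hall k q
  rwa [mul_div_cancel₀ _ hk0.ne'] at this

end Flow

/-! ### The linearized flow -/

section Variation

theorem two_le_infty : (2 : ℕ∞ω) ≤ ∞ := WithTop.coe_le_coe.2 (le_top : (2 : ℕ∞) ≤ ⊤)

theorem eventually_differentiableAt_slice {E F : Type*} [NormedAddCommGroup E] [NormedSpace ℝ E]
    [NormedAddCommGroup F] [NormedSpace ℝ F] {φ : ℝ × E → F} {x₀ : E}
    (hφ : ContDiffAt ℝ ∞ φ (0, x₀)) : ∀ᶠ t in 𝓝 (0 : ℝ),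
      HasFDerivAt (fun x => φ (t, x)) ((fderiv ℝ φ (t, x₀)).comp (.inr ℝ ℝ E)) x₀ := by
  have h1 : ∀ᶠ p in 𝓝 ((0 : ℝ), x₀), ContDiffAt ℝ 1 φ p :=
    (contDiffAt_infty.1 hφ 1).eventually (by simp)
  have h2 : Continuous fun t : ℝ => (t, x₀) := by fun_prop
  filter_upwards [(h2.tendsto 0).eventually h1] with t ht
  exact (ht.differentiableAt (by simp)).hasFDerivAt.comp x₀
    (hasFDerivAt_prodMk_right (𝕜 := ℝ) t x₀)

/-- The derivative of the linearized flow at time zero is the derivative of the vector field. -/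
theorem hasDerivAt_fderiv_flow {E : Type*} [NormedAddCommGroup E] [NormedSpace ℝ E]
    {φ : ℝ × E → E} {f : E → E} {x₀ : E}
    (hφ : ContDiffAt ℝ ∞ φ (0, x₀))
    (h : ∀ᶠ x in 𝓝 x₀, HasDerivAt (fun s => φ (s, x)) (f x) 0) (v : E) :
    HasDerivAt (fun t => fderiv ℝ (fun x => φ (t, x)) x₀ v) (fderiv ℝ f x₀ v) 0 := by
  have hd : DifferentiableAt ℝ (fderiv ℝ φ) (0, x₀) :=
    (hφ.fderiv_right (m := 1) (by norm_cast)).differentiableAt (by simp)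
  have hD := hd.hasFDerivAt
  have h1 : HasDerivAt (fun t : ℝ => fderiv ℝ φ (t, x₀) (0, v))
      (fderiv ℝ (fderiv ℝ φ) (0, x₀) (1, 0) (0, v)) 0 := by
    have h2 := hD.comp_hasDerivAt (0 : ℝ) (f := fun t : ℝ => (t, x₀)) (f' := ((1 : ℝ), (0 : E)))
      ((hasDerivAt_id (0 : ℝ)).prodMk (hasDerivAt_const 0 x₀))
    exact h2.clm_apply (hasDerivAt_const (0 : ℝ) ((0 : ℝ), v)) |>.congr_deriv (by simp)
  have h3 : HasFDerivAt f (((ContinuousLinearMap.apply ℝ E ((1 : ℝ), (0 : E))).comp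
      (fderiv ℝ (fderiv ℝ φ) (0, x₀))).comp (.inr ℝ ℝ E)) x₀ := by
    have h4 : HasFDerivAt (fun x => fderiv ℝ φ (0, x) ((1 : ℝ), (0 : E)))
        (((ContinuousLinearMap.apply ℝ E ((1 : ℝ), (0 : E))).comp
          (fderiv ℝ (fderiv ℝ φ) (0, x₀))).comp (.inr ℝ ℝ E)) x₀ :=
      ((ContinuousLinearMap.apply ℝ E ((1 : ℝ), (0 : E))).hasFDerivAt.comp ((0 : ℝ), x₀) hD).comp x₀
        (hasFDerivAt_prodMk_right (𝕜 := ℝ) (0 : ℝ) x₀)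
    refine h4.congr_of_eventuallyEq ?_
    have h5 : ∀ᶠ p in 𝓝 ((0 : ℝ), x₀), ContDiffAt ℝ 1 φ p :=
      (contDiffAt_infty.1 hφ 1).eventually (by simp)
    have h6 : Continuous fun x : E => ((0 : ℝ), x) := by fun_prop
    filter_upwards [h, (h6.tendsto x₀).eventually h5] with x hx hx2
    have h7 := (hx2.differentiableAt (by simp)).hasFDerivAt.comp_hasDerivAt (0 : ℝ)
      (f := fun t : ℝ => (t, x)) (f' := ((1 : ℝ), (0 : E)))
      ((hasDerivAt_id (0 : ℝ)).prodMk (hasDerivAt_const 0 x))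
    exact hx.unique h7
  -- Symmetry of the second derivative exchanges the time derivative of the linearized flow with the
  -- space derivative of the velocity, which at time zero is `f`.
  have hs : IsSymmSndFDerivAt ℝ φ (0, x₀) := hφ.isSymmSndFDerivAt (by simpa using two_le_infty)
  have h8 : fderiv ℝ f x₀ v = fderiv ℝ (fderiv ℝ φ) (0, x₀) (1, 0) (0, v) := by
    rw [h3.fderiv, hs.eq]
    simp
  rw [h8]
  refine h1.congr_of_eventuallyEq ?_
  filter_upwards [eventually_differentiableAt_slice hφ] with t ht
  rw [ht.fderiv]
  simp

end Variation

/-! ### Invariance of the area form, hyperbolicity and fixed points -/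

section LinearizedFlow

variable {S : Type*} [TopologicalSpace S] [ChartedSpace (EuclideanSpace ℝ (Fin 2)) S]
  {X : VField S} {e : ℂ → S} {U : Set ℂ} {f : ℂ → ℂ} 

/-- The differential of a parametrization, as a map to the model space. -/
def diffParam (e : ℂ → S) (z : ℂ) : ℂ →L[ℝ] EuclideanSpace ℝ (Fin 2) :=
  mfderiv 𝓘(ℝ, ℂ) (𝓡 2) e z

/-- The differential of a self-map, as an endomorphism of the model space. -/
def diffMap (F : S → S) (p : S) : EuclideanSpace ℝ (Fin 2) →L[ℝ] EuclideanSpace ℝ (Fin 2) :=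
  mfderiv (𝓡 2) (𝓡 2) F p

/-- A bilinear form at a point, as a form on the model space. -/
def formAt (Ω : BilinForm S) (p : S) :
    EuclideanSpace ℝ (Fin 2) →L[ℝ] EuclideanSpace ℝ (Fin 2) →L[ℝ] ℝ := Ω p

/-- The planar vector field `f` on `U` is Hamiltonian with Hamiltonian `H` for the area form with
density `ρ`, and this area form is the pull-back of `Ω` under `e`. -/
structure IsHamiltonianOn (Ω : BilinForm S) (e : ℂ → S) (U : Set ℂ) (f : ℂ → ℂ)
    (ρ H : ℂ → ℝ) : Prop where
  form_eq : ∀ z ∈ U, ∀ v w : ℂ, formAt Ω (e z) (diffParam e z v) (diffParam e z w) =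
    ρ z * (starRingEnd ℂ v * w).im
  smooth_density : ContDiffOn ℝ ∞ ρ U
  smooth_hamiltonian : ContDiffOn ℝ ∞ H U
  fderiv_eq : ∀ z ∈ U, ∀ w : ℂ, ρ z * (starRingEnd ℂ (f z) * w).im = fderiv ℝ H z w

/-- Chain rule for `ψ t ∘ e = e ∘ φ (t, ·)` near `z₀`. -/
theorem IsPushforwardOn.mfderiv_flow (h : IsPushforwardOn e U f X) {ψ : ℝ → S → S}
    (hsm : ContMDiff (𝓘(ℝ, ℝ).prod (𝓡 2)) (𝓡 2) ∞ (fun x : ℝ × S => ψ x.1 x.2))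
    {z₀ : ℂ} (hz₀ : z₀ ∈ U) {ε : ℝ} (hε : 0 < ε) {φ : ℝ × ℂ → ℂ}
    (hφ : ContDiffAt ℝ ∞ φ (0, z₀)) (hev : ∀ᶠ z in 𝓝 z₀, ∀ t ∈ Ioo (-ε) ε, φ (t, z) ∈ U ∧
      ψ t (e z) = e (φ (t, z))) :
    ∀ᶠ t in 𝓝 (0 : ℝ), ∀ v : ℂ, diffMap (ψ t) (e z₀) (diffParam e z₀ v) =
      diffParam e (φ (t, z₀)) (fderiv ℝ (fun z => φ (t, z)) z₀ v) := by
  filter_upwards [eventually_differentiableAt_slice hφ, Ioo_mem_nhds (neg_lt_zero.2 hε) hε]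
    with t ht htε v
  have h1 : MDifferentiableAt (𝓡 2) (𝓡 2) (ψ t) (e z₀) :=
    ((hsm.comp (contMDiff_const.prodMk contMDiff_id)).mdifferentiable (by simp)) (e z₀)
  have h2 : MDifferentiableAt 𝓘(ℝ, ℂ) (𝓡 2) e z₀ :=
    (h.localDiffeo _ hz₀).mdifferentiableAt (by simp)
  have h3 : MDifferentiableAt 𝓘(ℝ, ℂ) (𝓡 2) e (φ (t, z₀)) :=
    (h.localDiffeo _ (hev.self_of_nhds t htε).1).mdifferentiableAt (by simp)
  have h4 : MDifferentiableAt 𝓘(ℝ, ℂ) 𝓘(ℝ, ℂ) (fun z => φ (t, z)) z₀ :=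
    ht.differentiableAt.mdifferentiableAt
  have h5 : ψ t ∘ e =ᶠ[𝓝 z₀] e ∘ fun z => φ (t, z) := by
    filter_upwards [hev] with z hz using (hz t htε).2
  have h6 := mfderiv_comp z₀ h1 h2
  have h7 := mfderiv_comp z₀ (f := fun z => φ (t, z)) h3 h4
  have h8 := h5.mfderiv_eq (I := 𝓘(ℝ, ℂ)) (I' := 𝓡 2)
  rw [mfderiv_eq_fderiv] at h7
  have h9 := DFunLike.congr_fun (h6.symm.trans (h8.trans h7)) v
  exact h9

theorem diffMap_flow_zero {ψ : ℝ → S → S} (h0 : ∀ p, ψ 0 p = p) (p : S)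
    (v : EuclideanSpace ℝ (Fin 2)) : diffMap (ψ 0) p v = v := by
  have : ψ 0 = id := funext h0
  rw [this, diffMap, mfderiv_id]
  rfl

theorem diffMap_flow_add {ψ : ℝ → S → S}
    (hsm : ContMDiff (𝓘(ℝ, ℝ).prod (𝓡 2)) (𝓡 2) ∞ (fun x : ℝ × S => ψ x.1 x.2))
    (hadd : ∀ s t p, ψ (s + t) p = ψ s (ψ t p)) (s t : ℝ) (p : S)
    (v : EuclideanSpace ℝ (Fin 2)) :
    diffMap (ψ (s + t)) p v = diffMap (ψ s) (ψ t p) (diffMap (ψ t) p v) := by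
  have hd : ∀ t p, MDifferentiableAt (𝓡 2) (𝓡 2) (ψ t) p := fun t p =>
    ((hsm.comp (contMDiff_const.prodMk contMDiff_id)).mdifferentiable (by simp)) p
  have : ψ (s + t) = ψ s ∘ ψ t := funext (hadd s t)
  rw [this, diffMap, mfderiv_comp p (hd s _) (hd t p)]
  rfl

/-- This is Cartan's formula: the Lie derivative of the area form along `f` is `ddH = 0`. In
coordinates, the Hamiltonian equation is differentiated and antisymmetrized in `v` and `w`; the
second derivative of `H` drops out by symmetry. -/
theorem IsHamiltonianOn.divergence_eq {Ω : BilinForm S} {ρ H : ℂ → ℝ}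
    (hH : IsHamiltonianOn Ω e U f ρ H) (hU : IsOpen U) (hf : ContDiffOn ℝ ∞ f U) {z : ℂ}
    (hz : z ∈ U) (v w : ℂ) :
    fderiv ℝ ρ z (f z) * (starRingEnd ℂ v * w).im + ρ z *
      ((starRingEnd ℂ (fderiv ℝ f z v) * w).im + (starRingEnd ℂ v * fderiv ℝ f z w).im) = 0 := by
  have hn := hU.mem_nhds hz
  have hρ : HasFDerivAt ρ (fderiv ℝ ρ z) z :=
    ((hH.smooth_density.contDiffAt hn).differentiableAt (by simp)).hasFDerivAt
  have hf' : HasFDerivAt f (fderiv ℝ f z) z :=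
    ((hf.contDiffAt hn).differentiableAt (by simp)).hasFDerivAt
  have hHs : IsSymmSndFDerivAt ℝ H z :=
    (hH.smooth_hamiltonian.contDiffAt hn).isSymmSndFDerivAt (by simpa using two_le_infty)
  have hHd : HasFDerivAt (fderiv ℝ H) (fderiv ℝ (fderiv ℝ H) z) z :=
    (((hH.smooth_hamiltonian.contDiffAt hn).fderiv_right (m := 1)
      (by norm_cast)).differentiableAt (by simp)).hasFDerivAt
  have key : ∀ v w : ℂ, fderiv ℝ (fderiv ℝ H) z v w = fderiv ℝ ρ z v * (starRingEnd ℂ (f z) * w).im +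
      ρ z * (starRingEnd ℂ (fderiv ℝ f z v) * w).im := by
    intro v w
    have h1 : HasDerivAt (fun t : ℝ => z + t • v) v 0 := by
      simpa using ((hasDerivAt_id (0 : ℝ)).smul_const v).const_add z
    have e0 : z + (0 : ℝ) • v = z := by simp
    have h2 : HasDerivAt (fun t : ℝ => fderiv ℝ H (z + t • v) w)
        (fderiv ℝ (fderiv ℝ H) z v w) 0 := by
      have h3 : HasFDerivAt (fderiv ℝ H) (fderiv ℝ (fderiv ℝ H) z) (z + (0 : ℝ) • v) := by
        rw [e0]; exact hHd
      exact (ContinuousLinearMap.apply ℝ ℝ w).hasFDerivAt.comp_hasDerivAt (0 : ℝ)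
        (h3.comp_hasDerivAt (0 : ℝ) h1)
    have h3 : HasDerivAt (fun t : ℝ => ρ (z + t • v)) (fderiv ℝ ρ z v) 0 :=
      HasFDerivAt.comp_hasDerivAt (0 : ℝ) (by rw [e0]; exact hρ) h1
    have h4 : HasDerivAt (fun t : ℝ => f (z + t • v)) (fderiv ℝ f z v) 0 :=
      HasFDerivAt.comp_hasDerivAt (0 : ℝ) (by rw [e0]; exact hf') h1
    have h5 : HasDerivAt (fun t : ℝ => (starRingEnd ℂ (f (z + t • v)) * w).im)
        (starRingEnd ℂ (fderiv ℝ f z v) * w).im 0 := by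
      have h6 : HasDerivAt (fun t : ℝ => starRingEnd ℂ (f (z + t • v)))
          (starRingEnd ℂ (fderiv ℝ f z v)) 0 :=
        Complex.conjCLE.toContinuousLinearMap.hasFDerivAt.comp_hasDerivAt (0 : ℝ) h4
      exact Complex.imCLM.hasFDerivAt.comp_hasDerivAt (0 : ℝ) (h6.mul_const w)
    have h7 := h3.mul h5
    have h8 : (fun t : ℝ => fderiv ℝ H (z + t • v) w) =ᶠ[𝓝 0]
        fun t => ρ (z + t • v) * (starRingEnd ℂ (f (z + t • v)) * w).im := by
      have : ∀ᶠ t : ℝ in 𝓝 0, z + t • v ∈ U := by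
        refine h1.continuousAt.eventually ?_
        simp only [e0]; exact hn
      filter_upwards [this] with t ht using (hH.fderiv_eq _ ht w).symm
    have h9 := h2.unique (h7.congr_of_eventuallyEq h8)
    rw [h9]
    simp
  have h1 := key v w
  rw [hHs.eq, key w v] at h1
  -- Cramer's rule in the plane, which combines the derivatives of `ρ` along `v` and `w` into the
  -- one along `f z`.
  have h2 : (starRingEnd ℂ v * w).im • f z =
      (starRingEnd ℂ (f z) * w).im • v - (starRingEnd ℂ (f z) * v).im • w := by
    apply Complex.ext <;> simp <;> ring
  have h3 := congrArg (fderiv ℝ ρ z) h2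
  rw [map_sub, map_smul, map_smul, map_smul, smul_eq_mul, smul_eq_mul, smul_eq_mul] at h3
  have h4 : (starRingEnd ℂ v * fderiv ℝ f z w).im = -(starRingEnd ℂ (fderiv ℝ f z w) * v).im := by
    simp; ring
  rw [h4]
  linear_combination h3 - h1

/-- The infinitesimal form of the invariance of the area form. -/
theorem IsHamiltonianOn.hasDerivAt_form [T2Space S] [IsManifold (𝓡 2) ∞ S] {Ω : BilinForm S}
    {ρ H : ℂ → ℝ} (hH : IsHamiltonianOn Ω e U f ρ H) (h : IsPushforwardOn e U f X)
    (hX : IsLocalPushforward X) {ψ : ℝ → S → S} (h0 : ∀ p, ψ 0 p = p)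
    (hψ : ∀ p, IsMIntegralCurve (I := 𝓡 2) (fun t => ψ t p) X)
    (hsm : ContMDiff (𝓘(ℝ, ℝ).prod (𝓡 2)) (𝓡 2) ∞ (fun x : ℝ × S => ψ x.1 x.2))
    {z₀ : ℂ} (hz₀ : z₀ ∈ U) (v w : ℂ) :
    HasDerivAt (fun t => formAt Ω (ψ t (e z₀)) (diffMap (ψ t) (e z₀) (diffParam e z₀ v))
      (diffMap (ψ t) (e z₀) (diffParam e z₀ w))) 0 0 := by
  obtain ⟨ε, hε, φ, hφ, hev⟩ := h.exists_local_flow hX h0 hψ hz₀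
  have hI : (0 : ℝ) ∈ Ioo (-ε) ε := ⟨by linarith, hε⟩
  have hφ0 : φ (0, z₀) = z₀ := hev.self_of_nhds.1
  have hD : ∀ v, HasDerivAt (fun t => fderiv ℝ (fun x => φ (t, x)) z₀ v) (fderiv ℝ f z₀ v) 0 :=
    hasDerivAt_fderiv_flow hφ (by
      filter_upwards [hev] with z hz
      have := (hz.2 0 hI).2.1
      rwa [hz.1] at this)
  have hD0 : ∀ v, fderiv ℝ (fun x => φ (0, x)) z₀ v = v := by
    intro v
    have : (fun x => φ (0, x)) =ᶠ[𝓝 z₀] id := by filter_upwards [hev] with z hz using hz.1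
    rw [this.fderiv_eq, fderiv_id]; rfl
  have hρ : HasDerivAt (fun t => ρ (φ (t, z₀))) (fderiv ℝ ρ z₀ (f z₀)) 0 := by
    have h1 := (hev.self_of_nhds.2 0 hI).2.1
    rw [hφ0] at h1
    refine HasFDerivAt.comp_hasDerivAt (0 : ℝ) ?_ h1
    rw [hφ0]
    exact ((hH.smooth_density.contDiffAt (h.isOpen.mem_nhds hz₀)).differentiableAt
      (by simp)).hasFDerivAt
  have hconj : HasDerivAt (fun t => starRingEnd ℂ (fderiv ℝ (fun x => φ (t, x)) z₀ v))
      (starRingEnd ℂ (fderiv ℝ f z₀ v)) 0 :=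
    Complex.conjCLE.toContinuousLinearMap.hasFDerivAt.comp_hasDerivAt (0 : ℝ) (hD v)
  have him := Complex.imCLM.hasFDerivAt.comp_hasDerivAt (0 : ℝ) (hconj.mul (hD w))
  have h1 := hρ.mul him
  have h2 : fderiv ℝ ρ z₀ (f z₀) * (starRingEnd ℂ v * w).im + ρ z₀ *
      (starRingEnd ℂ (fderiv ℝ f z₀ v) * w + starRingEnd ℂ v * fderiv ℝ f z₀ w).im = 0 := by
    rw [Complex.add_im]; exact hH.divergence_eq h.isOpen h.smooth hz₀ v w
  have h3 := h1.congr_deriv (g' := 0) (by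
    simp only [Function.comp_apply, hφ0, hD0, Complex.imCLM_apply, Pi.mul_apply]
    exact h2)
  refine h3.congr_of_eventuallyEq ?_
  filter_upwards [h.mfderiv_flow hsm hz₀ hε hφ
    (by filter_upwards [hev] with z hz t ht using ⟨(hz.2 t ht).1, (hz.2 t ht).2.2⟩),
    Ioo_mem_nhds hI.1 hI.2] with t ht htε
  have h4 := hev.self_of_nhds.2 t htε
  rw [h4.2.2, ht v, ht w, hH.form_eq _ h4.1]
  rfl

/-- By the group law, the derivative at time `t` of the pulled-back form is a derivative at time
zero based at `ψ t p`. So it vanishes for all `t`. -/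
theorem flow_preserves {Ω : BilinForm S} {ψ : ℝ → S → S} (h0 : ∀ p, ψ 0 p = p)
    (hsm : ContMDiff (𝓘(ℝ, ℝ).prod (𝓡 2)) (𝓡 2) ∞ (fun x : ℝ × S => ψ x.1 x.2))
    (hadd : ∀ s t p, ψ (s + t) p = ψ s (ψ t p))
    (h : ∀ p (v w : EuclideanSpace ℝ (Fin 2)), HasDerivAt (fun t => formAt Ω (ψ t p)
      (diffMap (ψ t) p v) (diffMap (ψ t) p w)) 0 0)
    (t : ℝ) (p : S) (v w : EuclideanSpace ℝ (Fin 2)) :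
    formAt Ω (ψ t p) (diffMap (ψ t) p v) (diffMap (ψ t) p w) = formAt Ω p v w := by
  set Q : ℝ → ℝ := fun t => formAt Ω (ψ t p) (diffMap (ψ t) p v) (diffMap (ψ t) p w) with hQ
  have hd : ∀ t, HasDerivAt Q 0 t := by
    intro t
    have h1 := h (ψ t p) (diffMap (ψ t) p v) (diffMap (ψ t) p w)
    simp only [← diffMap_flow_add hsm hadd, ← hadd] at h1
    have h3 := HasDerivAt.comp_sub_const t t (f := fun s => Q (s + t)) (f' := 0)
      (by simpa using h1)
    simpa using h3
  have hconst : Q t = Q 0 := is_const_of_deriv_eq_zero (fun t => (hd t).differentiableAt)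
    (fun t => (hd t).deriv) t 0
  have hQ0 : Q 0 = formAt Ω p v w := by
    simp only [hQ, diffMap_flow_zero h0, h0]
  exact hconst.trans hQ0

/-- The differential of a parametrization, as an equivalence. -/
theorem IsPushforwardOn.exists_equiv (h : IsPushforwardOn e U f X) {z : ℂ} (hz : z ∈ U) :
    ∃ P : ℂ ≃L[ℝ] EuclideanSpace ℝ (Fin 2), ∀ v, P v = diffParam e z v :=
  ⟨(h.localDiffeo z hz).mfderivToContinuousLinearEquiv (by simp), fun _ => rfl⟩

/-- `A` is diagonal in the basis `P 1`, `P I`, and `exp κ`, `exp (-κ)` are positive and different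
from `1`. -/
theorem isHyperbolicMap_of_eigenvectors (A : EuclideanSpace ℝ (Fin 2) →L[ℝ] EuclideanSpace ℝ (Fin 2))
    (P : ℂ ≃L[ℝ] EuclideanSpace ℝ (Fin 2)) {κ : ℝ} (hκ : κ ≠ 0)
    (h1 : A (P 1) = Real.exp κ • P 1) (h2 : A (P Complex.I) = Real.exp (-κ) • P Complex.I) :
    IsHyperbolicMap A := by
  let b : Module.Basis (Fin 2) ℝ (EuclideanSpace ℝ (Fin 2)) :=
    Complex.basisOneI.map P.toLinearEquiv
  have hb0 : b 0 = P 1 := by simp [b]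
  have hb1 : b 1 = P Complex.I := by simp [b]
  have hM : LinearMap.toMatrix b b A.toLinearMap =
      Matrix.diagonal ![Real.exp κ, Real.exp (-κ)] := by
    ext i j
    rw [LinearMap.toMatrix_apply]
    have hj : A.toLinearMap (b j) = (![Real.exp κ, Real.exp (-κ)] j) • b j := by
      fin_cases j
      · simpa [hb0] using h1
      · simpa [hb1] using h2
    rw [hj, map_smul, Module.Basis.repr_self]
    by_cases hij : i = j
    · subst hij; simp
    · simp [hij]
  have hchar : A.toLinearMap.charpoly =
      (Polynomial.X - Polynomial.C (Real.exp κ)) * (Polynomial.X - Polynomial.C (Real.exp (-κ))) := by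
    rw [← LinearMap.charpoly_toMatrix A.toLinearMap b, hM, Matrix.charpoly_diagonal]
    simp
  intro z hz
  rw [hchar, Polynomial.map_mul, Polynomial.IsRoot.def, Polynomial.eval_mul, mul_eq_zero] at hz
  simp only [Polynomial.map_sub, Polynomial.map_X, Polynomial.map_C, Polynomial.eval_sub,
    Polynomial.eval_X, Polynomial.eval_C, sub_eq_zero, Complex.coe_algebraMap] at hz
  have key : ∀ c : ℝ, c ≠ 0 → z = (Real.exp c : ℂ) → z.im = 0 ∧ z ≠ 1 ∧ z ≠ -1 := by
    rintro c hc rfl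
    refine ⟨Complex.ofReal_im _, ?_, ?_⟩
    · intro h
      have : Real.exp c = 1 := by exact_mod_cast h
      exact hc (Real.exp_eq_one_iff c |>.1 this)
    · intro h
      have : Real.exp c = -1 := by exact_mod_cast h
      linarith [Real.exp_pos c]
  rcases hz with hz | hz
  · exact key κ hκ hz
  · exact key (-κ) (neg_ne_zero.2 hκ) hz

theorem exp_growth {F : Type*} [NormedAddCommGroup F] [NormedSpace ℝ F] {a : ℝ → F} {κ : ℝ}
    (h : ∀ t, HasDerivAt a (κ • a t) t) (t : ℝ) : a t = Real.exp (κ * t) • a 0 := by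
  have hd : ∀ t, HasDerivAt (fun t => Real.exp (-(κ * t)) • a t) 0 t := by
    intro t
    have h1 : HasDerivAt (fun t => Real.exp (-(κ * t))) (Real.exp (-(κ * t)) * -κ) t := by
      have : HasDerivAt (fun t => -(κ * t)) (-κ) t := by
        simpa using (hasDerivAt_id t).const_mul (-κ)
      exact this.exp
    refine (h1.smul (h t)).congr_deriv ?_
    rw [smul_smul, ← add_smul]
    simp
  have h2 := is_const_of_deriv_eq_zero (fun t => (hd t).differentiableAt)
    (fun t => (hd t).deriv) t 0
  simp only [mul_zero, neg_zero, Real.exp_zero, one_smul] at h2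
  rw [← h2, smul_smul, ← Real.exp_add]
  simp

/-- The transport along `hp` affects only the type; with a free end-point it can be eliminated. -/
theorem derivAtFixed_eq {F : S → S} {p : S} (hp : F p = p) (v : EuclideanSpace ℝ (Fin 2)) :
    @Eq (EuclideanSpace ℝ (Fin 2)) (derivAtFixed F p hp v) (diffMap F p v) := by
  have key : ∀ (q : S) (hq : F p = q), @Eq (EuclideanSpace ℝ (Fin 2))
      ((Eq.rec (motive := fun q _ => TangentSpace (𝓡 2) p →L[ℝ] TangentSpace (𝓡 2) q)
        (mfderiv (𝓡 2) (𝓡 2) F p) hq : TangentSpace (𝓡 2) p →L[ℝ] TangentSpace (𝓡 2) q) v)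
      (diffMap F p v) := by
    rintro q rfl
    rfl
  exact key p hp

/-- A zero of the vector field at which its derivative is `v ↦ κ conj v` is a hyperbolic fixed
point of the flow. -/
theorem IsPushforwardOn.isHyperbolicFixedPoint [T2Space S] [IsManifold (𝓡 2) ∞ S]
    (h : IsPushforwardOn e U f X)
    (hX : IsLocalPushforward X) {ψ : ℝ → S → S} (h0 : ∀ p, ψ 0 p = p)
    (hadd : ∀ s t p, ψ (s + t) p = ψ s (ψ t p))
    (hψ : ∀ p, IsMIntegralCurve (I := 𝓡 2) (fun t => ψ t p) X)
    (hsm : ContMDiff (𝓘(ℝ, ℝ).prod (𝓡 2)) (𝓡 2) ∞ (fun x : ℝ × S => ψ x.1 x.2))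
    {z₀ : ℂ} (hz₀ : z₀ ∈ U) (hfix : ∀ t, ψ t (e z₀) = e z₀) {κ : ℝ} (hκ : κ ≠ 0)
    (hf : ∀ v, fderiv ℝ f z₀ v = κ • starRingEnd ℂ v) :
    IsHyperbolicFixedPoint (ψ 1) (e z₀) := by
  refine ⟨hfix 1, ?_⟩
  obtain ⟨ε, hε, φ, hφ, hev⟩ := h.exists_local_flow hX h0 hψ hz₀
  obtain ⟨P, hP⟩ := h.exists_equiv hz₀
  have hI : (0 : ℝ) ∈ Ioo (-ε) ε := ⟨by linarith, hε⟩
  have hφ0 : φ (0, z₀) = z₀ := hev.self_of_nhds.1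
  have hD : ∀ v, HasDerivAt (fun t => fderiv ℝ (fun x => φ (t, x)) z₀ v) (fderiv ℝ f z₀ v) 0 :=
    hasDerivAt_fderiv_flow hφ (by
      filter_upwards [hev] with z hz
      have := (hz.2 0 hI).2.1
      rwa [hz.1] at this)
  -- The point `φ (t, z₀)` lies over the fixed point and stays close to `z₀`, where `e` is
  -- injective.
  have hφfix : ∀ᶠ t in 𝓝 (0 : ℝ), φ (t, z₀) = z₀ := by
    have he := h.localDiffeo z₀ hz₀
    have hc : ContinuousAt (fun t => φ (t, z₀)) 0 :=
      (hev.self_of_nhds.2 0 hI).2.1.continuousAt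
    have h1 : ∀ᶠ t in 𝓝 (0 : ℝ), φ (t, z₀) ∈ he.localInverse.target := by
      refine hc.eventually ?_
      simp only [hφ0]
      exact he.localInverse.open_target.mem_nhds he.localInverse_mem_target
    filter_upwards [h1, Ioo_mem_nhds hI.1 hI.2] with t ht htε
    have h2 := (hev.self_of_nhds.2 t htε).2.2
    rw [hfix] at h2
    rw [← he.localInverse_left_inv ht, ← h2,
      he.localInverse_left_inv he.localInverse_mem_target]
  have hbase : ∀ v, HasDerivAt (fun t => diffMap (ψ t) (e z₀) (P v))
      (P (κ • starRingEnd ℂ v)) 0 := by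
    intro v
    have h1 := P.toContinuousLinearMap.hasFDerivAt.comp_hasDerivAt (0 : ℝ) (hD v)
    rw [hf v] at h1
    refine h1.congr_of_eventuallyEq ?_
    filter_upwards [h.mfderiv_flow hsm hz₀ hε hφ
      (by filter_upwards [hev] with z hz t ht using ⟨(hz.2 t ht).1, (hz.2 t ht).2.2⟩),
      hφfix] with t ht ht2
    rw [hP, ht v, ht2, ← hP]
    rfl
  -- As `e z₀` is fixed, the group law carries the derivative at time zero to all times: on an
  -- eigenvector of `v ↦ κ conj v` the linearized flow solves `a' = c a`. The eigenvectors used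
  -- below are `1` and `I`, with eigenvalues `κ` and `-κ`.
  have heig : ∀ (v : ℂ) (c : ℝ), κ • starRingEnd ℂ v = c • v →
      diffMap (ψ 1) (e z₀) (P v) = Real.exp c • P v := by
    intro v c hc
    have hd : ∀ t, HasDerivAt (fun t => diffMap (ψ t) (e z₀) (P v))
        (c • diffMap (ψ t) (e z₀) (P v)) t := by
      intro t
      have h1 := (diffMap (ψ t) (e z₀)).hasFDerivAt.comp_hasDerivAt (0 : ℝ) (hbase v)
      rw [hc, map_smul, map_smul] at h1
      have h2 : (diffMap (ψ t) (e z₀)) ∘ (fun s => diffMap (ψ s) (e z₀) (P v)) =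
          fun s => diffMap (ψ (s + t)) (e z₀) (P v) := by
        funext s
        rw [add_comm s t, diffMap_flow_add hsm hadd, hfix]
        rfl
      rw [h2] at h1
      have h3 := HasDerivAt.comp_sub_const t t (f := fun s => diffMap (ψ (s + t)) (e z₀) (P v))
        (f' := c • diffMap (ψ t) (e z₀) (P v)) (by simpa using h1)
      simpa using h3
    have := exp_growth hd 1
    rwa [mul_one, diffMap_flow_zero h0] at this
  have hA : derivAtFixed (ψ 1) (e z₀) (hfix 1) = diffMap (ψ 1) (e z₀) :=
    ContinuousLinearMap.ext fun v => derivAtFixed_eq (hfix 1) v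
  have hH : IsHyperbolicMap (diffMap (ψ 1) (e z₀)) := by
    refine isHyperbolicMap_of_eigenvectors _ P hκ (heig 1 κ (by simp)) (heig Complex.I (-κ) ?_)
    rw [Complex.conj_I, smul_neg, neg_smul]
  exact hA ▸ hH

theorem fixed_iff_field_eq_zero [T2Space S] [IsManifold (𝓡 2) ∞ S]
    (hX : IsLocalPushforward X) {ψ : ℝ → S → S} (h0 : ∀ p, ψ 0 p = p)
    (hψ : ∀ p, IsMIntegralCurve (I := 𝓡 2) (fun t => ψ t p) X) (p : S) :
    (∀ t, ψ t p = p) ↔ X p = 0 := by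
  constructor
  · intro h
    have h1 := hψ p 0
    have h2 : (fun t => ψ t p) = fun _ => p := funext h
    have h3 : HasMFDerivAt 𝓘(ℝ, ℝ) (𝓡 2) (fun t => ψ t p) 0
        (0 : ℝ →L[ℝ] EuclideanSpace ℝ (Fin 2)) := by
      rw [h2]; exact hasMFDerivAt_const p 0
    have h4 := hasMFDerivAt_unique h1 h3
    have h5 := DFunLike.congr_fun h4 (1 : ℝ)
    have h6 : X (ψ 0 p) = 0 := by
      have h7 : (1 : ℝ) • X (ψ 0 p) = 0 := h5
      rwa [one_smul] at h7
    rwa [h0] at h6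
  · intro h t
    have := isMIntegralCurve_Ioo_eq_of_contMDiff_boundaryless (t₀ := 0)
      (hX.contMDiff.of_le (by simp)) (hψ p) (isMIntegralCurve_const h) (h0 p)
    exact congrFun this t

end LinearizedFlow

/-! ### The local model of the potential near a hole -/

section LocalModel

/-- A smooth function that is `0` up to `9/256` and `1` from `13/256` on. -/
def cutoff (q : ℝ) : ℝ := Real.smoothTransition (64 * q - 9 / 4)

theorem cutoff_of_le {q : ℝ} (h : q ≤ 9 / 256) : cutoff q = 0 :=
  Real.smoothTransition.zero_of_nonpos (by linarith)

theorem cutoff_of_ge {q : ℝ} (h : 13 / 256 ≤ q) : cutoff q = 1 :=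
  Real.smoothTransition.one_of_one_le (by linarith)

theorem contDiff_cutoff : ContDiff ℝ ∞ cutoff :=
  Real.smoothTransition.contDiff.comp (by fun_prop)

theorem monotone_cutoff : Monotone cutoff := fun _ _ h =>
  Real.smoothTransition.monotone (by linarith)

/-- The rotation and dilation which interpolates between the identity and the multiplication by
`exp L`. -/
def twist (L ζ : ℂ) : ℂ := Complex.exp (cutoff (Complex.normSq ζ) * L) * ζ

/-- The weight of the antiholomorphic part of the model. -/
def damping (q : ℝ) : ℝ := (1 - cutoff q) / (64 * q)

/-- The model of the potential: the Joukowski map `ε (ζ + 1 / (64 ζ))` for `|ζ|` close to `1/8`, the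
linear map `ε exp L ζ` for larger `|ζ|`. -/
def model (ε : ℝ) (L ζ : ℂ) : ℂ :=
  ε * (twist L ζ + damping (Complex.normSq ζ) * starRingEnd ℂ (twist L ζ))

/-- Since `conj ζ / (64 |ζ|²) = 1 / (64 ζ)`, the antiholomorphic term becomes holomorphic where the
cutoff vanishes. -/
theorem model_inner (ε : ℝ) (L : ℂ) {ζ : ℂ} (h : Complex.normSq ζ ≤ 9 / 256) :
    model ε L ζ = ε * (ζ + 1 / (64 * ζ)) := by
  rcases eq_or_ne ζ 0 with rfl | h0
  · simp [model, twist]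
  have hq : (Complex.normSq ζ : ℂ) ≠ 0 := by exact_mod_cast (Complex.normSq_pos.2 h0).ne'
  have hc : starRingEnd ℂ ζ ≠ 0 := (map_ne_zero _).2 h0
  rw [model, twist, damping, cutoff_of_le h]
  simp only [Complex.ofReal_zero, zero_mul, Complex.exp_zero, one_mul, sub_zero]
  push_cast
  rw [← Complex.mul_conj]
  field_simp

theorem model_outer (ε : ℝ) (L : ℂ) {ζ : ℂ} (h : 13 / 256 ≤ Complex.normSq ζ) :
    model ε L ζ = ε * Complex.exp L * ζ := by
  rw [model, twist, damping, cutoff_of_ge h]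
  simp
  ring

theorem contDiffAt_model (ε : ℝ) (L : ℂ) {ζ : ℂ} (h : ζ ≠ 0) : ContDiffAt ℝ ∞ (model ε L) ζ := by
  have hn : ContDiff ℝ ∞ Complex.normSq := by
    have : (Complex.normSq : ℂ → ℝ) = fun z => z.re * z.re + z.im * z.im := by
      funext z; exact Complex.normSq_apply z
    rw [this]
    exact (Complex.reCLM.contDiff.mul Complex.reCLM.contDiff).add
      (Complex.imCLM.contDiff.mul Complex.imCLM.contDiff)
  have hc : ContDiff ℝ ∞ fun z => cutoff (Complex.normSq z) := contDiff_cutoff.comp hn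
  have ht : ContDiff ℝ ∞ (twist L) := by
    have h1 : ContDiff ℝ ∞ fun z => ((cutoff (Complex.normSq z) : ℝ) : ℂ) :=
      Complex.ofRealCLM.contDiff.comp hc
    exact (Complex.contDiff_exp.comp (h1.mul contDiff_const)).mul contDiff_id
  have hq : 64 * Complex.normSq ζ ≠ 0 := by
    have := Complex.normSq_pos.2 h; positivity
  have hd : ContDiffAt ℝ ∞ (fun z => damping (Complex.normSq z)) ζ :=
    (contDiffAt_const.sub hc.contDiffAt).div (contDiffAt_const.mul hn.contDiffAt) hq
  have hd' : ContDiffAt ℝ ∞ (fun z => ((damping (Complex.normSq z) : ℝ) : ℂ)) ζ :=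
    Complex.ofRealCLM.contDiff.contDiffAt.comp ζ hd
  have hconj : ContDiffAt ℝ ∞ (fun z => starRingEnd ℂ (twist L z)) ζ :=
    Complex.conjCLE.toContinuousLinearMap.contDiff.contDiffAt.comp ζ ht.contDiffAt
  exact contDiffAt_const.mul (ht.contDiffAt.add (hd'.mul hconj))

theorem hasDerivAt_model_inner (ε : ℝ) (L : ℂ) {ζ : ℂ} (h0 : ζ ≠ 0)
    (h : Complex.normSq ζ < 9 / 256) :
    HasDerivAt (model ε L) (ε * (1 - 1 / (64 * ζ ^ 2))) ζ := by
  have h1 : HasDerivAt (fun z : ℂ => (ε : ℂ) * (z + 1 / (64 * z))) (ε * (1 - 1 / (64 * ζ ^ 2))) ζ := by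
    have h2 : HasDerivAt (fun z : ℂ => 1 / (64 * z)) (-(64) / (64 * ζ) ^ 2) ζ := by
      have h3 : HasDerivAt (fun z : ℂ => 64 * z) 64 ζ := by
        simpa using (hasDerivAt_id ζ).const_mul (64 : ℂ)
      exact (h3.inv (by simpa using h0)).congr_of_eventuallyEq
        (Eventually.of_forall fun z => one_div _)
    refine (((hasDerivAt_id ζ).add h2).const_mul (ε : ℂ)).congr_deriv ?_
    field_simp
    ring
  refine h1.congr_of_eventuallyEq ?_
  have hc : ContinuousAt Complex.normSq ζ := Complex.continuous_normSq.continuousAt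
  filter_upwards [hc.eventually_lt continuousAt_const h] with z hz
  exact model_inner ε L hz.le

/-- Multiplying `h1` by `(1 - B) p₁` and `h2` by `(1 + B) p₂` and adding eliminates `y'`. What
remains is `x` times a positive number: `B < 1`, and the gain `m` from the dilation outweighs the
loss `c / 32` from the decay of the damping. -/
theorem real_system_trivial {x y' p₁ p₂ B c m : ℝ} (hB0 : 0 ≤ B) (hB : B ≤ 4 / 9) (hc : 0 ≤ c)
    (hm : c / 32 ≤ m) (hp : p₁ ≠ 0 ∨ p₂ ≠ 0)
    (h1 : (1 + B) * (x * (1 + m) * p₁ - y' * p₂) - x * (c / 32 + 2 * B) * p₁ = 0)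
    (h2 : (1 - B) * (x * (1 + m) * p₂ + y' * p₁) + x * (c / 32 + 2 * B) * p₂ = 0) :
    x = 0 ∧ y' = 0 := by
  set K := (1 + B) * (1 + m) - 2 * B - c / 32 with hK
  set A := (1 - B) * (1 + m) + 2 * B + c / 32 with hA
  have hKpos : 0 < K := by nlinarith
  have hApos : 0 < A := by nlinarith
  have hpp : 0 < p₁ ^ 2 + p₂ ^ 2 := by
    rcases hp with hp | hp
    · have := sq_pos_of_ne_zero hp; positivity
    · have := sq_pos_of_ne_zero hp; positivity
  have h3 : x * (K * (1 - B) * p₁ ^ 2 + A * (1 + B) * p₂ ^ 2) = 0 := by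
    rw [hK, hA]; linear_combination (1 - B) * p₁ * h1 + (1 + B) * p₂ * h2
  have h4 : 0 < K * (1 - B) * p₁ ^ 2 + A * (1 + B) * p₂ ^ 2 := by
    have h5 : 0 < K * (1 - B) := mul_pos hKpos (by linarith)
    have h6 : 0 < A * (1 + B) := mul_pos hApos (by linarith)
    rcases hp with hp | hp
    · have := sq_pos_of_ne_zero hp; positivity
    · have := sq_pos_of_ne_zero hp; positivity
  have hx : x = 0 := (mul_eq_zero.1 h3).resolve_right h4.ne'
  refine ⟨hx, ?_⟩
  rw [hx] at h1 h2
  have h7 : y' * p₂ = 0 := by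
    have : (1 + B) * (y' * p₂) = 0 := by linarith
    exact (mul_eq_zero.1 this).resolve_left (by linarith)
  have h8 : y' * p₁ = 0 := by
    have : (1 - B) * (y' * p₁) = 0 := by linarith
    exact (mul_eq_zero.1 this).resolve_left (by linarith)
  rcases hp with hp | hp
  · exact (mul_eq_zero.1 h8).resolve_right hp
  · exact (mul_eq_zero.1 h7).resolve_right hp

/-- Write `v = s ζ`. The twisted point `η` moves by `τ η`, where the dilation contributes `2 q c Re
L` to `Re τ / Re s`, and the decay of the damping adds a term of relative size `c / 32`. As `q ≥
9/256` and `Re L ≥ 1`, the dilation wins; this is the reason for inserting `exp L` in the region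
where the antiholomorphic term is switched off. -/
theorem fderiv_model_injective {ε : ℝ} (hε : ε ≠ 0) {L : ℂ} (hL : 1 ≤ L.re) {ζ : ℂ}
    (hq : 9 / 256 ≤ Complex.normSq ζ) {v : ℂ} (hv : fderiv ℝ (model ε L) ζ v = 0) : v = 0 := by
  have h0 : ζ ≠ 0 := by
    rintro rfl; norm_num at hq
  set q := Complex.normSq ζ with hqd
  have hqpos : 0 < q := by linarith
  obtain ⟨s, hs⟩ : ∃ s, v = s * ζ := ⟨v / ζ, by field_simp⟩
  set c := deriv cutoff q with hcd
  have hc0 : 0 ≤ c := monotone_cutoff.deriv_nonneg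
  have hcut : HasDerivAt cutoff c q :=
    (contDiff_cutoff.differentiable (by simp) q).hasDerivAt
  set B := damping q with hBd
  have hchi1 : cutoff q ≤ 1 := Real.smoothTransition.le_one _
  have hchi0 : 0 ≤ cutoff q := Real.smoothTransition.nonneg _
  have hB0 : 0 ≤ B := div_nonneg (by linarith) (by linarith)
  -- `4 / 9` is the value of `1 / (64 q)` at `q = 9 / 256`.
  have hB : B ≤ 4 / 9 := by
    rw [hBd, damping, div_le_iff₀ (by linarith)]; linarith
  -- derivatives along the line through `ζ` in direction `v`
  have hz : HasDerivAt (fun t : ℝ => ζ + t * v) v 0 := by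
    have : HasDerivAt (fun t : ℝ => (t : ℂ)) 1 0 := Complex.ofRealCLM.hasDerivAt
    simpa using (this.mul_const v).const_add ζ
  have e0 : ζ + ((0 : ℝ) : ℂ) * v = ζ := by simp
  have hN : HasDerivAt (fun t : ℝ => Complex.normSq (ζ + t * v)) (2 * q * s.re) 0 := by
    have h1 : (fun t : ℝ => Complex.normSq (ζ + t * v)) =
        fun t : ℝ => q * ((1 + t * s.re) ^ 2 + (t * s.im) ^ 2) := by
      funext t
      rw [hs, show ζ + t * (s * ζ) = ζ * (1 + t * s) by ring, Complex.normSq_mul,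
        Complex.normSq_apply (1 + t * s)]
      rw [← hqd]
      simp
      left; ring
    rw [h1]
    have h2 : HasDerivAt (fun t : ℝ => 1 + t * s.re) s.re 0 := by
      simpa using ((hasDerivAt_id (0 : ℝ)).mul_const s.re).const_add 1
    have h3 : HasDerivAt (fun t : ℝ => t * s.im) s.im 0 := by
      simpa using (hasDerivAt_id (0 : ℝ)).mul_const s.im
    refine (((h2.pow 2).add (h3.pow 2)).const_mul q).congr_deriv ?_
    simp
    ring
  have hcutN : HasDerivAt (fun t : ℝ => cutoff (Complex.normSq (ζ + t * v)))
      (c * (2 * q * s.re)) 0 :=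
    HasDerivAt.comp (0 : ℝ) (h₂ := cutoff) (by rw [e0]; exact hcut) hN
  have hdamp : HasDerivAt (fun t : ℝ => damping (Complex.normSq (ζ + t * v)))
      (-s.re * (c / 32 + 2 * B)) 0 := by
    have h1 : HasDerivAt (fun t : ℝ => 1 - cutoff (Complex.normSq (ζ + t * v)))
        (-(c * (2 * q * s.re))) 0 := hcutN.const_sub 1
    have h2 := hN.const_mul (64 : ℝ)
    have h3 := h1.div h2 (by rw [e0]; positivity)
    rw [e0, ← hqd] at h3
    refine h3.congr_deriv ?_
    rw [hBd, damping]
    field_simp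
    ring
  set η := twist L ζ with hη
  have hη0 : η ≠ 0 := mul_ne_zero (Complex.exp_ne_zero _) h0
  set τ : ℂ := s + (c * (2 * q * s.re) : ℝ) * L with hτ
  have htw : HasDerivAt (fun t : ℝ => twist L (ζ + t * v)) (τ * η) 0 := by
    have h1 : HasDerivAt (fun t : ℝ => ((cutoff (Complex.normSq (ζ + t * v)) : ℝ) : ℂ))
        ((c * (2 * q * s.re) : ℝ) : ℂ) 0 := hcutN.ofReal_comp
    have h2 := ((h1.mul_const L).cexp).mul hz
    rw [e0, ← hqd] at h2
    refine h2.congr_deriv ?_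
    rw [hτ, hη, twist, hs, ← hqd]
    ring
  have hconj : HasDerivAt (fun t : ℝ => starRingEnd ℂ (twist L (ζ + t * v)))
      (starRingEnd ℂ (τ * η)) 0 :=
    Complex.conjCLE.toContinuousLinearMap.hasFDerivAt.comp_hasDerivAt (0 : ℝ) htw
  have hmod : HasDerivAt (fun t : ℝ => model ε L (ζ + t * v))
      (ε * (τ * η + (((-s.re * (c / 32 + 2 * B) : ℝ) : ℂ) * starRingEnd ℂ η +
        B * starRingEnd ℂ (τ * η)))) 0 := by
    have h2 := (htw.add (hdamp.ofReal_comp.mul hconj)).const_mul (ε : ℂ)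
    rw [e0, ← hqd, ← hBd, ← hη] at h2
    exact h2
  have hfd : HasDerivAt (fun t : ℝ => model ε L (ζ + t * v)) (fderiv ℝ (model ε L) ζ v) 0 := by
    refine HasFDerivAt.comp_hasDerivAt (0 : ℝ) (l := model ε L) ?_ hz
    rw [e0]
    exact ((contDiffAt_model ε L h0).differentiableAt (by simp)).hasFDerivAt
  have hzero := hmod.unique hfd
  rw [hv, mul_eq_zero, or_iff_right (by exact_mod_cast hε)] at hzero
  have hre := congrArg Complex.re hzero
  have him := congrArg Complex.im hzero
  have hτre : τ.re = s.re * (1 + 2 * q * c * L.re) := by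
    simp [hτ]; ring
  simp only [Complex.add_re, Complex.mul_re, Complex.add_im, Complex.mul_im, Complex.conj_re,
    Complex.conj_im, Complex.ofReal_re, Complex.ofReal_im, Complex.zero_re, Complex.zero_im,
    hτre] at hre him
  have hp : η.re ≠ 0 ∨ η.im ≠ 0 := by
    by_contra! h
    exact hη0 (Complex.ext h.1 h.2)
  have hm : c / 32 ≤ 2 * q * c * L.re := by
    have h1 : 9 / 256 * c ≤ q * c := mul_le_mul_of_nonneg_right hq hc0
    have h2 : q * c ≤ q * c * L.re := le_mul_of_one_le_right (mul_nonneg hqpos.le hc0) hL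
    linarith
  obtain ⟨hx, hy⟩ := real_system_trivial (x := s.re) (y' := τ.im) (p₁ := η.re) (p₂ := η.im)
    (m := 2 * q * c * L.re) hB0 hB hc0 hm hp
    (by linear_combination hre) (by linear_combination him)
  have hsim : s.im = 0 := by
    have : τ.im = s.im := by simp [hτ, hx]
    rw [← this]; exact hy
  have hs0 : s = 0 := Complex.ext hx hsim
  rw [hs, hs0, zero_mul]

end LocalModel

/-! ### The potentials on the holed planes -/

section Potential

/-- The points at distance more than `1/12` from the centres of the holes. -/
def farSet (g : ℕ) (i : Fin g) : Set ℂ := {z | ∀ c, IsHoleCentre g i c → 1 / 12 < ‖z - c‖}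

/-- The points at distance at least `1/8` from the centres of the holes. -/
def coreSet (g : ℕ) (i : Fin g) : Set ℂ := {z | ∀ c, IsHoleCentre g i c → 1 / 8 ≤ ‖z - c‖}

theorem farSet_subset (g : ℕ) (i : Fin g) : farSet g i ⊆ holedPlane g i :=
  fun _ hz c hc => lt_trans (by norm_num) (hz c hc)

theorem coreSet_subset (g : ℕ) (i : Fin g) : coreSet g i ⊆ farSet g i :=
  fun _ hz c hc => lt_of_lt_of_le (by norm_num) (hz c hc)

/-- A point close to a hole is far away from the other ones. -/
theorem quarter_lt_of_near {g : ℕ} {i : Fin g} {z c e : ℂ} (hc : IsHoleCentre g i c)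
    (hzc : ‖z - c‖ < 1 / 4) (he : IsHoleCentre g i e) (hne : c ≠ e) : 1 / 4 < ‖z - e‖ := by
  have h1 : 1 / 2 ≤ ‖c - e‖ := by
    by_contra! h; exact hne (holes_apart hc he h)
  have h2 : c - e = (z - e) - (z - c) := by ring
  rw [h2] at h1
  linarith [norm_sub_le (z - e) (z - c)]

theorem centre_unique {g : ℕ} {i : Fin g} {z c e : ℂ} (hc : IsHoleCentre g i c)
    (hzc : ‖z - c‖ < 1 / 4) (he : IsHoleCentre g i e) (hze : ‖z - e‖ ≤ 1 / 4) : c = e := by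
  by_contra hne
  linarith [quarter_lt_of_near hc hzc he hne]

theorem eventually_norm_sub_lt (z : ℂ) {r : ℝ} (hr : 0 < r) : ∀ᶠ z' in 𝓝 z, ‖z' - z‖ < r := by
  filter_upwards [Metric.ball_mem_nhds z hr] with z' hz'
  rwa [Metric.mem_ball, dist_eq_norm] at hz'

/-- Centres are at least `1/2` apart, so close to a given point at most one of the infinitely many
conditions is critical and the others hold with a uniform margin. -/
theorem isOpen_farOf (g : ℕ) (i : Fin g) {r : ℝ} (hr : r ≤ 1 / 8) :
    IsOpen {z | ∀ c, IsHoleCentre g i c → r < ‖z - c‖} := by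
  rw [isOpen_iff_mem_nhds]
  intro z hz
  have key : ∀ z' d : ℂ, ‖z - d‖ ≤ ‖z' - d‖ + ‖z' - z‖ := fun z' d => by
    have : z - d = (z' - d) - (z' - z) := by ring
    rw [this]; exact norm_sub_le _ _
  by_cases h : ∃ c, IsHoleCentre g i c ∧ ‖z - c‖ < 1 / 4
  · obtain ⟨c, hc, hzc⟩ := h
    have h1 := hz c hc
    filter_upwards [eventually_norm_sub_lt z (sub_pos.2 h1),
      eventually_norm_sub_lt z (show (0 : ℝ) < 1 / 8 by norm_num)] with z' h2 h3 d hd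
    by_cases hdc : c = d
    · subst hdc; linarith [key z' c]
    · linarith [key z' d, quarter_lt_of_near hc hzc hd hdc]
  · push Not at h
    filter_upwards [eventually_norm_sub_lt z (show (0 : ℝ) < 1 / 8 by norm_num)] with z' h3 d hd
    linarith [key z' d, h d hd]

theorem isOpen_farSet (g : ℕ) (i : Fin g) : IsOpen (farSet g i) :=
  isOpen_farOf g i (by norm_num)

theorem add_mem_coreSet {g : ℕ} {i : Fin g} {z l : ℂ} (hz : z ∈ coreSet g i)
    (hl : IsLattice l) : z + l ∈ coreSet g i := by
  intro c hc
  have := hz _ (hc.add hl.neg)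
  rwa [show z - (c + -l) = z + l - c by ring] at this

theorem isClosed_coreSet (g : ℕ) (i : Fin g) : IsClosed (coreSet g i) := by
  simp only [coreSet, Set.ofPred_forall]
  exact isClosed_iInter fun c => isClosed_iInter fun _ =>
    isClosed_le continuous_const (by fun_prop)

theorem isHoleCentre_right {g : ℕ} {i : Fin g} (hi : (i : ℕ) + 1 < g) {l : ℂ}
    (hl : IsLattice l) : IsHoleCentre g i (rightCentre + l) := Or.inr ⟨hi, by simpa using hl⟩

theorem isHoleCentre_left {g : ℕ} {i : Fin g} (hi : 0 < (i : ℕ)) {l : ℂ}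
    (hl : IsLattice l) : IsHoleCentre g i (leftCentre + l) := Or.inl ⟨hi, by simpa using hl⟩

/-- A point at distance `1/8` from a centre lies in the core. -/
theorem mem_coreSet_of_norm_eq {g : ℕ} {i : Fin g} {z c : ℂ} (hc : IsHoleCentre g i c)
    (hzc : ‖z - c‖ = 1 / 8) : z ∈ coreSet g i := by
  intro e he
  by_cases hce : c = e
  · rw [← hce, hzc]
  · linarith [quarter_lt_of_near hc (by rw [hzc]; norm_num) he hce]

/-- The parameters of the construction: the slopes `μ i` of the potentials far from the holes, a
common slope `ε` close to the holes, and logarithms `L i` of the quotients. -/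
structure Slopes (g : ℕ) where
  ε : ℝ
  μ : Fin g → ℂ
  L : Fin g → ℂ
  pos : 0 < ε
  exp_eq : ∀ i, ε * Complex.exp (L i) = μ i
  one_le_re : ∀ i, 1 ≤ (L i).re

/-- Take `ε` with `3 ε < |μ i|` for all `i`. As `exp 1 < 3`, the logarithm of `μ i / ε` has real
part at least `1`. -/
theorem Slopes.exists_of_ne_zero {g : ℕ} (μ : Fin g → ℂ) (hμ : ∀ i, μ i ≠ 0) :
    ∃ a : Slopes g, a.μ = μ := by
  have h : ∀ᶠ ε in 𝓝[>] (0 : ℝ), 0 < ε ∧ ∀ i, 3 * ε < ‖μ i‖ := by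
    refine (eventually_mem_nhdsWithin).and (eventually_all.2 fun i => ?_)
    refine eventually_nhdsWithin_of_eventually_nhds ?_
    have hc : ContinuousAt (fun ε : ℝ => 3 * ε) 0 := by fun_prop
    exact hc.eventually_lt continuousAt_const (by simpa using hμ i)
  obtain ⟨ε, hε, h⟩ := h.exists
  have hε' : (ε : ℂ) ≠ 0 := by exact_mod_cast hε.ne'
  refine ⟨⟨ε, μ, fun i => Complex.log (μ i / ε), hε, fun i => ?_, fun i => ?_⟩, rfl⟩
  · rw [Complex.exp_log (div_ne_zero (hμ i) hε')]
    field_simp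
  · rw [Complex.log_re, norm_div, Complex.norm_real, Real.norm_of_nonneg hε.le,
      Real.le_log_iff_exp_le (div_pos (norm_pos_iff.2 (hμ i)) hε), le_div_iff₀ hε]
    have := Real.exp_one_lt_d9
    nlinarith [h i]

variable {g : ℕ} (a : Slopes g) (i : Fin g)

open Classical in
/-- The multivalued potential on the surface, lifted to the `i`-th holed plane. -/
def potential (z : ℂ) : ℂ :=
  if h : ∃ c, IsHoleCentre g i c ∧ ‖z - c‖ < 1 / 4 then
    a.μ i * h.choose + model a.ε (a.L i) (z - h.choose) else a.μ i * z

variable {i}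

/-- The choice in the definition is harmless: discs of radius `1/4` about different centres are
disjoint. -/
theorem potential_near {z c : ℂ} (hc : IsHoleCentre g i c) (hzc : ‖z - c‖ < 1 / 4) :
    potential a i z = a.μ i * c + model a.ε (a.L i) (z - c) := by
  have h : ∃ c, IsHoleCentre g i c ∧ ‖z - c‖ < 1 / 4 := ⟨c, hc, hzc⟩
  have hcc : h.choose = c := centre_unique h.choose_spec.1 h.choose_spec.2 hc hzc.le
  rw [potential, dif_pos h, hcc]

/-- Beyond the cutoff region both branches of the definition agree, because `ε exp (L i) = μ i`;
hence the potential is smooth across the circles of radius `1/4`. -/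
theorem potential_eq_linear {z : ℂ}
    (h : ∀ c, IsHoleCentre g i c → 13 / 256 ≤ Complex.normSq (z - c)) :
    potential a i z = a.μ i * z := by
  by_cases hc : ∃ c, IsHoleCentre g i c ∧ ‖z - c‖ < 1 / 4
  · obtain ⟨c, hc, hzc⟩ := hc
    rw [potential_near a hc hzc, model_outer _ _ (h c hc), a.exp_eq]
    ring
  · rw [potential, dif_neg hc]

theorem potential_eventually_near {z c : ℂ} (hc : IsHoleCentre g i c) (hzc : ‖z - c‖ < 1 / 4) :
    potential a i =ᶠ[𝓝 z] fun z' => a.μ i * c + model a.ε (a.L i) (z' - c) := by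
  have hcont : ContinuousAt (fun z' : ℂ => ‖z' - c‖) z := by fun_prop
  filter_upwards [hcont.eventually_lt continuousAt_const hzc] with z' hz'
  exact potential_near a hc hz'

theorem potential_eventually_linear {z : ℂ} (h : ∀ c, IsHoleCentre g i c → 1 / 4 ≤ ‖z - c‖) :
    potential a i =ᶠ[𝓝 z] fun z' => a.μ i * z' := by
  filter_upwards [eventually_norm_sub_lt z (show (0 : ℝ) < 1 / 64 by norm_num)] with z' hz'
  -- The margin suffices: `(1/4 - 1/64)² = 225/4096`, and `13/256 = 208/4096`.
  refine potential_eq_linear a fun c hc => ?_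
  have h1 : ‖z - c‖ ≤ ‖z' - c‖ + ‖z' - z‖ := by
    have : z - c = (z' - c) - (z' - z) := by ring
    rw [this]; exact norm_sub_le _ _
  have h2 := h c hc
  rw [Complex.normSq_eq_norm_sq]
  nlinarith

theorem potential_cases (z : ℂ) :
    (∃ c, IsHoleCentre g i c ∧ ‖z - c‖ < 1 / 4 ∧
      potential a i =ᶠ[𝓝 z] fun z' => a.μ i * c + model a.ε (a.L i) (z' - c)) ∨
    (potential a i =ᶠ[𝓝 z] fun z' => a.μ i * z') := by
  by_cases hc : ∃ c, IsHoleCentre g i c ∧ ‖z - c‖ < 1 / 4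
  · obtain ⟨c, hc, hzc⟩ := hc
    exact Or.inl ⟨c, hc, hzc, potential_eventually_near a hc hzc⟩
  · push Not at hc
    exact Or.inr (potential_eventually_linear a hc)

theorem sub_ne_zero_of_mem_farSet {z c : ℂ} (hz : z ∈ farSet g i) (hc : IsHoleCentre g i c) :
    z - c ≠ 0 := by
  intro h
  have := hz c hc
  rw [h, norm_zero] at this
  linarith

theorem contDiffAt_potential {z : ℂ} (hz : z ∈ farSet g i) :
    ContDiffAt ℝ ∞ (potential a i) z := by
  rcases potential_cases a z with ⟨c, hc, -, h⟩ | h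
  · refine ContDiffAt.congr_of_eventuallyEq ?_ h
    refine contDiffAt_const.add ?_
    have h1 := contDiffAt_model a.ε (a.L i) (sub_ne_zero_of_mem_farSet hz hc)
    exact ContDiffAt.comp (g := model a.ε (a.L i)) (f := fun z' : ℂ => z' - c) z h1 (by fun_prop)
  · exact ContDiffAt.congr_of_eventuallyEq (by fun_prop) h

/-- The centres move along with the point, so the periods are those of `μ i z`. This is the relation
that periodic orbits will violate. -/
theorem potential_add_lattice {z l : ℂ} (hl : IsLattice l) :
    potential a i (z + l) = potential a i z + a.μ i * l := by
  by_cases hc : ∃ c, IsHoleCentre g i c ∧ ‖z - c‖ < 1 / 4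
  · obtain ⟨c, hc, hzc⟩ := hc
    have h1 : z + l - (c + l) = z - c := by ring
    rw [potential_near a hc hzc, potential_near a (hc.add hl) (by rwa [h1]), h1]
    ring
  · have hc' : ¬ ∃ c, IsHoleCentre g i c ∧ ‖z + l - c‖ < 1 / 4 := by
      rintro ⟨c, hc1, hc2⟩
      exact hc ⟨c + -l, hc1.add hl.neg, by rwa [show z - (c + -l) = z + l - c by ring]⟩
    rw [potential, potential, dif_neg hc, dif_neg hc']
    ring

/-- Close to a hole, the potential is holomorphic. -/
theorem hasDerivAt_potential {z c : ℂ} (hc : IsHoleCentre g i c) (h0 : z - c ≠ 0)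
    (hzc : Complex.normSq (z - c) < 9 / 256) :
    HasDerivAt (potential a i) (a.ε * (1 - 1 / (64 * (z - c) ^ 2))) z := by
  have hn : ‖z - c‖ < 1 / 4 := by
    rw [Complex.normSq_eq_norm_sq] at hzc
    nlinarith [norm_nonneg (z - c)]
  have h1 := hasDerivAt_model_inner a.ε (a.L i) h0 hzc
  refine HasDerivAt.congr_of_eventuallyEq ?_ (potential_eventually_near a hc hn)
  exact (h1.comp_sub_const z c).const_add _

/-- The differential of the potential is injective away from the saddle points. -/
theorem fderiv_potential_eq_zero {z : ℂ} (hz : z ∈ farSet g i) {v : ℂ}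
    (hv : fderiv ℝ (potential a i) z v = 0) :
    v = 0 ∨ ∃ c, IsHoleCentre g i c ∧ (z = c + 1 / 8 ∨ z = c - 1 / 8) := by
  rcases potential_cases a z with ⟨c, hc, hzc, h⟩ | h
  · have h0 := sub_ne_zero_of_mem_farSet hz hc
    -- Outside radius `3/16` the model is immersive; inside, the potential is holomorphic with
    -- derivative `ε (1 - 1 / (64 ζ²))`, which vanishes only at `ζ = ±1/8`.
    by_cases hq : 9 / 256 ≤ Complex.normSq (z - c)
    · left
      refine fderiv_model_injective a.pos.ne' (a.one_le_re i) hq ?_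
      rw [h.fderiv_eq, fderiv_const_add, fderiv_comp_sub] at hv
      exact hv
    · rw [((hasDerivAt_potential a hc h0 (not_le.1 hq)).hasFDerivAt.restrictScalars ℝ).fderiv]
        at hv
      have hv' : v * (a.ε * (1 - 1 / (64 * (z - c) ^ 2))) = 0 := by simpa using hv
      rcases mul_eq_zero.1 hv' with hv' | hv'
      · exact Or.inl hv'
      · right
        have hε : (a.ε : ℂ) ≠ 0 := by exact_mod_cast a.pos.ne'
        have h1 := (mul_eq_zero.1 hv').resolve_left hε
        field_simp at h1
        have h2 : (z - c - 1 / 8) * (z - c + 1 / 8) = 0 := by linear_combination h1 / 64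
        refine ⟨c, hc, (mul_eq_zero.1 h2).imp (fun h => ?_) fun h => ?_⟩
        · linear_combination h
        · linear_combination h
  · left
    rw [h.fderiv_eq] at hv
    have h1 : HasDerivAt (fun z' : ℂ => a.μ i * z') (a.μ i) z := by
      simpa using (hasDerivAt_id z).const_mul (a.μ i)
    rw [(h1.hasFDerivAt.restrictScalars ℝ).fderiv] at hv
    have hv' : v * a.μ i = 0 := by simpa using hv
    refine (mul_eq_zero.1 hv').resolve_right ?_
    rw [← a.exp_eq]
    exact mul_ne_zero (by exact_mod_cast a.pos.ne') (Complex.exp_ne_zero _)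

variable (i) in
/-- The Hamiltonian in the `i`-th holed plane. -/
def hamiltonian (z : ℂ) : ℝ := (potential a i z).im

theorem contDiffAt_hamiltonian {z : ℂ} (hz : z ∈ farSet g i) :
    ContDiffAt ℝ ∞ (hamiltonian a i) z :=
  Complex.imCLM.contDiff.contDiffAt.comp z (contDiffAt_potential a hz)

theorem fderiv_hamiltonian {z : ℂ} (hz : z ∈ farSet g i) (v : ℂ) :
    fderiv ℝ (hamiltonian a i) z v = (fderiv ℝ (potential a i) z v).im := by
  have h := ((contDiffAt_potential a hz).differentiableAt (by simp)).hasFDerivAt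
  have h1 : HasFDerivAt (hamiltonian a i) (Complex.imCLM.comp (fderiv ℝ (potential a i) z)) z :=
    Complex.imCLM.hasFDerivAt.comp z h
  rw [h1.fderiv]; rfl

/-- The critical points of the Hamiltonian are the saddle points. -/
theorem fderiv_hamiltonian_eq_zero_iff {z : ℂ} (hz : z ∈ farSet g i) :
    fderiv ℝ (hamiltonian a i) z = 0 ↔
      ∃ c, IsHoleCentre g i c ∧ (z = c + 1 / 8 ∨ z = c - 1 / 8) := by
  constructor
  · intro h
    by_contra hne
    have hinj : ∀ v, fderiv ℝ (potential a i) z v = 0 → v = 0 := fun v hv =>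
      (fderiv_potential_eq_zero a hz hv).resolve_right hne
    set D := fderiv ℝ (potential a i) z
    have him : ∀ v, (D v).im = 0 := fun v => by
      rw [← fderiv_hamiltonian a hz, h]; rfl
    set x := (D 1).re with hx
    set y := (D Complex.I).re with hy
    -- If `dH = 0`, the differential of the potential takes real values on a plane, so it has a
    -- kernel.
    have h1 : D (y • (1 : ℂ) - x • Complex.I) = 0 := by
      rw [map_sub, map_smul, map_smul]
      refine Complex.ext ?_ ?_
      · simp [← hx, ← hy]; ring
      · simp [him]
    have h2 := hinj _ h1
    have hx0 : x = 0 := by simpa using congrArg Complex.im h2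
    have h3 : D 1 = 0 := Complex.ext (by rw [← hx, hx0]; rfl) (him 1)
    exact one_ne_zero (hinj 1 h3)
  · rintro ⟨c, hc, hz'⟩
    ext v
    have hsq : (z - c) ^ 2 = 1 / 64 := by
      rcases hz' with rfl | rfl <;> norm_num
    have hq : Complex.normSq (z - c) < 9 / 256 := by
      rcases hz' with rfl | rfl
      · rw [add_sub_cancel_left]; norm_num [Complex.normSq_apply]
      · rw [sub_sub_cancel_left]; norm_num [Complex.normSq_apply]
    have h1 := hasDerivAt_potential a hc (sub_ne_zero_of_mem_farSet hz hc) hq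
    rw [fderiv_hamiltonian a hz, (h1.hasFDerivAt.restrictScalars ℝ).fderiv, hsq]
    norm_num

end Potential

/-! ### The vector field on the surface -/

section Field

variable {S : Type*} [TopologicalSpace S] [ChartedSpace (EuclideanSpace ℝ (Fin 2)) S]

/-- The density of the pull-back of a 2-form to the plane. -/
def density (Ω : BilinForm S) (e : ℂ → S) (z : ℂ) : ℝ :=
  formAt Ω (e z) (diffParam e z 1) (diffParam e z Complex.I)

variable {Ω : BilinForm S}

/-- The planar vector field with Hamiltonian `H` for the pull-back of `Ω` under `e`. -/
def planarField (Ω : BilinForm S) (e : ℂ → S) (H : ℂ → ℝ) (z : ℂ) : ℂ :=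
  (density Ω e z)⁻¹ • (⟨fderiv ℝ H z Complex.I, -fderiv ℝ H z 1⟩ : ℂ)

theorem planarField_eq_zero_iff {e : ℂ → S} {H : ℂ → ℝ} {z : ℂ} (h : density Ω e z ≠ 0) :
    planarField Ω e H z = 0 ↔ fderiv ℝ H z = 0 := by
  rw [planarField, smul_eq_zero, or_iff_right (inv_ne_zero h)]
  constructor
  · intro h1
    have h2 : fderiv ℝ H z Complex.I = 0 := congrArg Complex.re h1
    have h3 : fderiv ℝ H z 1 = 0 := neg_eq_zero.1 (congrArg Complex.im h1)
    ext w
    have : w = w.re • (1 : ℂ) + w.im • Complex.I := by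
      refine Complex.ext ?_ ?_ <;> simp
    rw [this, map_add, map_smul, map_smul, h2, h3]
    simp
  · intro h1
    rw [h1]
    refine Complex.ext ?_ ?_ <;> simp

theorem density_mul_planarField {e : ℂ → S} {H : ℂ → ℝ} {z : ℂ} (h : density Ω e z ≠ 0) (w : ℂ) :
    density Ω e z * (starRingEnd ℂ (planarField Ω e H z) * w).im = fderiv ℝ H z w := by
  have hw : w = w.re • (1 : ℂ) + w.im • Complex.I := by
    refine Complex.ext ?_ ?_ <;> simp
  conv_rhs => rw [hw, map_add, map_smul, map_smul]
  simp only [planarField, Complex.mul_im, Complex.conj_re, Complex.conj_im, Complex.smul_re,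
    Complex.smul_im, smul_eq_mul]
  field_simp
  ring

variable [IsManifold (𝓡 2) ∞ S]

/-- The density is `Ω` evaluated on the images of the constant fields `1` and `I` under the tangent
map of `e`, which are smooth sections along `e`. -/
theorem contDiffOn_density (hΩ : IsSymplecticForm Ω) {e : ℂ → S} {U : Set ℂ} (hU : IsOpen U)
    (he : ∀ z ∈ U, IsLocalDiffeomorphAt 𝓘(ℝ, ℂ) (𝓡 2) ∞ e z) :
    ContDiffOn ℝ ∞ (density Ω e) U := by
  intro z hz
  refine ContDiffAt.contDiffWithinAt ?_
  have h1 : ContMDiffOn 𝓘(ℝ, ℂ) (𝓡 2) ∞ e U := fun w hw =>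
    (he w hw).contMDiffAt.contMDiffWithinAt
  have h2 := h1.contMDiffOn_tangentMapWithin (m := ∞) (by simp) hU.uniqueMDiffOn
  have hv : ∀ v : ℂ, ContMDiffAt 𝓘(ℝ, ℂ) (𝓡 2).tangent ∞ (fun w =>
      Bundle.TotalSpace.mk' (EuclideanSpace ℝ (Fin 2)) (E := fun p : S => TangentSpace (𝓡 2) p)
        (e w) (mfderiv 𝓘(ℝ, ℂ) (𝓡 2) e w v)) z := by
    intro v
    have h3 : ContMDiffAt 𝓘(ℝ, ℂ) 𝓘(ℝ, ℂ).tangent ∞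
        (fun w => (⟨w, v⟩ : TangentBundle 𝓘(ℝ, ℂ) ℂ)) z :=
      contMDiffAt_vectorSpace_iff_contDiffAt.2 contDiffAt_const
    have hopen : (Bundle.TotalSpace.proj ⁻¹' U : Set (TangentBundle 𝓘(ℝ, ℂ) ℂ)) ∈
        𝓝 (⟨z, v⟩ : TangentBundle 𝓘(ℝ, ℂ) ℂ) :=
      (hU.preimage (FiberBundle.continuous_proj ℂ _)).mem_nhds hz
    refine ((h2.contMDiffAt hopen).comp z h3).congr_of_eventuallyEq ?_
    filter_upwards [hU.mem_nhds hz] with w hw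
    simp only [Function.comp_apply, tangentMapWithin]
    rw [mfderivWithin_of_isOpen hU hw]
  have h4 := hΩ.smooth.contMDiffAt.comp z (he z hz).contMDiffAt
  have h5 := ContMDiffAt.clm_bundle_apply₂ (E₃ := fun _ : S => ℝ) (F₃ := ℝ) (b := e)
    (ψ := fun w => Ω (e w)) h4 (hv 1) (hv Complex.I)
  have h6 := (Bundle.contMDiffAt_totalSpace.1 h5).2
  exact h6.contDiffAt

theorem form_skew (hΩ : IsSymplecticForm Ω) (p : S) (v w : EuclideanSpace ℝ (Fin 2)) :
    formAt Ω p v w = -formAt Ω p w v := by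
  have h : ∀ x, formAt Ω p x x = 0 := hΩ.alternating p
  have h1 := h (v + w)
  simp only [map_add, add_apply, h, zero_add, add_zero] at h1
  linarith

/-- In dimension two every alternating form is a multiple of `Im (conj v * w)`. -/
theorem form_diffParam (hΩ : IsSymplecticForm Ω) (e : ℂ → S) (z v w : ℂ) :
    formAt Ω (e z) (diffParam e z v) (diffParam e z w) =
      density Ω e z * (starRingEnd ℂ v * w).im := by
  have hb : ∀ x : ℂ, diffParam e z x = x.re • diffParam e z 1 + x.im • diffParam e z Complex.I := by
    intro x
    rw [← map_smul, ← map_smul, ← map_add]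
    congr 1
    refine Complex.ext ?_ ?_ <;> simp
  have h : ∀ x, formAt Ω (e z) x x = 0 := hΩ.alternating (e z)
  rw [hb v, hb w, density]
  simp only [map_add, map_smul, add_apply, smul_apply, h,
    smul_eq_mul, Complex.mul_im, Complex.conj_re, Complex.conj_im]
  rw [form_skew hΩ (e z) (diffParam e z Complex.I)]
  ring

theorem form_nondegenerate (hΩ : IsSymplecticForm Ω) {p : S} {x : EuclideanSpace ℝ (Fin 2)}
    (h : ∀ w : EuclideanSpace ℝ (Fin 2), formAt Ω p x w = 0) : x = 0 := hΩ.nondegenerate p x h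

theorem density_ne_zero (hΩ : IsSymplecticForm Ω) {e : ℂ → S} {z : ℂ}
    (he : IsLocalDiffeomorphAt 𝓘(ℝ, ℂ) (𝓡 2) ∞ e z) : density Ω e z ≠ 0 := by
  intro h
  let P : ℂ ≃L[ℝ] EuclideanSpace ℝ (Fin 2) := he.mfderivToContinuousLinearEquiv (by simp)
  have hP : ∀ v, P v = diffParam e z v := fun _ => rfl
  have h1 : P 1 = 0 := form_nondegenerate hΩ (p := e z) fun w => by
    have h2 := form_diffParam hΩ e z 1 (P.symm w)
    rw [h, zero_mul, ← hP, ← hP, P.apply_symm_apply] at h2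
    exact h2
  exact one_ne_zero ((map_eq_zero_iff P P.injective).1 h1)

/-- Non-degeneracy. It serves to compare vectors that come from different parametrizations through
their pairings with `Ω`. -/
theorem form_ext (hΩ : IsSymplecticForm Ω) {e : ℂ → S} {z : ℂ}
    (he : IsLocalDiffeomorphAt 𝓘(ℝ, ℂ) (𝓡 2) ∞ e z) {x y : EuclideanSpace ℝ (Fin 2)}
    (h : ∀ v, formAt Ω (e z) x (diffParam e z v) = formAt Ω (e z) y (diffParam e z v)) :
    x = y := by
  let P : ℂ ≃L[ℝ] EuclideanSpace ℝ (Fin 2) := he.mfderivToContinuousLinearEquiv (by simp)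
  have hP : ∀ v, P v = diffParam e z v := fun _ => rfl
  refine sub_eq_zero.1 (form_nondegenerate hΩ (p := e z) fun w => ?_)
  have h2 := h (P.symm w)
  rw [← hP, P.apply_symm_apply] at h2
  rw [map_sub, sub_apply, h2, sub_self]

theorem contDiffOn_planarField (hΩ : IsSymplecticForm Ω) {e : ℂ → S} {U : Set ℂ} (hU : IsOpen U)
    (he : ∀ z ∈ U, IsLocalDiffeomorphAt 𝓘(ℝ, ℂ) (𝓡 2) ∞ e z) {H : ℂ → ℝ}
    (hH : ContDiffOn ℝ ∞ H U) : ContDiffOn ℝ ∞ (planarField Ω e H) U := by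
  intro z hz
  refine ContDiffAt.contDiffWithinAt ?_
  have h1 := ((contDiffOn_density hΩ hU he).contDiffAt (hU.mem_nhds hz)).inv
    (density_ne_zero hΩ (he z hz))
  have h2 : ContDiffAt ℝ ∞ (fderiv ℝ H) z :=
    (hH.contDiffAt (hU.mem_nhds hz)).fderiv_right (by simp)
  have h3 : ∀ v, ContDiffAt ℝ ∞ (fun z => fderiv ℝ H z v) z := fun v =>
    h2.clm_apply contDiffAt_const
  have h4 : ContDiffAt ℝ ∞ (fun z => (⟨fderiv ℝ H z Complex.I, -fderiv ℝ H z 1⟩ : ℂ)) z := by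
    have h5 : ContDiffAt ℝ ∞ (fun z => Complex.equivRealProdCLM.symm
        (fderiv ℝ H z Complex.I, -fderiv ℝ H z 1)) z :=
      Complex.equivRealProdCLM.symm.contDiff.contDiffAt.comp z ((h3 _).prodMk (h3 1).neg)
    exact h5
  exact h1.smul h4

end Field

/-! ### Compatibility of the potentials under the gluing -/

section Gluing

variable {S : Type*} [TopologicalSpace S] [ChartedSpace (EuclideanSpace ℝ (Fin 2)) S]
  {g : ℕ} (d : TorusSum g S) (a : Slopes g)

/-- Thus any presentation is governed by the relation that defines `Model g`, and facts about
representatives carry over. -/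
theorem TorusSum.param_eq_iff {i j : Fin g} {z w : ℂ} (hz : z ∈ holedPlane g i)
    (hw : w ∈ holedPlane g j) : d.param i z = d.param j w ↔ Rel g i z j w := by
  rcases lt_trichotomy i j with h | h | h
  · have h1 : (i : ℕ) < j := h
    rw [d.eq_lt i j h z hz w hw]
    simp only [Rel, h.ne, false_and, false_or, show ¬ (i : ℕ) = j + 1 by omega, or_false]
  · subst h
    rw [d.eq_same i z hz w hw]
    simp [Rel]
  · have h1 : (j : ℕ) < i := h
    rw [eq_comm, d.eq_lt j i h w hw z hz]
    simp only [Rel, h.ne', false_and, false_or, show ¬ (j : ℕ) = i + 1 by omega]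

/-- Every point has a representative at distance at least `1/8` from the centres of the holes. -/
theorem TorusSum.exists_core (p : S) : ∃ i, ∃ z ∈ coreSet g i, d.param i z = p := by
  obtain ⟨i, z, hz, rfl⟩ := d.cover p
  obtain ⟨j, w, h, hw⟩ := exists_far (proj i ⟨z, hz⟩)
  exact ⟨j, w, hw, (d.param_eq_iff w.2 hz).2 (proj_eq.1 h)⟩

/-- The radius `1/12` in `farSet` is dual to `3/16 = 12/64`, up to which the cutoff vanishes. So two
far representatives glued across a neck both lie where the potential is the Joukowski map. -/
theorem normSq_lt_of_mul_eq {ζ w : ℂ} (h : ζ * w = 1 / 64) (hw : 1 / 12 < ‖w‖) :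
    Complex.normSq ζ < 9 / 256 := by
  have h1 : ‖ζ‖ * ‖w‖ = 1 / 64 := by rw [← norm_mul, h]; norm_num
  have h2 : ‖ζ‖ < 3 / 16 := by nlinarith [norm_nonneg ζ]
  rw [Complex.normSq_eq_norm_sq]
  nlinarith [norm_nonneg ζ]

theorem potential_of_normSq_lt {i : Fin g} {z c : ℂ} (hc : IsHoleCentre g i c)
    (h : Complex.normSq (z - c) < 9 / 256) :
    potential a i z = a.μ i * c + a.ε * ((z - c) + 1 / (64 * (z - c))) := by
  have hn : ‖z - c‖ < 1 / 4 := by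
    rw [Complex.normSq_eq_norm_sq] at h
    nlinarith [norm_nonneg (z - c)]
  rw [potential_near a hc hn, model_inner _ _ h.le]

/-- The gluing exchanges the two terms of `ζ + 1 / (64 ζ)`, and `ε` is common to both tori. Only the
constants `μ c` at the centres differ. -/
theorem potential_glued {i j : Fin g} {z w l m : ℂ} (hij : (j : ℕ) = i + 1)
    (hz : z ∈ farSet g i) (hw : w ∈ farSet g j) (hl : IsLattice l) (hm : IsLattice m)
    (h : (z - rightCentre - l) * (w - leftCentre - m) = 1 / 64) :
    potential a i z = potential a j w +
      (a.μ i * (rightCentre + l) - a.μ j * (leftCentre + m)) := by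
  rw [sub_sub, sub_sub] at h
  have hc : IsHoleCentre g i (rightCentre + l) :=
    isHoleCentre_right (by have := j.2; omega) hl
  have he : IsHoleCentre g j (leftCentre + m) := isHoleCentre_left (by omega) hm
  have h1 := normSq_lt_of_mul_eq h (hw _ he)
  have h2 := normSq_lt_of_mul_eq ((mul_comm _ _).trans h) (hz _ hc)
  have hz0 := sub_ne_zero_of_mem_farSet hz hc
  have hw0 := sub_ne_zero_of_mem_farSet hw he
  rw [potential_of_normSq_lt a hc h1, potential_of_normSq_lt a he h2]
  have h3 : 1 / (64 * (z - (rightCentre + l))) = w - (leftCentre + m) := by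
    rw [div_eq_iff (by simpa using hz0)]; linear_combination -64 * h
  have h4 : 1 / (64 * (w - (leftCentre + m))) = z - (rightCentre + l) := by
    rw [div_eq_iff (by simpa using hw0)]; linear_combination -64 * h
  rw [h3, h4]
  ring

/-- Identified points are identified through a local smooth map which preserves the potentials up to
a constant. -/
theorem TorusSum.exists_transition {i j : Fin g} {z w : ℂ} (hz : z ∈ farSet g i)
    (hw : w ∈ farSet g j) (h : d.param i z = d.param j w) :
    ∃ f : ℂ → ℂ, ContDiffAt ℝ ∞ f z ∧ f z = w ∧ ∃ k : ℂ,
      ∀ᶠ z' in 𝓝 z, d.param i z' = d.param j (f z') ∧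
        potential a i z' = potential a j (f z') + k := by
  have hzo := (isOpen_farSet g i).mem_nhds hz
  have hfar : ∀ f : ℂ → ℂ, ContDiffAt ℝ ∞ f z → f z = w → ∀ᶠ z' in 𝓝 z, f z' ∈ farSet g j := by
    intro f hf hfz
    exact hf.continuousAt.eventually (by rw [hfz]; exact (isOpen_farSet g j).mem_nhds hw)
  have hfin : ∀ {z' w' : ℂ}, z' ∈ farSet g i → w' ∈ farSet g j → Rel g i z' j w' →
      d.param i z' = d.param j w' := fun h1 h2 h3 =>
    (d.param_eq_iff (farSet_subset g i h1) (farSet_subset g j h2)).2 h3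
  rcases (d.param_eq_iff (farSet_subset g i hz) (farSet_subset g j hw)).1 h with
    ⟨rfl, hr⟩ | ⟨e, l, m, hl, hm, h⟩ | ⟨e, l, m, hl, hm, h⟩
  · have hf : ContDiffAt ℝ ∞ (fun z' => z' - (z - w)) z := by fun_prop
    have hfz : z - (z - w) = w := by ring
    refine ⟨_, hf, hfz, a.μ i * (z - w), ?_⟩
    filter_upwards [hzo, hfar _ hf hfz] with z' h1 h2
    refine ⟨hfin h1 h2 (Or.inl ⟨rfl, by simpa using hr⟩), ?_⟩
    rw [← potential_add_lattice a hr, sub_add_cancel]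
  · have h0 : z - rightCentre - l ≠ 0 := by
      intro h0; rw [h0] at h; norm_num at h
    have hf : ContDiffAt ℝ ∞ (fun z' => 1 / 64 * (z' - rightCentre - l)⁻¹ + leftCentre + m) z := by
      have : ContDiffAt ℝ ∞ (fun z' : ℂ => (z' - rightCentre - l)⁻¹) z :=
        ContDiffAt.inv (by fun_prop) h0
      fun_prop
    have hfz : 1 / 64 * (z - rightCentre - l)⁻¹ + leftCentre + m = w := by
      rw [← h]; field_simp; ring
    refine ⟨_, hf, hfz, a.μ i * (rightCentre + l) - a.μ j * (leftCentre + m), ?_⟩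
    have : ∀ᶠ z' in 𝓝 z, z' - rightCentre - l ≠ 0 :=
      ContinuousAt.eventually_ne (by fun_prop) h0
    filter_upwards [hzo, hfar _ hf hfz, this] with z' h1 h2 h3
    have h4 : (z' - rightCentre - l) *
        (1 / 64 * (z' - rightCentre - l)⁻¹ + leftCentre + m - leftCentre - m) = 1 / 64 := by
      field_simp; ring
    exact ⟨hfin h1 h2 (Or.inr (Or.inl ⟨e, l, m, hl, hm, h4⟩)),
      potential_glued a e h1 h2 hl hm h4⟩
  · have h0 : z - leftCentre - m ≠ 0 := by
      intro h0; rw [h0] at h; norm_num at h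
    have hf : ContDiffAt ℝ ∞ (fun z' => 1 / 64 * (z' - leftCentre - m)⁻¹ + rightCentre + l) z := by
      have : ContDiffAt ℝ ∞ (fun z' : ℂ => (z' - leftCentre - m)⁻¹) z :=
        ContDiffAt.inv (by fun_prop) h0
      fun_prop
    have hfz : 1 / 64 * (z - leftCentre - m)⁻¹ + rightCentre + l = w := by
      rw [← h]; field_simp; ring
    refine ⟨_, hf, hfz, -(a.μ j * (rightCentre + l) - a.μ i * (leftCentre + m)), ?_⟩
    have : ∀ᶠ z' in 𝓝 z, z' - leftCentre - m ≠ 0 :=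
      ContinuousAt.eventually_ne (by fun_prop) h0
    filter_upwards [hzo, hfar _ hf hfz, this] with z' h1 h2 h3
    have h4 : (1 / 64 * (z' - leftCentre - m)⁻¹ + rightCentre + l - rightCentre - l) *
        (z' - leftCentre - m) = 1 / 64 := by
      field_simp; ring
    refine ⟨hfin h1 h2 (Or.inr (Or.inr ⟨e, l, m, hl, hm, h4⟩)), ?_⟩
    rw [potential_glued a e h2 h1 hl hm h4]
    ring

theorem TorusSum.localDiffeo_far {i : Fin g} {z : ℂ} (hz : z ∈ farSet g i) :
    IsLocalDiffeomorphAt 𝓘(ℝ, ℂ) (𝓡 2) ∞ (d.param i) z :=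
  d.localDiffeo i z (farSet_subset g i hz)

/-- The linearized transition map. -/
theorem TorusSum.exists_linear_transition [IsManifold (𝓡 2) ∞ S] {i j : Fin g} {z w : ℂ}
    (hz : z ∈ farSet g i)
    (hw : w ∈ farSet g j) (h : d.param i z = d.param j w) :
    ∃ D : ℂ →L[ℝ] ℂ, (∀ v, diffParam (d.param i) z v = diffParam (d.param j) w (D v)) ∧
      ∀ v, fderiv ℝ (hamiltonian a i) z v = fderiv ℝ (hamiltonian a j) w (D v) := by
  obtain ⟨f, hf, rfl, k, hk⟩ := d.exists_transition a hz hw h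
  have hfd := hf.differentiableAt (by simp)
  refine ⟨fderiv ℝ f z, fun v => ?_, fun v => ?_⟩
  · have h1 : d.param i =ᶠ[𝓝 z] d.param j ∘ f := hk.mono fun z' h => h.1
    have h2 : MDifferentiableAt 𝓘(ℝ, ℂ) (𝓡 2) (d.param j) (f z) :=
      (d.localDiffeo_far hw).mdifferentiableAt (by simp)
    have h3 := h2.hasMFDerivAt.comp z hfd.hasFDerivAt.hasMFDerivAt
    have h4 := (h3.congr_of_eventuallyEq h1).mfderiv
    exact DFunLike.congr_fun h4 v
  · have h1 : hamiltonian a i =ᶠ[𝓝 z] fun z' => hamiltonian a j (f z') + k.im :=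
      hk.mono fun z' h => by rw [hamiltonian, h.2]; simp [hamiltonian]
    have h2 := ((contDiffAt_hamiltonian a hw).differentiableAt (by simp)).hasFDerivAt
    have h3 := ((h2.comp z hfd.hasFDerivAt).add_const k.im).congr_of_eventuallyEq h1
    rw [h3.fderiv]
    rfl

variable [IsManifold (𝓡 2) ∞ S] {Ω : BilinForm S}

variable (Ω) in
/-- The Hamiltonian vector field in the `i`-th holed plane. -/
def liftedField (i : Fin g) : ℂ → ℂ := planarField Ω (d.param i) (hamiltonian a i)

variable (Ω) in
/-- The vector field on the surface with the given multivalued Hamiltonian. -/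
def surfaceField : VField S := fun p =>
  let h := d.exists_core p
  diffParam (d.param h.choose) h.choose_spec.choose
    (liftedField d a Ω h.choose h.choose_spec.choose)

/-- The representative chosen in the definition is immaterial: transition maps preserve `dH`, and
`Ω` determines the vector from `dH`. -/
theorem surfaceField_eq (hΩ : IsSymplecticForm Ω) {i : Fin g} {z : ℂ} (hz : z ∈ farSet g i) :
    surfaceField d a Ω (d.param i z) = diffParam (d.param i) z (liftedField d a Ω i z) := by
  have h := d.exists_core (d.param i z)
  set j := h.choose with hj
  set w := h.choose_spec.choose with hw
  have hwj : w ∈ farSet g j := coreSet_subset g j h.choose_spec.choose_spec.1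
  have hpw : d.param j w = d.param i z := h.choose_spec.choose_spec.2
  have hdef : surfaceField d a Ω (d.param i z) = diffParam (d.param j) w (liftedField d a Ω j w) :=
    rfl
  have hdz := d.localDiffeo_far hz
  have hdw := d.localDiffeo_far hwj
  rw [hdef]
  refine form_ext hΩ hdz fun v => ?_
  obtain ⟨D, hD, hDH⟩ := d.exists_linear_transition a hz hwj hpw.symm
  have h1 : formAt Ω (d.param j w) (diffParam (d.param j) w (liftedField d a Ω j w))
      (diffParam (d.param j) w (D v)) = fderiv ℝ (hamiltonian a j) w (D v) := by
    rw [form_diffParam hΩ]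
    exact density_mul_planarField (density_ne_zero hΩ hdw) _
  rw [form_diffParam hΩ, hD, ← hpw, h1, ← hDH]
  exact (density_mul_planarField (density_ne_zero hΩ hdz) v).symm

theorem isPushforwardOn_surfaceField (hΩ : IsSymplecticForm Ω) (i : Fin g) :
    IsPushforwardOn (d.param i) (farSet g i) (liftedField d a Ω i) (surfaceField d a Ω) where
  isOpen := isOpen_farSet g i
  smooth := contDiffOn_planarField hΩ (isOpen_farSet g i) (fun _ h => d.localDiffeo_far h)
    fun _ h => (contDiffAt_hamiltonian a h).contDiffWithinAt
  localDiffeo := fun _ h => d.localDiffeo_far h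
  map_eq := fun _ h => surfaceField_eq d a hΩ h

theorem isHamiltonianOn_liftedField (hΩ : IsSymplecticForm Ω) (i : Fin g) :
    IsHamiltonianOn Ω (d.param i) (farSet g i) (liftedField d a Ω i) (density Ω (d.param i))
      (hamiltonian a i) where
  form_eq := fun z _ v w => form_diffParam hΩ (d.param i) z v w
  smooth_density := contDiffOn_density hΩ (isOpen_farSet g i) fun _ h => d.localDiffeo_far h
  smooth_hamiltonian := fun _ h => (contDiffAt_hamiltonian a h).contDiffWithinAt
  fderiv_eq := fun _ h w => density_mul_planarField (density_ne_zero hΩ (d.localDiffeo_far h)) w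

theorem isLocalPushforward_surfaceField (hΩ : IsSymplecticForm Ω) :
    IsLocalPushforward (surfaceField d a Ω) := by
  intro p
  obtain ⟨i, z, hz, rfl⟩ := d.exists_core p
  exact ⟨_, _, _, isPushforwardOn_surfaceField d a hΩ i, z, coreSet_subset g i hz, rfl⟩

theorem contraction_surfaceField (hΩ : IsSymplecticForm Ω) {i : Fin g} {z : ℂ}
    (hz : z ∈ farSet g i) (v : ℂ) :
    formAt Ω (d.param i z) (surfaceField d a Ω (d.param i z)) (diffParam (d.param i) z v) =
      fderiv ℝ (hamiltonian a i) z v := by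
  rw [surfaceField_eq d a hΩ hz, form_diffParam hΩ]
  exact density_mul_planarField (density_ne_zero hΩ (d.localDiffeo_far hz)) v

theorem surfaceField_eq_zero_iff (hΩ : IsSymplecticForm Ω) {i : Fin g} {z : ℂ}
    (hz : z ∈ farSet g i) : surfaceField d a Ω (d.param i z) = 0 ↔
      ∃ c, IsHoleCentre g i c ∧ (z = c + 1 / 8 ∨ z = c - 1 / 8) := by
  have hdz := d.localDiffeo_far hz
  rw [← fderiv_hamiltonian_eq_zero_iff a hz,
    ← planarField_eq_zero_iff (density_ne_zero hΩ hdz)]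
  obtain ⟨P, hP⟩ := (isPushforwardOn_surfaceField d a hΩ i).exists_equiv hz
  have h1 : surfaceField d a Ω (d.param i z) = P (liftedField d a Ω i z) := by
    rw [hP]; exact surfaceField_eq d a hΩ hz
  constructor
  · intro h
    exact (map_eq_zero_iff P P.injective).1 (h1.symm.trans h)
  · intro h
    refine h1.trans ?_
    have h2 : liftedField d a Ω i z = 0 := h
    rw [h2, map_zero]
    rfl

/-- The lifted field is periodic. -/
theorem liftedField_add_lattice (hΩ : IsSymplecticForm Ω) {i : Fin g} {z l : ℂ}
    (hz : z ∈ coreSet g i) (hl : IsLattice l) :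
    liftedField d a Ω i (z + l) = liftedField d a Ω i z := by
  have h1 := coreSet_subset g i hz
  have h2 := coreSet_subset g i (add_mem_coreSet hz hl)
  have he : ∀ z' ∈ farSet g i, z' + l ∈ farSet g i → d.param i (z' + l) = d.param i z' :=
    fun z' h3 h4 => (d.eq_same i _ (farSet_subset g i h4) _ (farSet_subset g i h3)).2
      (by simpa using hl)
  have hev : d.param i =ᶠ[𝓝 z] d.param i ∘ fun z' => z' + l := by
    have hc : ContinuousAt (fun z' : ℂ => z' + l) z := by fun_prop
    filter_upwards [(isOpen_farSet g i).mem_nhds h1,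
      hc.eventually ((isOpen_farSet g i).mem_nhds h2)] with z' h3 h4
    exact (he z' h3 h4).symm
  have hD : ∀ v, diffParam (d.param i) z v = diffParam (d.param i) (z + l) v := by
    intro v
    have h3 : MDifferentiableAt 𝓘(ℝ, ℂ) (𝓡 2) (d.param i) (z + l) :=
      (d.localDiffeo_far h2).mdifferentiableAt (by simp)
    have h4 : HasFDerivAt (fun z' : ℂ => z' + l) (ContinuousLinearMap.id ℝ ℂ) z :=
      (hasFDerivAt_id z).add_const l
    have h5 := ((h3.hasMFDerivAt.comp z h4.hasMFDerivAt).congr_of_eventuallyEq hev).mfderiv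
    exact DFunLike.congr_fun h5 v
  obtain ⟨P, hP⟩ := (isPushforwardOn_surfaceField d a hΩ i).exists_equiv h2
  refine P.injective ?_
  rw [hP, hP]
  have h6 := surfaceField_eq d a hΩ h1
  have h7 := surfaceField_eq d a hΩ h2
  rw [he z h1 h2] at h7
  rw [← hD (liftedField d a Ω i z)]
  exact h7.symm.trans h6

end Gluing

/-! ### The saddle points -/

section Saddles

variable {S : Type*} [TopologicalSpace S] [ChartedSpace (EuclideanSpace ℝ (Fin 2)) S]
  {g : ℕ} (d : TorusSum g S) (a : Slopes g) {Ω : BilinForm S}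

/-- Close to a hole, the lifted field is the conjugate of a holomorphic function divided by the
density. -/
theorem liftedField_near {i : Fin g} {z c : ℂ} (hz : z ∈ farSet g i) (hc : IsHoleCentre g i c)
    (hzc : Complex.normSq (z - c) < 9 / 256) :
    liftedField d a Ω i z = (density Ω (d.param i) z)⁻¹ •
      starRingEnd ℂ (a.ε * (1 - 1 / (64 * (z - c) ^ 2))) := by
  have h1 := hasDerivAt_potential a hc (sub_ne_zero_of_mem_farSet hz hc) hzc
  have h2 : ∀ v, fderiv ℝ (hamiltonian a i) z v =
      (v * (a.ε * (1 - 1 / (64 * (z - c) ^ 2)))).im := by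
    intro v
    rw [fderiv_hamiltonian a hz, (h1.hasFDerivAt.restrictScalars ℝ).fderiv]
    simp
  rw [liftedField, planarField, h2, h2]
  congr 1
  generalize (a.ε : ℂ) * (1 - 1 / (64 * (z - c) ^ 2)) = D
  refine Complex.ext ?_ ?_ <;> simp

/-- The holomorphic factor vanishes at the saddle, so the derivative of the density drops out. At `ζ
= s / 8` with `s = ±1`, the derivative of `1 - 1 / (64 ζ²)` is `16 s`. -/
theorem fderiv_liftedField_saddle [IsManifold (𝓡 2) ∞ S] (hΩ : IsSymplecticForm Ω) {i : Fin g} {z c : ℂ}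
    (hz : z ∈ farSet g i) (hc : IsHoleCentre g i c) (hzc : z = c + 1 / 8 ∨ z = c - 1 / 8) :
    ∃ κ : ℝ, κ ≠ 0 ∧ ∀ v, fderiv ℝ (liftedField d a Ω i) z v = κ • starRingEnd ℂ v := by
  have hzo := (isOpen_farSet g i).mem_nhds hz
  have h0 := sub_ne_zero_of_mem_farSet hz hc
  obtain ⟨s, hs0, hs⟩ : ∃ s : ℝ, s ^ 2 = 1 ∧ z - c = s / 8 := by
    rcases hzc with rfl | rfl
    · exact ⟨1, by norm_num, by push_cast; ring⟩
    · exact ⟨-1, by norm_num, by push_cast; ring⟩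
  have hsC : (s : ℂ) ^ 2 = 1 := by exact_mod_cast hs0
  have hs1 : s ≠ 0 := by rintro rfl; norm_num at hs0
  have hq : Complex.normSq (z - c) < 9 / 256 := by
    rw [hs, show (s : ℂ) / 8 = ((s / 8 : ℝ) : ℂ) by push_cast; ring, Complex.normSq_ofReal]
    nlinarith
  have hρ := density_ne_zero hΩ (d.localDiffeo_far hz)
  have hρd : DifferentiableAt ℝ (fun z' => (density Ω (d.param i) z')⁻¹) z :=
    (((contDiffOn_density hΩ (isOpen_farSet g i) fun _ h => d.localDiffeo_far h).contDiffAt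
      hzo).inv hρ).differentiableAt (by simp)
  have hev : liftedField d a Ω i =ᶠ[𝓝 z] fun z' => (density Ω (d.param i) z')⁻¹ •
      starRingEnd ℂ (a.ε * (1 - 1 / (64 * (z' - c) ^ 2))) := by
    have hcont : ContinuousAt (fun z' : ℂ => Complex.normSq (z' - c)) z :=
      (Complex.continuous_normSq.comp (continuous_sub_right c)).continuousAt
    filter_upwards [hzo, hcont.eventually_lt continuousAt_const hq] with z' h1 h2
    exact liftedField_near d a h1 hc h2
  have hD : HasDerivAt (fun z' : ℂ => (a.ε : ℂ) * (1 - 1 / (64 * (z' - c) ^ 2)))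
      ((a.ε : ℂ) * (16 * s)) z := by
    have h1 : HasDerivAt (fun z' : ℂ => 64 * (z' - c) ^ 2) (64 * (2 * (z - c))) z := by
      have := (((hasDerivAt_id z).sub_const c).pow 2).const_mul (64 : ℂ)
      simpa using this
    have h2 : HasDerivAt (fun z' : ℂ => 1 / (64 * (z' - c) ^ 2))
        (-(64 * (2 * (z - c))) / (64 * (z - c) ^ 2) ^ 2) z :=
      (h1.inv (mul_ne_zero (by norm_num) (pow_ne_zero 2 h0))).congr_of_eventuallyEq
        (Eventually.of_forall fun z => one_div _)
    refine ((h2.const_sub 1).const_mul (a.ε : ℂ)).congr_deriv ?_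
    rw [hs]
    have : (s : ℂ) ≠ 0 := by exact_mod_cast hs1
    have h4 : (64 * ((s : ℂ) / 8) ^ 2) ^ 2 = 1 := by
      rw [show (64 * ((s : ℂ) / 8) ^ 2) = (s : ℂ) ^ 2 by ring, hsC]; norm_num
    rw [h4]
    ring
  have hconj := Complex.conjCLE.toContinuousLinearMap.hasFDerivAt.comp z
    (hD.hasFDerivAt.restrictScalars ℝ)
  have hval : starRingEnd ℂ ((a.ε : ℂ) * (1 - 1 / (64 * (z - c) ^ 2))) = 0 := by
    rw [hs, show (64 * ((s : ℂ) / 8) ^ 2) = (s : ℂ) ^ 2 by ring, hsC]; norm_num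
  have hprod := hρd.hasFDerivAt.smul hconj
  refine ⟨(density Ω (d.param i) z)⁻¹ * (a.ε * (16 * s)), ?_, fun v => ?_⟩
  · have := a.pos.ne'
    positivity
  · rw [hev.fderiv_eq]
    refine (DFunLike.congr_fun hprod.fderiv v).trans ?_
    have hval' : (Complex.conjCLE.toContinuousLinearMap ∘
        fun z' : ℂ => (a.ε : ℂ) * (1 - 1 / (64 * (z' - c) ^ 2))) z = 0 := hval
    rw [hval']
    have h16 : starRingEnd ℂ 16 = 16 := map_ofNat _ 16
    simp [h16]
    ring

/-- The saddle points of the vector field, two on each neck. -/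
def saddle (x : Fin (g - 1) × Bool) : S :=
  d.param ⟨x.1, by omega⟩ (rightCentre + if x.2 then 1 / 8 else -1 / 8)

theorem norm_saddle_offset (b : Bool) : ‖(if b then 1 / 8 else -1 / 8 : ℂ)‖ = 1 / 8 := by
  cases b <;> norm_num

theorem saddle_mem_coreSet (x : Fin (g - 1) × Bool) :
    rightCentre + (if x.2 then 1 / 8 else -1 / 8) ∈ coreSet g ⟨x.1, by omega⟩ := by
  refine mem_coreSet_of_norm_eq (c := rightCentre + 0)
    (isHoleCentre_right (by simp only; omega) isLattice_zero) ?_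
  rw [add_zero, add_sub_cancel_left, norm_saddle_offset]

/-- In one torus, two offsets differ by less than a non-zero lattice vector. Across a neck, a glued
point lies within `1/4` of a left centre, while a saddle is `1/8` away from a right centre; but left
and right centres are at least `1/2` apart. -/
theorem saddle_injective : Function.Injective (saddle d) := by
  have key : ∀ x y : Fin (g - 1) × Bool, (x.1 : ℕ) ≤ y.1 → saddle d x = saddle d y → x = y := by
    intro x y hxy h
    have hx := farSet_subset _ _ (coreSet_subset _ _ (saddle_mem_coreSet x))
    have hy := farSet_subset _ _ (coreSet_subset _ _ (saddle_mem_coreSet y))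
    rcases (d.param_eq_iff hx hy).1 h with ⟨h1, h2⟩ | ⟨e, l, m, hl, hm, h2⟩ | ⟨e, -⟩
    · have h3 : x.1 = y.1 := by
        have := congrArg Fin.val h1
        exact Fin.ext this
      have h4 : x.2 = y.2 := by
        rw [add_sub_add_left_eq_sub] at h2
        have h5 := h2.eq_zero (by
          refine (norm_sub_le _ _).trans_lt ?_
          rw [norm_saddle_offset, norm_saddle_offset]; norm_num)
        cases hx2 : x.2 <;> cases hy2 : y.2 <;> simp [hx2, hy2] at h5 ⊢ <;> norm_num at h5
      exact Prod.ext h3 h4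
    · exfalso
      have b := glued_bounds e hx hy hl hm h2
      have h3 := half_le_norm (c := leftCentre + m) (d := rightCentre) (by simpa using hm)
        (by simpa using isLattice_zero)
      set o : ℂ := if y.2 then 1 / 8 else -1 / 8 with ho
      have h4 : leftCentre + m - rightCentre = o - (rightCentre + o - leftCentre - m) := by ring
      rw [h4] at h3
      have h5 : ‖o‖ = 1 / 8 := norm_saddle_offset y.2
      linarith [norm_sub_le o (rightCentre + o - leftCentre - m), b.2.2.2]
    · simp only at e
      omega
  intro x y h
  rcases le_total (x.1 : ℕ) y.1 with hxy | hxy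
  · exact key x y hxy h
  · exact (key y x hxy h.symm).symm

variable [IsManifold (𝓡 2) ∞ S]

/-- Zeros at a left hole are already counted: as `(±1/8)² = 1/64`, each is glued to the zero with
the same sign at the right hole of the previous torus. -/
theorem range_saddle (hΩ : IsSymplecticForm Ω) :
    range (saddle d) = {p | surfaceField d a Ω p = 0} := by
  ext p
  constructor
  · rintro ⟨x, rfl⟩
    refine (surfaceField_eq_zero_iff d a hΩ (coreSet_subset _ _ (saddle_mem_coreSet x))).2
      ⟨rightCentre + 0, isHoleCentre_right (by simp only; omega) isLattice_zero, ?_⟩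
    cases x.2
    · right; norm_num; ring
    · left; norm_num
  · intro hp
    obtain ⟨i, z, hz, rfl⟩ := d.exists_core p
    have hzf := coreSet_subset g i hz
    obtain ⟨c, hc, hzc⟩ := (surfaceField_eq_zero_iff d a hΩ hzf).1 hp
    obtain ⟨b, hb⟩ : ∃ b : Bool, z = c + if b then 1 / 8 else -1 / 8 := by
      rcases hzc with h | h
      · exact ⟨true, by simpa using h⟩
      · exact ⟨false, by rw [h]; norm_num; ring⟩
    rcases hc with ⟨hi, hc⟩ | ⟨hi, hc⟩
    · refine ⟨(⟨i - 1, by omega⟩, b), ?_⟩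
      have hx := farSet_subset _ _ (coreSet_subset _ _
        (saddle_mem_coreSet ((⟨i - 1, by omega⟩, b) : Fin (g - 1) × Bool)))
      refine (d.param_eq_iff hx (farSet_subset g i hzf)).2
        (Or.inr (Or.inl ⟨by simp only; omega, 0, c - leftCentre, isLattice_zero, hc, ?_⟩))
      rw [hb]
      cases b
      · simp only [Bool.false_eq_true, if_false]; ring
      · simp only [if_true]; ring
    · refine ⟨(⟨i, by omega⟩, b), ?_⟩
      have hx := farSet_subset _ _ (coreSet_subset _ _
        (saddle_mem_coreSet ((⟨i, by omega⟩, b) : Fin (g - 1) × Bool)))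
      refine (d.param_eq_iff hx (farSet_subset g i hzf)).2 (Or.inl ⟨rfl, ?_⟩)
      have : rightCentre + (if b then 1 / 8 else -1 / 8) - z = -(c - rightCentre) := by
        rw [hb]; ring
      simp only at this ⊢
      rw [this]
      exact hc.neg

theorem encard_zeros (hΩ : IsSymplecticForm Ω) :
    {p | surfaceField d a Ω p = 0}.encard = ((2 * g - 2 : ℕ) : ℕ∞) := by
  rw [← range_saddle d a hΩ, ← image_univ, (saddle_injective d).encard_image, encard_univ,
    ENat.card_eq_coe_fintype_card]
  simp only [Fintype.card_prod, Fintype.card_fin, Fintype.card_bool]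
  congr 1
  omega

end Saddles

/-! ### The flux -/

section Flux

variable {S : Type*} [TopologicalSpace S] [ChartedSpace (EuclideanSpace ℝ (Fin 2)) S]
  [IsManifold (𝓡 2) ∞ S] {g : ℕ} (d : TorusSum g S) (a : Slopes g) {Ω : BilinForm S}

/-- The contraction has local primitives. -/
theorem exists_primitive (hΩ : IsSymplecticForm Ω) (p : S) : ∃ K : S → ℝ,
    ContMDiffAt (𝓡 2) 𝓘(ℝ, ℝ) ∞ K p ∧ ∀ᶠ q in 𝓝 p,
      HasMFDerivAt (𝓡 2) 𝓘(ℝ, ℝ) K q (contraction Ω (surfaceField d a Ω) q) := by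
  obtain ⟨i, z, hz, rfl⟩ := d.exists_core p
  have hzf := coreSet_subset g i hz
  have he := d.localDiffeo_far hzf
  have hσz : he.localInverse (d.param i z) = z :=
    he.localInverse_left_inv he.localInverse_mem_target
  have hσ := he.localInverse_contMDiffAt
  refine ⟨fun q => hamiltonian a i (he.localInverse q), ?_, ?_⟩
  · have h1 : ContMDiffAt 𝓘(ℝ, ℂ) 𝓘(ℝ, ℝ) ∞ (hamiltonian a i) (he.localInverse (d.param i z)) := by
      rw [hσz]; exact (contDiffAt_hamiltonian a hzf).contMDiffAt
    exact h1.comp _ hσ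
  · have hU : ∀ᶠ q in 𝓝 (d.param i z), he.localInverse q ∈ farSet g i := by
      refine hσ.continuousAt.eventually ?_
      rw [hσz]; exact (isOpen_farSet g i).mem_nhds hzf
    have hs : ∀ᶠ q in 𝓝 (d.param i z),
        ContMDiffAt (𝓡 2) 𝓘(ℝ, ℂ) 1 he.localInverse q :=
      (contMDiffAt_iff_contMDiffAt_nhds (by simp)).1 (hσ.of_le (by simp))
    filter_upwards [hU, hs, he.localInverse_eventuallyEq_right.eventually_nhds]
      with q h1 h2 h3
    have hq : d.param i (he.localInverse q) = q := h3.self_of_nhds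
    have h4 := (h2.mdifferentiableAt (by simp)).hasMFDerivAt
    have h5 := ((contDiffAt_hamiltonian a h1).differentiableAt (by simp)).hasFDerivAt.hasMFDerivAt
    have h6 := h5.comp q h4
    have h7 := ((d.localDiffeo_far h1).mdifferentiableAt (by simp)).hasMFDerivAt
    have h8 := h7.comp q h4
    have h9 : (d.param i ∘ he.localInverse) =ᶠ[𝓝 q] id := h3
    have h10 := hasMFDerivAt_unique ((hasMFDerivAt_id q).congr_of_eventuallyEq h9) h8
    have h11 : ∀ (y : ℂ) (x : EuclideanSpace ℝ (Fin 2)),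
        x = diffParam (d.param i) (he.localInverse q) y →
        formAt Ω q (surfaceField d a Ω q) x = fderiv ℝ (hamiltonian a i) (he.localInverse q) y := by
      rintro y x rfl
      have h13 := contraction_surfaceField d a hΩ h1 y
      rwa [hq] at h13
    have h12 : contraction Ω (surfaceField d a Ω) q = (fderiv ℝ (hamiltonian a i)
        (he.localInverse q)).comp (mfderiv (𝓡 2) 𝓘(ℝ, ℂ) he.localInverse q) := by
      refine ContinuousLinearMap.ext fun x => ?_
      exact h11 _ x (DFunLike.congr_fun h10 x)
    rw [h12]
    exact h6

/-- In a chart the form is the differential of a function, so its derivative is a symmetric second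
derivative. -/
theorem isClosed_of_primitive {α : OneForm S} (h : ∀ p, ∃ K : S → ℝ,
    ContMDiffAt (𝓡 2) 𝓘(ℝ, ℝ) ∞ K p ∧ ∀ᶠ q in 𝓝 p, HasMFDerivAt (𝓡 2) 𝓘(ℝ, ℝ) K q (α q)) :
    α.IsClosed := by
  intro p
  have key : ∀ y ∈ (extChartAt (𝓡 2) p).target, ∃ k : EuclideanSpace ℝ (Fin 2) → ℝ,
      ContDiffAt ℝ ∞ k y ∧ α.inChart p =ᶠ[𝓝 y] fderiv ℝ k := by
    intro y hy
    have hopen : IsOpen (extChartAt (𝓡 2) p).target := isOpen_extChartAt_target p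
    have hsm : ∀ y ∈ (extChartAt (𝓡 2) p).target,
        ContMDiffAt 𝓘(ℝ, EuclideanSpace ℝ (Fin 2)) (𝓡 2) ∞ (extChartAt (𝓡 2) p).symm y :=
      fun y hy => (contMDiffOn_extChartAt_symm p).contMDiffAt (hopen.mem_nhds hy)
    obtain ⟨K, hK, hev⟩ := h ((extChartAt (𝓡 2) p).symm y)
    refine ⟨K ∘ (extChartAt (𝓡 2) p).symm, (hK.comp y (hsm y hy)).contDiffAt, ?_⟩
    filter_upwards [hopen.mem_nhds hy, (hsm y hy).continuousAt.eventually hev] with y' h1 h2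
    have h3 := h2.comp y' ((hsm y' h1).mdifferentiableAt (by simp)).hasMFDerivAt
    have h4 : HasFDerivAt (K ∘ (extChartAt (𝓡 2) p).symm) (α.inChart p y') y' :=
      hasMFDerivAt_iff_hasFDerivAt.1 h3
    exact h4.fderiv.symm
  refine ⟨fun y hy => ?_, fun y hy v w => ?_⟩
  · obtain ⟨k, hk, hev⟩ := key y hy
    exact ((hk.fderiv_right (by simp)).congr_of_eventuallyEq hev).contDiffWithinAt
  · obtain ⟨k, hk, hev⟩ := key y hy
    rw [hev.fderiv_eq]
    exact (hk.isSymmSndFDerivAt (by simpa using two_le_infty)) v w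

theorem quarter_le_abs {t : ℝ} {m : ℤ} (h : t = 1 / 4 - m ∨ t = -1 / 4 - m) : 1 / 4 ≤ |t| := by
  rcases h with rfl | rfl
  · rcases le_or_gt m 0 with hm | hm
    · have : (m : ℝ) ≤ 0 := by exact_mod_cast hm
      rw [abs_of_nonneg] <;> linarith
    · have : (1 : ℝ) ≤ m := by exact_mod_cast hm
      rw [abs_of_nonpos] <;> linarith
  · rcases le_or_gt m (-1) with hm | hm
    · have : (m : ℝ) ≤ -1 := by exact_mod_cast hm
      rw [abs_of_nonneg] <;> linarith
    · have : (0 : ℝ) ≤ m := by exact_mod_cast (show (0 : ℤ) ≤ m by omega)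
      rw [abs_of_nonpos] <;> linarith

/-- The coordinates of the centres are integers or half-integers, and `1/4` is at distance `1/4`
from these. Hence the potential is linear along the loops. -/
theorem quarter_le_norm_sub {i : Fin g} {z : ℂ} (h : z.re = 1 / 4 ∨ z.im = 1 / 4) {c : ℂ}
    (hc : IsHoleCentre g i c) : 1 / 4 ≤ ‖z - c‖ := by
  have hc' : ∃ m n : ℤ, (c.re = m ∧ c.im = n) ∨ (c.re = 1 / 2 + m ∧ c.im = 1 / 2 + n) := by
    rcases hc with ⟨_, m, n, h⟩ | ⟨_, m, n, h⟩
    · refine ⟨m, n, Or.inl ?_⟩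
      rw [sub_eq_iff_eq_add.1 h]; simp [leftCentre]
    · refine ⟨m, n, Or.inr ?_⟩
      rw [sub_eq_iff_eq_add.1 h]; constructor <;> simp [rightCentre] <;> ring
  obtain ⟨m, n, hc'⟩ := hc'
  rcases h with h | h
  · refine le_trans (quarter_le_abs (m := m) ?_) (Complex.abs_re_le_norm _)
    rw [Complex.sub_re, h]
    rcases hc' with ⟨h1, -⟩ | ⟨h1, -⟩ <;> rw [h1]
    · exact Or.inl rfl
    · right; ring
  · refine le_trans (quarter_le_abs (m := n) ?_) (Complex.abs_im_le_norm _)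
    rw [Complex.sub_im, h]
    rcases hc' with ⟨-, h1⟩ | ⟨-, h1⟩ <;> rw [h1]
    · exact Or.inl rfl
    · right; ring

/-- Along the line the potential is `μ i z`, so the integrand is constant in both variables. -/
theorem fluxOn_line (hΩ : IsSymplecticForm Ω) (i : Fin g) (x v : ℂ)
    (h : ∀ s : ℝ, (x + s * v).re = 1 / 4 ∨ (x + s * v).im = 1 / 4) :
    fluxOn Ω (fun _ => surfaceField d a Ω) (fun s => d.param i (x + s * v)) =
      (a.μ i * v).im := by
  have key : ∀ s : ℝ, contraction Ω (surfaceField d a Ω) (d.param i (x + s * v))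
      (mfderiv 𝓘(ℝ, ℝ) (𝓡 2) (fun s : ℝ => d.param i (x + s * v)) s (1 : ℝ)) =
        (a.μ i * v).im := by
    intro s
    have h1 : ∀ c, IsHoleCentre g i c → 1 / 4 ≤ ‖x + s * v - c‖ := fun c hc =>
      quarter_le_norm_sub (h s) hc
    have hz : x + s * v ∈ farSet g i := fun c hc => lt_of_lt_of_le (by norm_num) (h1 c hc)
    have h2 : HasDerivAt (fun s : ℝ => x + s * v) v s := by
      have : HasDerivAt (fun t : ℝ => (t : ℂ)) 1 s := Complex.ofRealCLM.hasDerivAt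
      simpa using (this.mul_const v).const_add x
    have h3 := ((d.localDiffeo_far hz).mdifferentiableAt (by simp)).hasMFDerivAt
    have h4 := (h3.comp s h2.hasFDerivAt.hasMFDerivAt).mfderiv
    have h5 : @Eq (EuclideanSpace ℝ (Fin 2))
        (mfderiv 𝓘(ℝ, ℝ) (𝓡 2) (fun s : ℝ => d.param i (x + s * v)) s (1 : ℝ))
        (diffParam (d.param i) (x + s * v) v) := by
      refine (DFunLike.congr_fun h4 (1 : ℝ)).trans ?_
      exact congrArg (diffParam (d.param i) (x + s * v)) (one_smul ℝ v)
    have h6 := contraction_surfaceField d a hΩ hz v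
    rw [← h5] at h6
    refine h6.trans ?_
    have h7 : HasDerivAt (fun z' : ℂ => a.μ i * z') (a.μ i) (x + s * v) := by
      simpa using (hasDerivAt_id (x + s * v)).const_mul (a.μ i)
    rw [fderiv_hamiltonian a hz, (potential_eventually_linear a h1).fderiv_eq,
      (h7.hasFDerivAt.restrictScalars ℝ).fderiv]
    simp
    ring
  rw [fluxOn]
  simp only [OneForm.period, key]
  simp

end Flux

/-! ### Absence of periodic orbits -/

section Orbits

/-- With the integrating factor `exp (-∫ b)`, `F t` is a positive multiple of `F 0`. -/
theorem nonneg_of_linear_ode {F b : ℝ → ℝ} {ε : ℝ} (hε : 0 < ε)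
    (hb : ContinuousOn b (Ioo (-ε) ε)) (hF : ∀ t ∈ Ioo (-ε) ε, HasDerivAt F (b t * F t) t)
    (h0 : 0 ≤ F 0) {t : ℝ} (ht : t ∈ Ioo (-ε) ε) : 0 ≤ F t := by
  have hI : (0 : ℝ) ∈ Ioo (-ε) ε := ⟨by linarith, hε⟩
  let A : ℝ → ℝ := fun t => ∫ s in (0 : ℝ)..t, b s
  have hA : ∀ t ∈ Ioo (-ε) ε, HasDerivAt A (b t) t := by
    intro t ht
    have hsub : uIcc 0 t ⊆ Ioo (-ε) ε := (ordConnected_Ioo).uIcc_subset hI ht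
    exact intervalIntegral.integral_hasDerivAt_right (hb.mono hsub).intervalIntegrable
      (hb.stronglyMeasurableAtFilter isOpen_Ioo t ht) (hb.continuousAt (isOpen_Ioo.mem_nhds ht))
  have hE : ∀ t ∈ Ioo (-ε) ε, HasDerivAt (fun t => Real.exp (-A t) * F t) 0 t := by
    intro t ht
    refine ((hA t ht).neg.exp.mul (hF t ht)).congr_deriv ?_
    simp only [Pi.neg_apply]
    ring
  have h1 := isOpen_Ioo.is_const_of_deriv_eq_zero isPreconnected_Ioo
    (fun t ht => (hE t ht).differentiableAt.differentiableWithinAt)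
    (fun t ht => (hE t ht).deriv) ht hI
  have hA0 : A 0 = 0 := intervalIntegral.integral_same
  rw [hA0, neg_zero, Real.exp_zero, one_mul] at h1
  rw [← h1] at h0
  exact nonneg_of_mul_nonneg_right h0 (Real.exp_pos _)

theorem exists_interval_of_eventually {Y : Type*} [TopologicalSpace Y] {y : Y}
    {Q : ℝ × Y → Prop} (h : ∀ᶠ x in 𝓝 ((0 : ℝ), y), Q x) :
    ∃ ε > 0, ∀ᶠ y' in 𝓝 y, ∀ t ∈ Ioo (-ε) ε, Q (t, y') := by
  rw [nhds_prod_eq, eventually_prod_iff] at h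
  obtain ⟨P, hP, R, hR, h⟩ := h
  obtain ⟨ε, hε, hb⟩ := Metric.eventually_nhds_iff.1 hP
  refine ⟨ε, hε, hR.mono fun y' hy' t ht => h (hb ?_) hy'⟩
  rw [Real.dist_eq, sub_zero]
  exact abs_lt.2 ht

variable {S : Type*} [TopologicalSpace S] [ChartedSpace (EuclideanSpace ℝ (Fin 2)) S]
  [IsManifold (𝓡 2) ∞ S] {g : ℕ} (d : TorusSum g S) (a : Slopes g) {Ω : BilinForm S}

/-- The circles of radius `1/8` around the centres of the holes are invariant. -/
theorem norm_ge_of_flow (hΩ : IsSymplecticForm Ω) {i : Fin g} {c : ℂ} (hc : IsHoleCentre g i c)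
    {φ : ℝ → ℂ} {ε : ℝ} (hε : 0 < ε) (hfar : ∀ t ∈ Ioo (-ε) ε, φ t ∈ farSet g i)
    (hφ : ∀ t ∈ Ioo (-ε) ε, HasDerivAt φ (liftedField d a Ω i (φ t)) t)
    (hnear : ∀ t ∈ Ioo (-ε) ε, ‖φ t - c‖ < 3 / 16) (h0 : 1 / 8 ≤ ‖φ 0 - c‖) {t : ℝ}
    (ht : t ∈ Ioo (-ε) ε) : 1 / 8 ≤ ‖φ t - c‖ := by
  -- For `ζ = φ - c`, the derivative of `|ζ|² - 1/64` is `2 ε ρ⁻¹ Re (ζ - 1 / (64 ζ))`. This is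
  -- divisible by `|ζ|² - 1/64`, and `b` is the quotient.
  let b : ℝ → ℝ := fun t => (density Ω (d.param i) (φ t))⁻¹ * (2 * a.ε * (φ t - c).re) /
    Complex.normSq (φ t - c)
  have hcont : ContinuousOn φ (Ioo (-ε) ε) := fun t ht =>
    (hφ t ht).continuousAt.continuousWithinAt
  have hne : ∀ t ∈ Ioo (-ε) ε, Complex.normSq (φ t - c) ≠ 0 := fun t ht =>
    (Complex.normSq_pos.2 (sub_ne_zero_of_mem_farSet (hfar t ht) hc)).ne'
  have hb : ContinuousOn b (Ioo (-ε) ε) := by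
    have h1 : ContinuousOn (fun t => density Ω (d.param i) (φ t)) (Ioo (-ε) ε) :=
      (contDiffOn_density hΩ (isOpen_farSet g i) fun _ h => d.localDiffeo_far h).continuousOn.comp
        hcont hfar
    have h2 : ContinuousOn (fun t => φ t - c) (Ioo (-ε) ε) := hcont.sub continuousOn_const
    refine ContinuousOn.div (ContinuousOn.mul (h1.inv₀ fun t ht =>
      density_ne_zero hΩ (d.localDiffeo_far (hfar t ht)))
      (continuousOn_const.mul (Complex.continuous_re.comp_continuousOn h2)))
      (Complex.continuous_normSq.comp_continuousOn h2) hne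
  have hF : ∀ t ∈ Ioo (-ε) ε, HasDerivAt (fun t => Complex.normSq (φ t - c) - 1 / 64)
      (b t * (Complex.normSq (φ t - c) - 1 / 64)) t := by
    intro t ht
    have hn : Complex.normSq (φ t - c) < 9 / 256 := by
      rw [Complex.normSq_eq_norm_sq]
      nlinarith [norm_nonneg (φ t - c), hnear t ht]
    have h1 : HasDerivAt (fun t => φ t - c) (liftedField d a Ω i (φ t)) t :=
      (hφ t ht).sub_const c
    have hre : HasDerivAt (fun t => (φ t - c).re) (liftedField d a Ω i (φ t)).re t :=
      Complex.reCLM.hasFDerivAt.comp_hasDerivAt t h1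
    have him : HasDerivAt (fun t => (φ t - c).im) (liftedField d a Ω i (φ t)).im t :=
      Complex.imCLM.hasFDerivAt.comp_hasDerivAt t h1
    have h2 := (((hre.mul hre).add (him.mul him)).sub_const (1 / 64)).congr_of_eventuallyEq
      (f₁ := fun t => Complex.normSq (φ t - c) - 1 / 64)
      (Eventually.of_forall fun t => by simp [Complex.normSq_apply])
    refine h2.congr_deriv ?_
    rw [liftedField_near d a (hfar t ht) hc hn]
    have h3 := hne t ht
    have h4 := sub_ne_zero_of_mem_farSet (hfar t ht) hc
    simp only [b]
    set ζ := φ t - c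
    set ρ := density Ω (d.param i) (φ t)
    have h5 : 1 / (64 * ζ ^ 2) = (starRingEnd ℂ ζ) ^ 2 / (64 * (Complex.normSq ζ : ℂ) ^ 2) := by
      have h6 : starRingEnd ℂ ζ ≠ 0 := (map_ne_zero _).2 h4
      rw [← Complex.mul_conj]
      field_simp
    have h7 : (64 * (Complex.normSq ζ : ℂ) ^ 2) = ((64 * Complex.normSq ζ ^ 2 : ℝ) : ℂ) := by
      push_cast; ring
    rw [h5, h7]
    have hre2 : ((starRingEnd ℂ ζ) ^ 2 / ((64 * Complex.normSq ζ ^ 2 : ℝ) : ℂ)).re =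
        (ζ.re * ζ.re - ζ.im * ζ.im) / (64 * Complex.normSq ζ ^ 2) := by
      rw [Complex.div_ofReal_re]
      simp [sq]
    have him2 : ((starRingEnd ℂ ζ) ^ 2 / ((64 * Complex.normSq ζ ^ 2 : ℝ) : ℂ)).im =
        -(2 * ζ.re * ζ.im) / (64 * Complex.normSq ζ ^ 2) := by
      rw [Complex.div_ofReal_im]
      simp [sq]; ring
    simp only [Complex.smul_re, Complex.smul_im, smul_eq_mul, Complex.conj_re, Complex.conj_im,
      Complex.re_ofReal_mul, Complex.im_ofReal_mul, Complex.sub_re, Complex.sub_im, Complex.one_re,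
      Complex.one_im, hre2, him2]
    have hN : Complex.normSq ζ = ζ.re * ζ.re + ζ.im * ζ.im := Complex.normSq_apply ζ
    generalize ρ⁻¹ = R
    field_simp
    rw [hN]
    ring
  have h1 := nonneg_of_linear_ode hε hb hF (by
    rw [Complex.normSq_eq_norm_sq]; nlinarith) ht
  simp only [Complex.normSq_eq_norm_sq] at h1
  nlinarith [norm_nonneg (φ t - c)]

/-- A flow line through the core, over a symmetric time interval, lifted to the plane. -/
def HasCoreLift (Ω : BilinForm S) (ψ : ℝ → S → S) (i : Fin g) (ε : ℝ) (z : ℂ) : Prop :=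
  ∃ φ : ℝ → ℂ, φ 0 = z ∧ ∀ t ∈ Ioo (-ε) ε, φ t ∈ coreSet g i ∧
    HasDerivAt φ (liftedField d a Ω i (φ t)) t ∧ ψ t (d.param i z) = d.param i (φ t)

/-- The derivative of the real part of the potential along the flow lines. -/
def speed (Ω : BilinForm S) (i : Fin g) (z : ℂ) : ℝ :=
  (fderiv ℝ (potential a i) z (liftedField d a Ω i z)).re

theorem fderiv_hamiltonian_liftedField (hΩ : IsSymplecticForm Ω) {i : Fin g} {z : ℂ}
    (hz : z ∈ farSet g i) : fderiv ℝ (hamiltonian a i) z (liftedField d a Ω i z) = 0 := by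
  rw [← (isHamiltonianOn_liftedField d a hΩ i).fderiv_eq z hz, mul_comm (starRingEnd ℂ _),
    Complex.mul_conj, Complex.ofReal_im, mul_zero]

/-- The differential of the potential maps the field to a real number, as the Hamiltonian is
constant along the flow. If that number were zero, injectivity away from the saddles would make the
point a zero of the field. -/
theorem speed_ne_zero (hΩ : IsSymplecticForm Ω) {i : Fin g} {z : ℂ} (hz : z ∈ farSet g i)
    (hX : surfaceField d a Ω (d.param i z) ≠ 0) : speed d a Ω i z ≠ 0 := by
  intro h
  have h1 : fderiv ℝ (potential a i) z (liftedField d a Ω i z) = 0 :=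
    Complex.ext h (by
      rw [← fderiv_hamiltonian a hz, fderiv_hamiltonian_liftedField d a hΩ hz]; rfl)
  refine hX ((surfaceField_eq_zero_iff d a hΩ hz).2 ?_)
  rcases fderiv_potential_eq_zero a hz h1 with h2 | h2
  · exact (fderiv_hamiltonian_eq_zero_iff a hz).1
      ((planarField_eq_zero_iff (density_ne_zero hΩ (d.localDiffeo_far hz))).1 h2)
  · exact h2

theorem continuousOn_speed (hΩ : IsSymplecticForm Ω) (i : Fin g) :
    ContinuousOn (speed d a Ω i) (farSet g i) := by
  intro z hz
  refine ContinuousAt.continuousWithinAt ?_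
  have h1 : ContinuousAt (fderiv ℝ (potential a i)) z :=
    ((contDiffAt_potential a hz).fderiv_right (m := 0) (by simp)).continuousAt
  have h2 : ContinuousAt (liftedField d a Ω i) z :=
    (isPushforwardOn_surfaceField d a hΩ i).smooth.continuousOn.continuousAt
      ((isOpen_farSet g i).mem_nhds hz)
  exact Complex.continuous_re.continuousAt.comp (h1.clm_apply h2)

/-- Along a lifted flow line without fixed points, the imaginary part of the potential is constant
and the real part is strictly monotone. -/
theorem potential_along_flow (hΩ : IsSymplecticForm Ω) {i : Fin g} {φ : ℝ → ℂ} {T : ℝ}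
    (hT : 0 < T) (hfar : ∀ t ∈ Icc 0 T, φ t ∈ farSet g i)
    (hφ : ∀ t ∈ Icc 0 T, HasDerivAt φ (liftedField d a Ω i (φ t)) t)
    (hX : ∀ t ∈ Icc 0 T, surfaceField d a Ω (d.param i (φ t)) ≠ 0) {s : ℝ}
    (hs : 0 < s * speed d a Ω i (φ 0)) :
    hamiltonian a i (φ T) = hamiltonian a i (φ 0) ∧
      s * (potential a i (φ 0)).re < s * (potential a i (φ T)).re ∧
      0 < s * speed d a Ω i (φ T) := by
  have h0 : (0 : ℝ) ∈ Icc 0 T := ⟨le_rfl, hT.le⟩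
  have hTT : T ∈ Icc 0 T := ⟨hT.le, le_rfl⟩
  have hcont : ContinuousOn φ (Icc 0 T) := fun t ht => (hφ t ht).continuousAt.continuousWithinAt
  have hsc : ContinuousOn (fun t => s * speed d a Ω i (φ t)) (Icc 0 T) :=
    continuousOn_const.mul ((continuousOn_speed d a hΩ i).comp hcont hfar)
  have hs0 : s ≠ 0 := by rintro rfl; simp at hs
  -- A continuous speed without zeros keeps its sign.
  have hpos : ∀ t ∈ Icc 0 T, 0 < s * speed d a Ω i (φ t) := by
    intro t ht
    by_contra! hneg
    obtain ⟨r, hr, hr0⟩ := intermediate_value_Icc' ht.1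
      (hsc.mono (Icc_subset_Icc le_rfl ht.2)) ⟨hneg, hs.le⟩
    have hr' : r ∈ Icc 0 T := ⟨hr.1, hr.2.trans ht.2⟩
    exact mul_ne_zero hs0 (speed_ne_zero d a hΩ (hfar r hr') (hX r hr')) hr0
  have hΦ : ∀ t ∈ Icc 0 T, HasDerivAt (fun t => potential a i (φ t))
      (fderiv ℝ (potential a i) (φ t) (liftedField d a Ω i (φ t))) t := fun t ht =>
    (((contDiffAt_potential a (hfar t ht)).differentiableAt (by simp)).hasFDerivAt).comp_hasDerivAt
      t (hφ t ht)
  have hre : ∀ t ∈ Icc 0 T, HasDerivAt (fun t => s * (potential a i (φ t)).re)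
      (s * speed d a Ω i (φ t)) t := fun t ht =>
    (Complex.reCLM.hasFDerivAt.comp_hasDerivAt t (hΦ t ht)).const_mul s
  have him : ∀ t ∈ Icc 0 T, HasDerivAt (fun t => hamiltonian a i (φ t)) 0 t := fun t ht => by
    refine (Complex.imCLM.hasFDerivAt.comp_hasDerivAt t (hΦ t ht)).congr_deriv ?_
    have h1 := fderiv_hamiltonian_liftedField d a hΩ (hfar t ht)
    rw [fderiv_hamiltonian a (hfar t ht)] at h1
    exact h1
  refine ⟨?_, ?_, hpos T hTT⟩
  · exact constant_of_has_deriv_right_zero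
      (fun t ht => (him t ht).continuousAt.continuousWithinAt)
      (fun t ht => (him t ⟨ht.1, ht.2.le⟩).hasDerivWithinAt) T hTT
  · refine strictMonoOn_of_deriv_pos (convex_Icc 0 T)
      (fun t ht => (hre t ht).continuousAt.continuousWithinAt) (fun t ht => ?_) h0 hTT hT
    rw [interior_Icc] at ht
    have ht' : t ∈ Icc 0 T := ⟨ht.1.le, ht.2.le⟩
    rw [(hre t ht').deriv]
    exact hpos t ht'

variable [T2Space S] {ψ : ℝ → S → S}

/-- At a boundary point of the core, that is at distance exactly `1/8` from a centre, invariance of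
the circle keeps nearby lifts in the core. Elsewhere the core is a neighbourhood of the point. -/
theorem exists_core_lift_near (hΩ : IsSymplecticForm Ω) (h0 : ∀ p, ψ 0 p = p)
    (hψ : ∀ p, IsMIntegralCurve (I := 𝓡 2) (fun t => ψ t p) (surfaceField d a Ω))
    {i : Fin g} {z₀ : ℂ} (hz₀ : z₀ ∈ coreSet g i) :
    ∃ ε > 0, ∀ᶠ z in 𝓝 z₀, z ∈ coreSet g i → HasCoreLift d a Ω ψ i ε z := by
  obtain ⟨ε, hε, φ, hφ, hev⟩ := (isPushforwardOn_surfaceField d a hΩ i).exists_local_flow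
    (isLocalPushforward_surfaceField d a hΩ) h0 hψ (coreSet_subset g i hz₀)
  have hφ0 : φ (0, z₀) = z₀ := hev.self_of_nhds.1
  by_cases hc : ∃ c, IsHoleCentre g i c ∧ ‖z₀ - c‖ ≤ 1 / 8
  · obtain ⟨c, hc, hzc⟩ := hc
    have hnear : ∀ᶠ x in 𝓝 ((0 : ℝ), z₀), ‖φ x - c‖ < 3 / 16 := by
      have h1 : ContinuousAt (fun x => ‖φ x - c‖) ((0 : ℝ), z₀) :=
        (hφ.continuousAt.sub continuousAt_const).norm
      exact h1.eventually_lt continuousAt_const (by rw [hφ0]; linarith)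
    obtain ⟨δ, hδ, hn⟩ := exists_interval_of_eventually hnear
    refine ⟨min ε δ, lt_min hε hδ, ?_⟩
    filter_upwards [hev, hn] with z h1 h2 hz
    have hsub1 : Ioo (-min ε δ) (min ε δ) ⊆ Ioo (-ε) ε :=
      Ioo_subset_Ioo (neg_le_neg (min_le_left _ _)) (min_le_left _ _)
    have hsub2 : Ioo (-min ε δ) (min ε δ) ⊆ Ioo (-δ) δ :=
      Ioo_subset_Ioo (neg_le_neg (min_le_right _ _)) (min_le_right _ _)
    refine ⟨fun t => φ (t, z), h1.1, fun t ht => ⟨?_, (h1.2 t (hsub1 ht)).2⟩⟩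
    have h3 : 1 / 8 ≤ ‖φ (t, z) - c‖ := by
      refine norm_ge_of_flow d a hΩ hc (φ := fun t => φ (t, z)) (lt_min hε hδ)
        (fun s hs => (h1.2 s (hsub1 hs)).1) (fun s hs => (h1.2 s (hsub1 hs)).2.1)
        (fun s hs => h2 s (hsub2 hs)) ?_ ht
      simp only [h1.1]
      exact hz c hc
    intro e he
    by_cases hce : c = e
    · rw [← hce]; exact h3
    · have h4 := h2 t (hsub2 ht)
      linarith [quarter_lt_of_near (z := φ (t, z)) hc (by linarith) he hce]
  · push Not at hc
    have hopen : IsOpen {z | ∀ c, IsHoleCentre g i c → 1 / 8 < ‖z - c‖} :=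
      isOpen_farOf g i le_rfl
    have hin : ∀ᶠ x in 𝓝 ((0 : ℝ), z₀), φ x ∈ {z | ∀ c, IsHoleCentre g i c → 1 / 8 < ‖z - c‖} :=
      hφ.continuousAt.eventually (by rw [hφ0]; exact hopen.mem_nhds hc)
    obtain ⟨δ, hδ, hn⟩ := exists_interval_of_eventually hin
    refine ⟨min ε δ, lt_min hε hδ, ?_⟩
    filter_upwards [hev, hn] with z h1 h2 hz
    refine ⟨fun t => φ (t, z), h1.1, fun t ht => ⟨fun c hc' => ?_, (h1.2 t ?_).2⟩⟩
    · exact (h2 t (Ioo_subset_Ioo (neg_le_neg (min_le_right _ _)) (min_le_right _ _) ht) c hc').le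
    · exact Ioo_subset_Ioo (neg_le_neg (min_le_left _ _)) (min_le_left _ _) ht

/-- Flow lines that start in a core can be lifted over a uniform time interval. -/
theorem exists_uniform_core_lift (hΩ : IsSymplecticForm Ω) (h0 : ∀ p, ψ 0 p = p)
    (hψ : ∀ p, IsMIntegralCurve (I := 𝓡 2) (fun t => ψ t p) (surfaceField d a Ω)) (i : Fin g) :
    ∃ ε > 0, ∀ z ∈ coreSet g i, HasCoreLift d a Ω ψ i ε z := by
  have hK : IsCompact (coreSet g i ∩ Metric.closedBall 0 2) :=
    (isCompact_closedBall 0 2).inter_left (isClosed_coreSet g i)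
  obtain ⟨ε, hε, h⟩ := exists_uniform_of_isCompact hK
    (P := fun ε z => z ∈ coreSet g i → HasCoreLift d a Ω ψ i ε z)
    (fun {ε ε' z} hle h hz => by
      obtain ⟨φ, h1, h2⟩ := h hz
      exact ⟨φ, h1, fun t ht => h2 t (Ioo_subset_Ioo (neg_le_neg hle) hle ht)⟩)
    (fun z hz => exists_core_lift_near d a hΩ h0 hψ hz.1)
  refine ⟨ε, hε, fun z hz => ?_⟩
  -- Translation by `-l` brings `z` into the unit square, where compactness applies; the lift is
  -- translated back by periodicity of the field.
  let l : ℂ := ⌊z.re⌋ + ⌊z.im⌋ * Complex.I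
  have hl : IsLattice l := ⟨_, _, rfl⟩
  have hm : z + -l ∈ coreSet g i := add_mem_coreSet hz hl.neg
  have hball : z + -l ∈ Metric.closedBall (0 : ℂ) 2 := by
    rw [mem_closedBall_zero_iff]
    refine (Complex.norm_le_abs_re_add_abs_im _).trans ?_
    have h1 : (z + -l).re = Int.fract z.re := by simp [l, Int.fract, sub_eq_add_neg]
    have h2 : (z + -l).im = Int.fract z.im := by simp [l, Int.fract, sub_eq_add_neg]
    rw [h1, h2, Int.abs_fract, Int.abs_fract]
    linarith [Int.fract_lt_one z.re, Int.fract_lt_one z.im]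
  have hpar : ∀ w ∈ coreSet g i, d.param i (w + l) = d.param i w := fun w hw =>
    (d.eq_same i _ (farSet_subset g i (coreSet_subset g i (add_mem_coreSet hw hl))) _
      (farSet_subset g i (coreSet_subset g i hw))).2 (by simpa using hl)
  obtain ⟨φ, h1, h2⟩ := h (z + -l) ⟨hm, hball⟩ hm
  refine ⟨fun t => φ t + l, by simp [h1], fun t ht => ?_⟩
  obtain ⟨h3, h4, h5⟩ := h2 t ht
  refine ⟨add_mem_coreSet h3 hl, ?_, ?_⟩
  · rw [liftedField_add_lattice d a hΩ h3 hl]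
    exact h4.add_const l
  · rw [hpar _ h3, ← h5, ← hpar _ hm, neg_add_cancel_right]

/-- The orbit of a point that is not fixed does not meet the fixed points. -/
theorem field_ne_zero_of_flow {X : VField S} (hX : IsLocalPushforward X)
    (h0 : ∀ p, ψ 0 p = p) (hadd : ∀ s t p, ψ (s + t) p = ψ s (ψ t p))
    (hψ : ∀ p, IsMIntegralCurve (I := 𝓡 2) (fun t => ψ t p) X) {p : S} (hp : X p ≠ 0) (t : ℝ) :
    X (ψ t p) ≠ 0 := by
  intro h
  have h1 := (fixed_iff_field_eq_zero hX h0 hψ (ψ t p)).2 h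
  have h2 : ψ t p = p := by
    have := h1 (-t)
    rw [← hadd, neg_add_cancel, h0] at this
    exact this.symm
  rw [h2] at h
  exact hp h

/-- For `l = m + n I` the imaginary part is `u n + v m`; if `m ≠ 0`, then `v / u = -n / m` would be
rational. -/
theorem isLattice_eq_zero_of_im_mul {u v : ℝ} (hu : u ≠ 0) (huv : Irrational (v / u)) {l : ℂ}
    (hl : IsLattice l) (h : ((⟨u, v⟩ : ℂ) * l).im = 0) : l = 0 := by
  obtain ⟨m, n, rfl⟩ := hl
  have h1 : u * n + v * m = 0 := by simpa using h
  have hm : m = 0 := by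
    by_contra hm
    have hm' : (m : ℝ) ≠ 0 := by exact_mod_cast hm
    refine huv ⟨-n / m, ?_⟩
    push_cast
    field_simp
    linarith
  rw [hm] at h1
  have hn : n = 0 := by
    have : u * n = 0 := by simpa using h1
    exact_mod_cast (mul_eq_zero.1 this).resolve_left hu
  simp [hm, hn]

/-- Periodic points are zeros of the vector field. -/
theorem surfaceField_eq_zero_of_periodic (hΩ : IsSymplecticForm Ω) {u v : Fin g → ℝ}
    (hu : ∀ i, u i ≠ 0) (huv : ∀ i, Irrational (v i / u i)) (ha : ∀ i, a.μ i = ⟨u i, v i⟩)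
    (h0 : ∀ p, ψ 0 p = p) (hadd : ∀ s t p, ψ (s + t) p = ψ s (ψ t p))
    (hψ : ∀ p, IsMIntegralCurve (I := 𝓡 2) (fun t => ψ t p) (surfaceField d a Ω)) {p : S} {T : ℝ}
    (hT : 0 < T) (hp : ψ T p = p) : surfaceField d a Ω p = 0 := by
  by_contra hX
  obtain ⟨i, z, hz, rfl⟩ := d.exists_core p
  obtain ⟨ε, hε, hlift⟩ := exists_uniform_core_lift d a hΩ h0 hψ i
  -- The period is cut into `N` pieces shorter than the uniform lifting time.
  obtain ⟨N, hN⟩ := exists_nat_gt (T / ε)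
  have hN0 : (0 : ℝ) < N := lt_of_le_of_lt (by positivity) hN
  set η := T / N with hη
  have hη0 : 0 < η := div_pos hT hN0
  have hηε : η < ε := by
    rw [hη, div_lt_iff₀ hN0]
    rwa [div_lt_iff₀ hε, mul_comm] at hN
  obtain ⟨s, hs⟩ : ∃ s : ℝ, 0 < s * speed d a Ω i z :=
    ⟨speed d a Ω i z, mul_self_pos.2 (speed_ne_zero d a hΩ (coreSet_subset g i hz) hX)⟩
  -- The lifts of successive pieces are joined end to end in the plane of the torus `i`, which the
  -- orbit never leaves. The increase of the real part is strict only after the first piece.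
  have step : ∀ n : ℕ, ∃ z' ∈ coreSet g i, ψ (n * η) (d.param i z) = d.param i z' ∧
      hamiltonian a i z' = hamiltonian a i z ∧ 0 < s * speed d a Ω i z' ∧
      s * (potential a i z).re ≤ s * (potential a i z').re ∧
      (0 < n → s * (potential a i z).re < s * (potential a i z').re) := by
    intro n
    induction n with
    | zero => exact ⟨z, hz, by simp [h0], rfl, hs, le_rfl, fun h => absurd h (lt_irrefl 0)⟩
    | succ n ih =>
      obtain ⟨w, hw, h1, h2, h3, h4, -⟩ := ih
      obtain ⟨φ, hφ0, hφ⟩ := hlift w hw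
      have hsub : ∀ t ∈ Icc 0 η, t ∈ Ioo (-ε) ε := fun t ht =>
        ⟨by linarith [ht.1], ht.2.trans_lt hηε⟩
      have hXt : ∀ t ∈ Icc 0 η, surfaceField d a Ω (d.param i (φ t)) ≠ 0 := by
        intro t ht
        have h5 := field_ne_zero_of_flow (isLocalPushforward_surfaceField d a hΩ) h0 hadd hψ hX
          (t + n * η)
        rwa [hadd, h1, (hφ t (hsub t ht)).2.2] at h5
      have h6 := potential_along_flow d a hΩ hη0
        (fun t ht => coreSet_subset g i (hφ t (hsub t ht)).1)
        (fun t ht => (hφ t (hsub t ht)).2.1) hXt (s := s) (by rwa [hφ0])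
      rw [hφ0] at h6
      have hηm := hsub η ⟨hη0.le, le_rfl⟩
      have h7 := h4.trans_lt h6.2.1
      refine ⟨φ η, (hφ η hηm).1, ?_, h6.1.trans h2, h6.2.2, h7.le, fun _ => h7⟩
      rw [← (hφ η hηm).2.2, ← h1, ← hadd]
      congr 1
      push_cast
      ring
  obtain ⟨z', hz', h1, h2, -, -, h3⟩ := step N
  rw [hη, mul_div_cancel₀ _ hN0.ne', hp] at h1
  -- After one period the lift has moved by a lattice vector. Equal Hamiltonians at its ends force
  -- this vector to be zero, against the strict increase of the real part.
  have hl : IsLattice (z' - z) := (d.eq_same i _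
    (farSet_subset g i (coreSet_subset g i hz')) _
    (farSet_subset g i (coreSet_subset g i hz))).1 h1.symm
  have h4 : potential a i z' = potential a i z + a.μ i * (z' - z) := by
    rw [← potential_add_lattice a hl, add_sub_cancel]
  have h5 : ((⟨u i, v i⟩ : ℂ) * (z' - z)).im = 0 := by
    rw [hamiltonian, hamiltonian, h4, Complex.add_im, ha] at h2
    linarith
  have h6 := isLattice_eq_zero_of_im_mul (hu i) (huv i) hl h5
  have h7 := h3 (by exact_mod_cast hN0)
  rw [sub_eq_zero.1 h6] at h7
  exact lt_irrefl _ h7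

end Orbits

end SurfaceFlow

end

/-! ### The flow with prescribed flux -/

open SurfaceFlow in
theorem theorem1p2 {S : Type*} [TopologicalSpace S] [T2Space S] [CompactSpace S]
    [ChartedSpace (EuclideanSpace ℝ (Fin 2)) S] [IsManifold (𝓡 2) ∞ S]
    (g : ℕ) (hg : 2 ≤ g) (d : TorusSum g S)
    (Ω : BilinForm S) (hΩ : IsSymplecticForm Ω)
    (u v : Fin g → ℝ) (hu : ∀ i, u i ≠ 0) (huv : ∀ i, Irrational (v i / u i)) :
    ∃ ψ : SymplecticFlow Ω,
      (∀ p, ψ.IsPeriodicPoint p → p ∈ ψ.fixedPoints) ∧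
      ψ.fixedPoints.encard = ((2 * g - 2 : ℕ) : ℕ∞) ∧
      (∀ p ∈ ψ.fixedPoints, IsHyperbolicFixedPoint (ψ.toFun 1) p) ∧
      HasFlux d ψ u v := by
  obtain ⟨a, ha⟩ := Slopes.exists_of_ne_zero (fun i => (⟨u i, v i⟩ : ℂ))
    fun i h => hu i (congrArg Complex.re h)
  have ha' : ∀ i, a.μ i = ⟨u i, v i⟩ := fun i => congrFun ha i
  have hX := isLocalPushforward_surfaceField d a hΩ
  obtain ⟨ψ, h0, hadd, hψ, hsm⟩ := hX.exists_flow
  have hinf : ∀ p (v w : EuclideanSpace ℝ (Fin 2)), HasDerivAt (fun t => formAt Ω (ψ t p)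
      (diffMap (ψ t) p v) (diffMap (ψ t) p w)) 0 0 := by
    intro p v w
    obtain ⟨i, z, hz, rfl⟩ := d.exists_core p
    have hzf := coreSet_subset g i hz
    have hpush := isPushforwardOn_surfaceField d a hΩ i
    obtain ⟨P, hP⟩ := hpush.exists_equiv hzf
    have h1 := (isHamiltonianOn_liftedField d a hΩ i).hasDerivAt_form hpush hX h0 hψ hsm hzf
      (P.symm v) (P.symm w)
    simpa only [← hP, P.apply_symm_apply] using h1
  let Ψ : SymplecticFlow Ω :=
    { toFun := ψ
      field := surfaceField d a Ω
      smooth := hsm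
      map_zero := h0
      map_add := hadd
      generates := hψ
      preserves := flow_preserves h0 hsm hadd hinf }
  have hfix : Ψ.fixedPoints = {p | surfaceField d a Ω p = 0} :=
    Set.ext fun p => fixed_iff_field_eq_zero hX h0 hψ p
  refine ⟨Ψ, ?_, ?_, ?_, isClosed_of_primitive (exists_primitive d a hΩ), fun i => ⟨?_, ?_⟩⟩
  · rintro p ⟨T, hT, hp⟩
    rw [hfix]
    exact surfaceField_eq_zero_of_periodic d a hΩ hu huv ha' h0 hadd hψ hT hp
  · rw [hfix]
    exact encard_zeros d a hΩ
  · intro p hp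
    have hp0 : surfaceField d a Ω p = 0 := (fixed_iff_field_eq_zero hX h0 hψ p).1 hp
    obtain ⟨i, z, hz, rfl⟩ := d.exists_core p
    have hzf := coreSet_subset g i hz
    obtain ⟨c, hc, hzc⟩ := (surfaceField_eq_zero_iff d a hΩ hzf).1 hp0
    obtain ⟨κ, hκ, hD⟩ := fderiv_liftedField_saddle d a hΩ hzf hc hzc
    exact (isPushforwardOn_surfaceField d a hΩ i).isHyperbolicFixedPoint hX h0 hadd hψ hsm hzf hp
      hκ hD
  -- The vertical direction gives `Im (μ i * I) = Re (μ i) = u i`, and the horizontal one below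
  -- gives `Im (μ i) = v i`.
  · have h1 := fluxOn_line d a hΩ i (1 / 4) Complex.I fun s => Or.inl (by simp)
    rw [ha'] at h1
    exact h1.trans (by simp)
  · have h1 := fluxOn_line d a hΩ i (1 / 4 * Complex.I) 1 fun s => Or.inr (by simp)
    rw [ha'] at h1
    have h2 : d.loopB i = fun s : ℝ => d.param i (1 / 4 * Complex.I + s * 1) := by
      funext s
      rw [TorusSum.loopB, mul_one, add_comm]
    rw [h2]
    exact h1.trans (by simp)
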